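/- **Setting.** Let $M$ be a smooth manifold with boundary $\Sigma=\partial M$, $d=\dim M\ge 3$, with a conformal structure $c$ of any signature, and let $\sigma\in\Gamma\mathcal E[1]$ be a smooth density, $\sigma\ge 0$, with zero locus exactly $\Sigma$, whose scale tractor $I=\frac1d D\sigma$ ($D$ the tractor-D operator) has $I^2$ nowhere zero. Let $\mathcal E^\Phi$ be a tractor bundle (a tensor power of the standard tractor bundle, or a tensor part of one, with the tractor connection). For each integer $h_0\ge 1$ let $w_0$ be the weight with $h_0=d+2w_0$, and on weighted tractor fields put $x=\sigma$, $y=-\frac1{I^2}\,I\cdot D$, and $\colon z^k\colon=x^ky^k$ (extended linearly to power series in $z$). Set $$K^{h}(z)=\sum_{m\ge0}\frac{(-z)^m}{m!\,(m+1-h)_m},\qquad (k)_m=k(k-1)\cdots(k-m+1),\qquad \bar h_0=2-h_0,$$ $$F_{h_0-2}(z)=\sum_{k=0}^{h_0-2}\frac{z^k}{k!\,(h_0-2)_k}\quad(h_0\ge2),\qquad H(z)=\sum_{k\ge0}\gamma_kz^k,\qquad \gamma_0=\frac{h_0+1}{h_0^2},$$ $$\gamma_k=-\frac1{(k+1)(h_0+k)}\Big[\gamma_{k-1}+\frac{(-1)^{k+1}(h_0+2k+1)}{(k+1)!\,(h_0+k)_{k+1}}\Big]\quad(k\ge1).$$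 Let $\tau\in\Gamma\mathcal E[1]$ be a smooth positive scale on $M$ (up to the boundary), and let $(\log\tau\,y^{m})_{\rm W}=\frac12(\log\tau\,y^{m}+y^{m}\log\tau)$, where $y$ acts on log densities through the weight operator. A formal series $$f=\sum_{k\ge0}\sigma^kf_k+\sigma^{h_0-1}(\log\sigma-\log\tau)\sum_{j\ge0}\sigma^j\bar f_j ,$$ with $f_k\in\Gamma\mathcal E^\Phi[w_0-k]$ and $\bar f_j\in\Gamma\mathcal E^\Phi[-d-w_0+1-j]$ smooth up to the boundary, is an *infinite order solution* if for every $\ell\ge0$ the sum of its terms of order at most $\ell$ in $\sigma$ satisfies, off $\Sigma$, $I\cdot D f=O(\sigma^\ell)$ when $\ell<h_0-1$ and $I\cdot Df=O(\sigma^\ell)+O(\sigma^\ell\log\sigma)$ when $\ell\ge h_0-1$. Here $O(\sigma^\ell)$ means $\sigma^\ell$ times a section smooth up to the boundary, and $O(\sigma^\ell\log\sigma)$ means $\sigma^\ell\log\sigma$ times such a section. Two formal series are *equal* if for every $N$ their sums of terms of order at most $N$ differ by $O(\sigma^{N+1})+O(\sigma^{N+1}\log\sigma)$. **Theorem.** (1)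 Let $h_0\ge 2$ be an integer. For all $f_0\in\Gamma\mathcal E^\Phi[w_0]$ and all $\tau$, the formal series $\mathcal Of_0$, where $$\mathcal O=\colon F_{h_0-2}(z)\colon-\frac{\colon z^{h_0}H(z)\colon}{(h_0-1)!(h_0-2)!}-\frac{x^{h_0-1}\log x\,\colon K^{\bar h_0}(z)\colon\,y^{h_0-1}-x^{h_0-1}\,\colon K^{\bar h_0}(z)\colon\,(\log\tau\,y^{h_0-1})_{\rm W}}{(h_0-1)!(h_0-2)!},$$ is of the above form with leading coefficient the given $f_0$ and is an infinite order solution. It has no free term of order $h_0-1$: the coefficient of $x^{h_0-1}$ in $\mathcal O f_0$ is $$-\frac{1}{(h_0-1)!(h_0-2)!}\big(\log x\,y^{h_0-1}-(\log\tau\,y^{h_0-1})_{\rm W}\big)f_0,\qquad\text{and}\qquad \bar f_0=-\frac{1}{(h_0-1)!(h_0-2)!}\,y^{h_0-1}f_0 .$$ (2) Let $h_0=1$, so $w_0=\frac{1-d}2$. For all $\bar f_0\in\Gamma\mathcal E^\Phi[\frac{1-d}2]$ and all $\tau$, the formal series $\overline{\mathcal O}\bar f_0$, where $$\overline{\mathcal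 O}=\log x\,\colon J_0(2\sqrt z)\colon-\colon J_0(2\sqrt z)\colon\log\tau+\colon zH(z)\colon,\qquad J_0(2\sqrt z)=\sum_{m\ge0}\frac{(-z)^m}{(m!)^2},$$ is of the above form (with $h_0=1$), has $f_0=0$ and leading logarithmic coefficient the given $\bar f_0$, and is an infinite order solution. (3) In both cases the solution depends, as a formal series, only on $f_0|_\Sigma$ (respectively $\bar f_0|_\Sigma$) and $\tau|_\Sigma$: if $f_0,f_0'$ agree on $\Sigma$ and $\tau,\tau'$ agree on $\Sigma$, the two formal series are equal. Hence $\mathcal O$ and $\overline{\mathcal O}$ are well defined on data given along $\Sigma$. -/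

import Mathlib

open Bundle
open scoped Manifold ContDiff

/-!
# Degenerate Laplacian on conformally compact manifolds, and formal solutions with log terms

A conformal structure `c` is handled through an arbitrary metric `g ∈ c` (a *scale*).  The scale
trivialises the density bundles, so that a section of `𝓔^Φ[w]` *is* a section of the tractor
bundle `𝓔^Φ` together with the number `w`; the trivialisations given by `g` and by `e^{2Υ} g`
differ by the factor `e^{wΥ}`.  All operators are given by their expressions in the scale `g`.
-/

namespace TractorCalculus

noncomputable section

section Geometry

variable {E : Type*} [NormedAddCommGroup E] [NormedSpace ℝ E] [FiniteDimensional ℝ E]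
  {H : Type*} [TopologicalSpace H] {I : ModelWithCorners ℝ E H}
  {M : Type*} [TopologicalSpace M] [ChartedSpace H M] [IsManifold I ∞ M]

variable (I M) in
/-- A smooth pseudo-Riemannian metric, of any signature. -/
structure PseudoMetric where
  toFun : ∀ x : M, TangentSpace I x →L[ℝ] TangentSpace I x →L[ℝ] ℝ
  symm : ∀ (x : M) (v w : TangentSpace I x), toFun x v w = toFun x w v
  nondegenerate : ∀ (x : M) (v : TangentSpace I x), (∀ w, toFun x v w = 0) → v = 0
  contMDiff : ContMDiff I (I.prod 𝓘(ℝ, E →L[ℝ] E →L[ℝ] ℝ)) ∞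
    (fun x => TotalSpace.mk' (E →L[ℝ] E →L[ℝ] ℝ) x (toFun x))

/-- A basis of the tangent space at `x`. -/
def tangentBasis (x : M) : Module.Basis (Fin (Module.finrank ℝ E)) ℝ (TangentSpace I x) :=
  Module.finBasis ℝ E

/-- A local vector field, smooth near `x`, with value `v` at `x`. -/
abbrev ext {x : M} (v : TangentSpace I x) : ∀ y : M, TangentSpace I y :=
  FiberBundle.extend E v

/-- Linear map out of a tangent space with prescribed values on `tangentBasis`. -/
def ofBasis {W : Type*} [AddCommGroup W] [Module ℝ W] [TopologicalSpace W]
    [IsTopologicalAddGroup W] [ContinuousSMul ℝ W] (x : M)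
    (φ : Fin (Module.finrank ℝ E) → W) : TangentSpace I x →L[ℝ] W :=
  ((Module.finBasis ℝ E).constr ℝ φ : E →ₗ[ℝ] W).toContinuousLinearMap

/-- Raising an index: the inverse of `v ↦ g(v, ·)`. -/
def sharp (g : PseudoMetric I M) (x : M) : (TangentSpace I x →L[ℝ] ℝ) →L[ℝ] TangentSpace I x :=
  (g.toFun x).inverse

/-- The `g`-dual basis of `tangentBasis`: `g(dualVec i, b j) = δᵢⱼ`. -/
def dualVec (g : PseudoMetric I M) (x : M) (i : Fin (Module.finrank ℝ E)) : TangentSpace I x :=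
  sharp g x (ofBasis x (fun j => if j = i then (1 : ℝ) else 0))

/-- The trace `g^{ab} β_{ab}` of a bilinear form. -/
def metricTrace {W : Type*} [AddCommGroup W] (g : PseudoMetric I M) (x : M)
    (β : TangentSpace I x → TangentSpace I x → W) : W :=
  ∑ i, β (tangentBasis x i) (dualVec g x i)

/-- Koszul's expression for `g(∇_X Y, Z)`. -/
def koszul (g : PseudoMetric I M) (X Y Z : ∀ x : M, TangentSpace I x) (x : M) : ℝ :=
  (1 / 2) *
    (mvfderiv I (fun y => g.toFun y (Y y) (Z y)) x (X x)
      + mvfderiv I (fun y => g.toFun y (X y) (Z y)) x (Y x)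
      - mvfderiv I (fun y => g.toFun y (X y) (Y y)) x (Z x)
      + g.toFun x (VectorField.mlieBracket I X Y x) (Z x)
      - g.toFun x (VectorField.mlieBracket I X Z x) (Y x)
      - g.toFun x (VectorField.mlieBracket I Y Z x) (X x))

/-- The Levi-Civita connection: `leviCivita g Y x v` is `∇_v Y` at `x`. -/
def leviCivita (g : PseudoMetric I M) (Y : ∀ x : M, TangentSpace I x) (x : M) :
    TangentSpace I x →L[ℝ] TangentSpace I x :=
  ofBasis x fun i =>
    ∑ j, koszul g (ext (tangentBasis x i)) Y (ext (tangentBasis x j)) x • dualVec g x j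

/-- `R(X,Y)Z = ∇_X ∇_Y Z - ∇_Y ∇_X Z - ∇_{[X,Y]} Z`. -/
def curvature (g : PseudoMetric I M) (X Y Z : ∀ x : M, TangentSpace I x) (x : M) :
    TangentSpace I x :=
  leviCivita g (fun y => leviCivita g Z y (Y y)) x (X x)
    - leviCivita g (fun y => leviCivita g Z y (X y)) x (Y x)
    - leviCivita g Z x (VectorField.mlieBracket I X Y x)

/-- `Ric(v,w)`, the trace of `u ↦ R(u,v)w`. -/
def ricci (g : PseudoMetric I M) (x : M) (v w : TangentSpace I x) : ℝ :=
  ∑ i, (tangentBasis x).coord i (curvature g (ext (tangentBasis x i)) (ext v) (ext w) x)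

/-- The dimension `d`, as a real number. -/
def dimR (_ : PseudoMetric I M) : ℝ := Module.finrank ℝ E

/-- `J`, the trace of the Schouten tensor: `Sc = 2(d-1)J`. -/
def schoutenTrace (g : PseudoMetric I M) (x : M) : ℝ :=
  metricTrace g x (ricci g x) / (2 * (dimR g - 1))

/-- The Schouten tensor: `Ric = (d-2)P + J g`. -/
def schouten (g : PseudoMetric I M) (x : M) (v w : TangentSpace I x) : ℝ :=
  (ricci g x v w - schoutenTrace g x * g.toFun x v w) / (dimR g - 2)

/-! ### Weighted fields and the tractor D-operator -/

section Fields

variable {V : M → Type*} [∀ x, AddCommGroup (V x)] [∀ x, Module ℝ (V x)]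
  [∀ x, TopologicalSpace (V x)]

/-- The second covariant derivative `∇²_{v,w} s`, for `∇` coupled to the Levi-Civita connection. -/
def hessian (g : PseudoMetric I M) (cov : (∀ x, V x) → ∀ x, TangentSpace I x →L[ℝ] V x)
    (s : ∀ x, V x) (x : M) (v w : TangentSpace I x) : V x :=
  cov (fun y => cov s y (ext w y)) x v - cov s x (leviCivita g (ext w) x v)

/-- The coupled Laplacian `Δ = g^{ab} ∇_a ∇_b`. -/
def laplacian (g : PseudoMetric I M) (cov : (∀ x, V x) → ∀ x, TangentSpace I x →L[ℝ] V x)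
    (s : ∀ x, V x) (x : M) : V x :=
  metricTrace g x (hessian g cov s x)

/-- The tractor D-operator in the scale `g`,
`((d + 2𝐰 - 2)𝐰 s, (d + 2𝐰 - 2)∇ s, -(Δ + J𝐰) s)`.
The weight operator `𝐰` is the fibrewise endomorphism `W`. It is `w • id` on `𝓔^Φ[w]`; the form
used here also covers log densities, where `𝐰` is not diagonal. -/
def thomasD (g : PseudoMetric I M) (cov : (∀ x, V x) → ∀ x, TangentSpace I x →L[ℝ] V x)
    (W : ∀ x, V x →ₗ[ℝ] V x) (s : ∀ x, V x) (x : M) :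
    V x × (TangentSpace I x →L[ℝ] V x) × V x :=
  let s' : ∀ y, V y := fun y => (dimR g - 2) • s y + (2 : ℝ) • W y (s y)
  (W x (s' x), cov s' x, -(laplacian g cov s x + schoutenTrace g x • W x (s x)))

/-- The weight operator on `𝓔^Φ[w]`. -/
def weight (w : ℝ) (x : M) : V x →ₗ[ℝ] V x := w • LinearMap.id

/-- The exterior derivative of functions, as a connection on the trivial bundle. -/
def scalarCov (f : M → ℝ) (x : M) : TangentSpace I x →L[ℝ] ℝ := mvfderiv I f x

/-- The scale tractor `I = (1/d) D σ` of a density `σ` of weight one. -/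
def scaleTractor (g : PseudoMetric I M) (σ : M → ℝ) (x : M) :
    ℝ × (TangentSpace I x →L[ℝ] ℝ) × ℝ :=
  (dimR g)⁻¹ • thomasD (V := fun _ : M => ℝ) g scalarCov (weight 1) σ x

/-- `I² = h(I, I)`, with `h` the tractor metric `g⁻¹(μ,μ) + 2σρ`. -/
def scaleNormSq (g : PseudoMetric I M) (σ : M → ℝ) (x : M) : ℝ :=
  (scaleTractor g σ x).2.1 (sharp g x (scaleTractor g σ x).2.1)
    + 2 * (scaleTractor g σ x).1 * (scaleTractor g σ x).2.2

/-- The degenerate Laplacian `I · D`: the contraction of `I` and `D` by the tractor metric. -/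
def IdotD (g : PseudoMetric I M) (σ : M → ℝ)
    (cov : (∀ x, V x) → ∀ x, TangentSpace I x →L[ℝ] V x)
    (W : ∀ x, V x →ₗ[ℝ] V x) (s : ∀ x, V x) (x : M) : V x :=
  (scaleTractor g σ x).1 • (thomasD g cov W s x).2.2
    + (thomasD g cov W s x).2.1 (sharp g x (scaleTractor g σ x).2.1)
    + (scaleTractor g σ x).2.2 • (thomasD g cov W s x).1

/-- `y = -(1/I²) I · D`, an operator lowering the weight by one. -/
def yOp (g : PseudoMetric I M) (σ : M → ℝ)
    (cov : (∀ x, V x) → ∀ x, TangentSpace I x →L[ℝ] V x)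
    (W : ∀ x, V x →ₗ[ℝ] V x) (s : ∀ x, V x) (x : M) : V x :=
  -((scaleNormSq g σ x)⁻¹ • IdotD g σ cov W s x)

/-- The power `y^k` on fields with weight operator `W`; each factor lowers the weight by one. -/
def yPow (g : PseudoMetric I M) (σ : M → ℝ)
    (cov : (∀ x, V x) → ∀ x, TangentSpace I x →L[ℝ] V x)
    (W : ∀ x, V x →ₗ[ℝ] V x) : ℕ → (∀ x, V x) → ∀ x, V x
  | 0, s => s
  | k + 1, s => yOp g σ cov (fun x => W x - (k : ℝ) • LinearMap.id) (yPow g σ cov W k s)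

/-- Normal ordering: for `P = ∑ pₖ zᵏ` the expression `:P: s = ∑ xᵏ (pₖ yᵏ s)`, recorded by its
coefficient sequence with respect to the powers `xᵏ = σᵏ`. -/
def normalOrder (g : PseudoMetric I M) (σ : M → ℝ)
    (cov : (∀ x, V x) → ∀ x, TangentSpace I x →L[ℝ] V x)
    (W : ∀ x, V x →ₗ[ℝ] V x) (P : PowerSeries ℝ) (s : ∀ x, V x) : ℕ → ∀ x, V x :=
  fun k => PowerSeries.coeff k P • yPow g σ cov W k s

/-- Multiplication of a formal series in `x` by `x^m`. -/
def shift (m : ℕ) (a : ℕ → ∀ x, V x) : ℕ → ∀ x, V x :=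
  fun k => if m ≤ k then a (k - m) else 0

/-! ### Log densities

In the scale `g` a section of the ray bundle of metrics is `t² g`, and a density of weight `w`
is `t^w a`.  A section of the tensor product of `𝓔^Φ[w]` with log densities is
`t^w (a + b log t)`; it is recorded by the pair `(a, b)`.  The weight operator is `t ∂/∂t`, so that
`𝐰 (a, b) = (w a + b, w b)`, and `∇` acts on `a` and `b` separately.  A positive density `τ` of
weight one has `log τ = log τ_g + log t`. -/

/-- The weight operator `t ∂/∂t` on pairs `(a, b)` of weight `w`. -/
def logWeight (w : ℝ) (x : M) : (V x × V x) →ₗ[ℝ] (V x × V x) :=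
  (w • LinearMap.fst ℝ (V x) (V x) + LinearMap.snd ℝ (V x) (V x)).prod
    (w • LinearMap.snd ℝ (V x) (V x))

/-- The connection on pairs. -/
def logCov (cov : (∀ x, V x) → ∀ x, TangentSpace I x →L[ℝ] V x) (u : ∀ x, V x × V x) (x : M) :
    TangentSpace I x →L[ℝ] V x × V x :=
  (cov (fun y => (u y).1) x).prod (cov (fun y => (u y).2) x)

/-- A density seen as a pair. -/
def ofDensity (s : ∀ x, V x) : ∀ x, V x × V x := fun x => (s x, 0)

/-- Multiplication of a density by the log density `log τ`. -/
def logMul (τ : M → ℝ) (s : ∀ x, V x) : ∀ x, V x × V x :=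
  fun x => (Real.log (τ x) • s x, s x)

/-- A formal series `∑ xᵏ regₖ + log x ∑ xᵏ logxₖ`, with `x = σ`. -/
structure LogSeries (V : M → Type*) where
  reg : ℕ → ∀ x, V x × V x
  logx : ℕ → ∀ x, V x

/-! ### The solution operators -/

/-- The Weyl average `½ (log τ y^m + y^m log τ)` on densities of weight `w`. -/
def weylAverage (g : PseudoMetric I M) (σ : M → ℝ)
    (cov : (∀ x, V x) → ∀ x, TangentSpace I x →L[ℝ] V x) (w : ℝ) (τ : M → ℝ) (m : ℕ)
    (s : ∀ x, V x) : ∀ x, V x × V x :=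
  (1 / 2 : ℝ) • (logMul τ (yPow g σ cov (weight w) m s)
    + yPow g σ (logCov cov) (logWeight w) m (logMul τ s))

end Fields

/-- `K^h(z) = ∑ (-z)^m / (m! (m+1-h)_m)`, with `(k)_m = k(k-1)⋯(k-m+1)`. -/
def seriesK (h : ℝ) : PowerSeries ℝ :=
  PowerSeries.mk fun m =>
    (-1) ^ m / ((m.factorial : ℝ) * (descPochhammer ℝ m).eval ((m : ℝ) + 1 - h))

/-- The Taylor series of `J₀(2√z)`. -/
def seriesJ0 : PowerSeries ℝ :=
  PowerSeries.mk fun m => (-1) ^ m / (m.factorial : ℝ) ^ 2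

/-- The polynomial `F_{h-2}(z) = ∑_{k ≤ h-2} z^k / (k! (h-2)(h-3)⋯(h-1-k))`, for `h ≥ 2`. -/
def polyF (h : ℕ) : Polynomial ℝ :=
  ∑ k ∈ Finset.range (h - 1),
    Polynomial.monomial k (1 / ((k.factorial : ℝ) * ((h - 2).descFactorial k : ℝ)))

/-- The coefficients `γ_k` of `H(z)`, where `h` is the parameter `h₀`. -/
def gammaH (h : ℕ) : ℕ → ℝ
  | 0 => ((h : ℝ) + 1) / (h : ℝ) ^ 2
  | k + 1 => -(1 / (((k : ℝ) + 2) * ((h : ℝ) + k + 1))) *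
      (gammaH h k + (-1) ^ (k + 2) * ((h : ℝ) + 2 * k + 3)
        / (((k + 2).factorial : ℝ) * (descPochhammer ℝ (k + 2)).eval ((h : ℝ) + k + 1)))

/-- The power series `H(z) = ∑ γ_k z^k`. -/
def seriesH (h : ℕ) : PowerSeries ℝ := PowerSeries.mk (gammaH h)

section Solutions

variable {V : M → Type*} [∀ x, AddCommGroup (V x)] [∀ x, Module ℝ (V x)]
  [∀ x, TopologicalSpace (V x)]

/-- The weight `w₀` with `h₀ = d + 2 w₀`. -/
def weightOf (g : PseudoMetric I M) (h : ℕ) : ℝ := ((h : ℝ) - dimR g) / 2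

/-- The solution operator for integral `h ≥ 2`: with `c = 1 / ((h-1)! (h-2)!)`,
`𝒪 = :F: - c :z^h H: - c (x^{h-1} log x :K: y^{h-1} - x^{h-1} :K: (log τ y^{h-1})_W)`,
where `K = K^{2-h}`. -/
def solO (g : PseudoMetric I M) (σ : M → ℝ)
    (cov : (∀ x, V x) → ∀ x, TangentSpace I x →L[ℝ] V x) (h : ℕ) (τ : M → ℝ)
    (f₀ : ∀ x, V x) : LogSeries V :=
  let w₀ := weightOf g h
  let w₁ := w₀ - ((h - 1 : ℕ) : ℝ)
  let c : ℝ := 1 / (((h - 1).factorial : ℝ) * ((h - 2).factorial : ℝ))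
  { reg := fun k =>
      ofDensity (normalOrder g σ cov (weight w₀) (polyF h : PowerSeries ℝ) f₀ k)
        - c • ofDensity (normalOrder g σ cov (weight w₀)
            (PowerSeries.X ^ h * seriesH h) f₀ k)
        + c • shift (h - 1) (normalOrder g σ (logCov cov) (logWeight w₁) (seriesK (2 - (h : ℝ)))
            (weylAverage g σ cov w₀ τ (h - 1) f₀)) k
    logx := fun k =>
      -(c • shift (h - 1) (normalOrder g σ cov (weight w₁) (seriesK (2 - (h : ℝ)))
            (yPow g σ cov (weight w₀) (h - 1) f₀)) k) }

/-- The solution operator for `h₀ = 1`, that is, on weight `(1-d)/2`: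
`log x :J₀(2√z): - :J₀(2√z): log τ + :z H(z):`. -/
def solObar (g : PseudoMetric I M) (σ : M → ℝ)
    (cov : (∀ x, V x) → ∀ x, TangentSpace I x →L[ℝ] V x) (τ : M → ℝ)
    (f₀ : ∀ x, V x) : LogSeries V :=
  let w₀ := weightOf g 1
  { reg := fun k =>
      -normalOrder g σ (logCov cov) (logWeight w₀) seriesJ0 (logMul τ f₀) k
        + ofDensity (normalOrder g σ cov (weight w₀) (PowerSeries.X * seriesH 1) f₀ k)
    logx := normalOrder g σ cov (weight w₀) seriesJ0 f₀ }

/-- `u` is the formal series `∑ xᵏ fₖ + x^{h-1} (log x - log τ) ∑ xʲ f̄ⱼ`, whose coefficients are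
densities. -/
def LogSeries.HasForm (u : LogSeries V) (h : ℕ) (τ : M → ℝ) (f fbar : ℕ → ∀ x, V x) : Prop :=
  (∀ k, u.reg k = ofDensity (f k) - logMul τ (shift (h - 1) fbar k)) ∧
    ∀ k, u.logx k = shift (h - 1) fbar k

/-- The terms of order at most `ℓ` of `∑ σᵏ fₖ + σ^{h-1} (log σ - log τ) ∑ σʲ f̄ⱼ`. -/
def truncation (σ : M → ℝ) (h : ℕ) (τ : M → ℝ) (f fbar : ℕ → ∀ x, V x) (ℓ : ℕ) :
    ∀ x, V x :=
  fun x => ∑ k ∈ Finset.range (ℓ + 1), σ x ^ k •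
    (f k x + (Real.log (σ x) - Real.log (τ x)) • shift (h - 1) fbar k x)

/-- The terms of order at most `N` of a formal series, as a section in the scale `g` (`t = 1`). -/
def LogSeries.partialSum (σ : M → ℝ) (u : LogSeries V) (N : ℕ) : ∀ x, V x :=
  fun x => ∑ k ∈ Finset.range (N + 1), σ x ^ k •
    ((u.reg k x).1 + Real.log (σ x) • u.logx k x)

variable (F : Type*) [NormedAddCommGroup F] [NormedSpace ℝ F]
  [TopologicalSpace (TotalSpace F V)] [FiberBundle F V]

variable (I) in
/-- Smoothness (up to the boundary) of a section. -/
def SmoothSection (s : ∀ x, V x) : Prop :=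
  ContMDiff I (I.prod 𝓘(ℝ, F)) ∞ (fun x => TotalSpace.mk' F x (s x))

/-- The log-type problem, solved to infinite order: with smooth coefficients `fₖ`, `f̄ⱼ`, for every
`ℓ` the truncation at order `ℓ` satisfies `I·D f = O(σ^ℓ)` when `ℓ < h-1`, and
`I·D f = O(σ^ℓ) + O(σ^ℓ log σ)` when `ℓ ≥ h-1`, off the zero locus of `σ`.  Here `O(σ^ℓ)`
stands for `σ^ℓ` times a section that is smooth up to the boundary. -/
def IsInfiniteOrderSolution (g : PseudoMetric I M) (σ : M → ℝ)
    (cov : (∀ x, V x) → ∀ x, TangentSpace I x →L[ℝ] V x) (h : ℕ) (τ : M → ℝ)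
    (f fbar : ℕ → ∀ x, V x) : Prop :=
  (∀ k, SmoothSection I F (f k)) ∧ (∀ j, SmoothSection I F (fbar j)) ∧
    ∀ ℓ : ℕ, ∃ p q : ∀ x, V x, SmoothSection I F p ∧ SmoothSection I F q ∧
      (ℓ < h - 1 → q = 0) ∧
      ∀ x, 0 < σ x →
        IdotD g σ cov (weight (weightOf g h)) (truncation σ h τ f fbar ℓ) x
          = σ x ^ ℓ • p x + (σ x ^ ℓ * Real.log (σ x)) • q x

variable (I) in
/-- Equality of formal series: the partial sums agree to all orders along the zero locus of `σ`,
up to terms `O(σ^{N+1}) + O(σ^{N+1} log σ)`. -/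
def FormallyEqual (σ : M → ℝ) (u v : LogSeries V) : Prop :=
  ∀ N : ℕ, ∃ p q : ∀ x, V x, SmoothSection I F p ∧ SmoothSection I F q ∧
    ∀ x, 0 < σ x →
      u.partialSum σ N x - v.partialSum σ N x
        = σ x ^ (N + 1) • p x + (σ x ^ (N + 1) * Real.log (σ x)) • q x

end Solutions

/-! ### Tractor bundles -/

variable (I) in
/-- The fibre of the standard tractor bundle in the scale `g`: triples `(σ, μᵃ, ρ)`, the middle slot
being identified with a one-form by the metric. -/
abbrev TractorFibre (x : M) : Type _ := ℝ × TangentSpace I x × ℝ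

/-- The normal tractor connection,
`∇_v (σ, μ, ρ) = (∇_v σ - g(v,μ), ∇_v μ + ρ v + σ P(v), ∇_v ρ - P(v,μ))`. -/
def tractorCov (g : PseudoMetric I M) (t : ∀ x : M, TractorFibre I x) (x : M)
    (v : TangentSpace I x) : TractorFibre I x :=
  ( mvfderiv I (fun y => (t y).1) x v - g.toFun x v (t x).2.1,
    leviCivita g (fun y => (t y).2.1) x v + (t x).2.2 • v
      + (t x).1 • ∑ j, schouten g x v (tangentBasis x j) • dualVec g x j,
    mvfderiv I (fun y => (t y).2.2) x v - schouten g x v (t x).2.1 )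

/-- Smoothness of a section of the standard tractor bundle. -/
def SmoothTractor (t : ∀ x : M, TractorFibre I x) : Prop :=
  ContMDiff I 𝓘(ℝ, ℝ) ∞ (fun x => (t x).1) ∧
    SmoothSection I E (fun x => (t x).2.1) ∧
    ContMDiff I 𝓘(ℝ, ℝ) ∞ (fun x => (t x).2.2)

/-- A vector bundle with connection is a *tractor bundle* if it is, for some `k`, (a tensor part of)
the `k`-th tensor power of the standard tractor bundle with the tractor connection: it embeds
smoothly and parallelly into the bundle of complex valued `k`-linear forms on standard tractors
(the standard tractor bundle is self-dual by the tractor metric). -/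
def IsTractorBundle (F : Type*) [NormedAddCommGroup F] [NormedSpace ℝ F]
    {V : M → Type*} [TopologicalSpace (TotalSpace F V)]
    [∀ x, AddCommGroup (V x)] [∀ x, Module ℝ (V x)] [∀ x, TopologicalSpace (V x)]
    [FiberBundle F V] (g : PseudoMetric I M)
    (cov : (∀ x, V x) → ∀ x, TangentSpace I x →L[ℝ] V x) : Prop :=
  ∃ (k : ℕ) (ι : ∀ x, V x →ₗ[ℝ] MultilinearMap ℝ (fun _ : Fin k => TractorFibre I x) ℂ),
    (∀ x, Function.Injective (ι x)) ∧
    ∀ (s : ∀ x, V x) (t : Fin k → ∀ x : M, TractorFibre I x),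
      SmoothSection I F s → (∀ i, SmoothTractor (t i)) →
        ContMDiff I 𝓘(ℝ, ℂ) ∞ (fun x => ι x (s x) (fun i => t i x)) ∧
        ∀ (x : M) (v : TangentSpace I x),
          mvfderiv I (fun y => ι y (s y) (fun i => t i y)) x v
            = ι x (cov s x v) (fun i => t i x)
              + ∑ i, ι x (s x) (Function.update (fun j => t j x) i (tractorCov g (t i) x v))

end Geometry

end

end TractorCalculus

/-!
With `x` multiplication by `σ` and `y = -(1/I²) I·D` one has, on weight `w`, `[y, x] = -(d + 2w)`.
Iterating, `y` sends `xᵏ⁺¹ yᵏ⁺¹ f₀` to `xᵏ⁺¹ yᵏ⁺² f₀` plus a multiple of `xᵏ yᵏ⁺¹ f₀`, and the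
coefficients of `𝒪` satisfy precisely the recurrences that make consecutive terms cancel: applied
to a truncation of the series, `y` leaves only its last term.

A logarithm makes the weight operator non-diagonal, with square-zero nilpotent part, so that a log
density is a pair on which `y` acts as a matrix `[[y, ∂y], [0, y]]`, where `∂y` is the derivative of
`y` in the weight.  Near an interior point the terms with `log σ` obey the same calculus, except
for a contribution of the pole of `d (log σ)`, and this is what the coefficients `γₖ` of `H`
compensate.

Two data that agree along `Σ` differ by a multiple of `σ`, because `I² ≠ 0` forces `dσ ≠ 0` there.
On data of the form `x v` the terms of the series again telescope, and its truncations are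
`O(σᴺ⁺¹)` up to a factor `log σ`.
-/

namespace TractorCalculus

open scoped Topology

noncomputable section

/-! ### The metric and its Levi-Civita connection -/

section Pointwise

variable {E : Type*} [NormedAddCommGroup E] [NormedSpace ℝ E]
  {H : Type*} [TopologicalSpace H] {I : ModelWithCorners ℝ E H}
  {M : Type*} [TopologicalSpace M] [ChartedSpace H M]

lemma ofBasis_apply [FiniteDimensional ℝ E] {W : Type*} [AddCommGroup W] [Module ℝ W]
    [TopologicalSpace W] [IsTopologicalAddGroup W] [ContinuousSMul ℝ W] (x : M)
    (φ : Fin (Module.finrank ℝ E) → W) (v : TangentSpace I x) :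
    ofBasis x φ v = ∑ i, (tangentBasis x).repr v i • φ i :=
  Module.Basis.constr_apply_fintype (S := ℝ) (Module.finBasis ℝ E) φ v

variable [IsManifold I ∞ M]

lemma metric_ext (g : PseudoMetric I M) (x : M) {v v' : TangentSpace I x}
    (h : ∀ w, g.toFun x v w = g.toFun x v' w) : v = v' := by
  rw [← sub_eq_zero]
  refine g.nondegenerate x _ fun w => ?_
  simp [h w]

lemma metric_ext_basis (g : PseudoMetric I M) (x : M) {ι : Type*}
    (b : Module.Basis ι ℝ (TangentSpace I x)) {v v' : TangentSpace I x}
    (h : ∀ j, g.toFun x v (b j) = g.toFun x v' (b j)) : v = v' := by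
  refine metric_ext g x fun w => ?_
  have : (g.toFun x v : TangentSpace I x →ₗ[ℝ] ℝ) = (g.toFun x v' : TangentSpace I x →ₗ[ℝ] ℝ) :=
    b.ext fun j => by simpa using h j
  exact congrArg (fun φ : TangentSpace I x →ₗ[ℝ] ℝ => φ w) this

/-- The Gram matrix of a family of vectors. -/
def gram (g : PseudoMetric I M) (x : M) {ι : Type*} (c : ι → TangentSpace I x) : Matrix ι ι ℝ :=
  Matrix.of fun i j => g.toFun x (c i) (c j)

section Gram

variable {ι : Type*} [Fintype ι] [DecidableEq ι]

lemma gram_inv_symm (g : PseudoMetric I M) (x : M) (c : ι → TangentSpace I x) (i j : ι) :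
    (gram g x c)⁻¹ i j = (gram g x c)⁻¹ j i := by
  have h : (gram g x c).transpose = gram g x c := by
    ext i j
    simp [gram, g.symm x]
  conv_lhs => rw [← h, ← Matrix.transpose_nonsing_inv]
  rfl

lemma isUnit_det_gram (g : PseudoMetric I M) (x : M)
    (c : Module.Basis ι ℝ (TangentSpace I x)) : IsUnit (gram g x c).det := by
  rw [isUnit_iff_ne_zero]
  intro h0
  obtain ⟨v, hv, hvG⟩ := Matrix.exists_vecMul_eq_zero_iff.mpr h0
  have h : ∑ i, v i • c i = 0 := by
    refine metric_ext_basis g x c fun j => ?_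
    have := congrFun hvG j
    simpa [Matrix.vecMul, dotProduct, gram] using this
  exact hv (funext (Fintype.linearIndependent_iff.mp c.linearIndependent v h))

lemma sum_gram_inv (g : PseudoMetric I M) (x : M)
    (c : Module.Basis ι ℝ (TangentSpace I x)) (v : TangentSpace I x) :
    ∑ i, ∑ j, ((gram g x c)⁻¹ i j * g.toFun x v (c i)) • c j = v := by
  refine metric_ext_basis g x c fun k => ?_
  have h : ∀ i, ∑ j, (gram g x c)⁻¹ i j * gram g x c j k = if i = k then 1 else 0 := fun i => by
    rw [← Matrix.mul_apply, Matrix.nonsing_inv_mul _ (isUnit_det_gram g x c), Matrix.one_apply]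
  simp only [map_sum, map_smul, sum_apply, smul_apply, smul_eq_mul]
  calc _ = ∑ i, g.toFun x v (c i) * ∑ j, (gram g x c)⁻¹ i j * gram g x c j k := by
        refine Finset.sum_congr rfl fun i _ => ?_
        rw [Finset.mul_sum]
        refine Finset.sum_congr rfl fun j _ => ?_
        simp only [gram, Matrix.of_apply]
        ring
    _ = _ := by simp [h]

end Gram

variable [FiniteDimensional ℝ E]

lemma isInvertible_metric (g : PseudoMetric I M) (x : M) :
    ContinuousLinearMap.IsInvertible (M := TangentSpace I x)
      (M₂ := TangentSpace I x →L[ℝ] ℝ) (g.toFun x) := by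
  let B : E →L[ℝ] E →L[ℝ] ℝ := g.toFun x
  have hinj : Function.Injective (B : E →ₗ[ℝ] E →L[ℝ] ℝ) := fun v v' h =>
    metric_ext g x fun w => DFunLike.congr_fun h w
  have hdim : Module.finrank ℝ E = Module.finrank ℝ (E →L[ℝ] ℝ) := by
    rw [← LinearEquiv.finrank_eq (LinearMap.toContinuousLinearMap (𝕜 := ℝ) (E := E) (F' := ℝ))]
    exact (Subspace.dual_finrank_eq (K := ℝ) (V := E)).symm
  exact ⟨(LinearEquiv.ofInjectiveOfFinrankEq _ hinj hdim).toContinuousLinearEquiv, rfl⟩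

@[simp] lemma toFun_sharp (g : PseudoMetric I M) (x : M) (α : TangentSpace I x →L[ℝ] ℝ) :
    g.toFun x (sharp g x α) = α :=
  (isInvertible_metric g x).self_apply_inverse α

@[simp] lemma metric_dualVec (g : PseudoMetric I M) (x : M) (i j : Fin (Module.finrank ℝ E)) :
    g.toFun x (dualVec g x i) (tangentBasis x j) = if j = i then 1 else 0 := by
  rw [dualVec, toFun_sharp, ofBasis_apply]
  simp [Finsupp.single_apply]

lemma sum_metric_smul_dualVec (g : PseudoMetric I M) (x : M) (v : TangentSpace I x) :
    ∑ i, g.toFun x (tangentBasis x i) v • dualVec g x i = v := by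
  refine metric_ext_basis g x (tangentBasis x) fun j => ?_
  simp [g.symm x v]

variable {W : Type*} [AddCommGroup W] [Module ℝ W]

lemma metricTrace_eq_sum (g : PseudoMetric I M) (x : M) {ι : Type*} [Fintype ι] [DecidableEq ι]
    (c : Module.Basis ι ℝ (TangentSpace I x))
    (β : TangentSpace I x →ₗ[ℝ] TangentSpace I x →ₗ[ℝ] W) :
    metricTrace g x (fun v w => β v w)
      = ∑ i, ∑ j, (gram g x c)⁻¹ i j • β (c i) (c j) := by
  have h1 : ∀ k, β (tangentBasis x k) (dualVec g x k)
      = ∑ i, ∑ j, (gram g x c)⁻¹ i j •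
          β (c j) (g.toFun x (tangentBasis x k) (c i) • dualVec g x k) := fun k => by
    conv_lhs => rw [← sum_gram_inv g x c (tangentBasis x k)]
    simp [LinearMap.sum_apply, mul_smul]
  calc metricTrace g x (fun v w => β v w)
      = ∑ i, ∑ j, (gram g x c)⁻¹ i j •
          β (c j) (∑ k, g.toFun x (tangentBasis x k) (c i) • dualVec g x k) := by
        rw [metricTrace, Finset.sum_congr rfl fun k _ => h1 k, Finset.sum_comm]
        refine Finset.sum_congr rfl fun i _ => ?_
        rw [Finset.sum_comm]
        refine Finset.sum_congr rfl fun j _ => ?_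
        rw [map_sum, Finset.smul_sum]
    _ = ∑ i, ∑ j, (gram g x c)⁻¹ j i • β (c j) (c i) := by
        simp_rw [sum_metric_smul_dualVec, gram_inv_symm g x c]
    _ = _ := Finset.sum_comm

lemma metricTrace_flip (g : PseudoMetric I M) (x : M)
    (β : TangentSpace I x →ₗ[ℝ] TangentSpace I x →ₗ[ℝ] W) :
    metricTrace g x (fun v w => β w v) = metricTrace g x (fun v w => β v w) := by
  refine (metricTrace_eq_sum g x (tangentBasis x) β.flip).trans ?_
  rw [metricTrace_eq_sum g x (tangentBasis x) β, Finset.sum_comm]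
  simp_rw [LinearMap.flip_apply, gram_inv_symm g x (tangentBasis x)]

lemma metricTrace_smul_left (g : PseudoMetric I M) (x : M) (α : TangentSpace I x →L[ℝ] ℝ)
    (ψ : TangentSpace I x →ₗ[ℝ] W) :
    metricTrace g x (fun v w => α v • ψ w) = ψ (sharp g x α) := by
  calc metricTrace g x (fun v w => α v • ψ w)
      = ψ (∑ i, g.toFun x (tangentBasis x i) (sharp g x α) • dualVec g x i) := by
        simp_rw [metricTrace, map_sum, map_smul, g.symm x (tangentBasis x _), toFun_sharp]
    _ = ψ (sharp g x α) := by rw [sum_metric_smul_dualVec]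

lemma metricTrace_smul_right (g : PseudoMetric I M) (x : M) (α : TangentSpace I x →L[ℝ] ℝ)
    (ψ : TangentSpace I x →ₗ[ℝ] W) :
    metricTrace g x (fun v w => α w • ψ v) = ψ (sharp g x α) :=
  (metricTrace_flip g x ((α : TangentSpace I x →ₗ[ℝ] ℝ).smulRight ψ)).trans
    (metricTrace_smul_left g x α ψ)

end Pointwise

section Connection

variable {E : Type*} [NormedAddCommGroup E] [NormedSpace ℝ E]
  {H : Type*} [TopologicalSpace H] {I : ModelWithCorners ℝ E H}
  {M : Type*} [TopologicalSpace M] [ChartedSpace H M] [IsManifold I ∞ M]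

variable (I M) in
lemma isManifold_one : IsManifold I 1 M := IsManifold.of_le (n := ∞) (by simp)

variable (I M) in
lemma isManifold_minSmoothness : IsManifold I (minSmoothness ℝ 3) M := IsManifold.of_le (n := ∞) (by
  rw [minSmoothness_of_isRCLikeNormedField]
  exact WithTop.coe_le_coe.mpr le_top)

attribute [local instance] isManifold_one isManifold_minSmoothness

lemma contMDiffAt_mvfderiv {f : M → ℝ} {x : M} (hf : CMDiffAt ∞ f x) :
    ContMDiffAt I (I.prod 𝓘(ℝ, E →L[ℝ] ℝ)) ∞
      (fun y => TotalSpace.mk' (E →L[ℝ] ℝ)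
        (E := fun y : M => TangentSpace I y →L[ℝ] Bundle.Trivial M ℝ y) y (mvfderiv I f y)) x := by
  rw [contMDiffAt_hom_bundle]
  refine ⟨contMDiffAt_id, ?_⟩
  refine (hf.mfderiv_const (m := ∞) (by simp)).congr_of_eventuallyEq ?_
  filter_upwards with y
  ext v
  simp [ContinuousLinearMap.inCoordinates, inTangentCoordinates, mvfderiv]
  rfl

lemma contMDiffAt_mvfderiv_apply {f : M → ℝ} {X : ∀ x : M, TangentSpace I x} {x : M}
    (hf : CMDiffAt ∞ f x) (hX : CMDiffAt ∞ (T% X) x) :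
    CMDiffAt ∞ (fun y => mvfderiv I f y (X y)) x := by
  have := (contMDiffAt_mvfderiv hf).clm_bundle_apply (F₁ := E) hX
  simp only [contMDiffAt_totalSpace] at this
  exact this.2

lemma mdifferentiableAt_mvfderiv_apply {f : M → ℝ} {X : ∀ x : M, TangentSpace I x} {x : M}
    (hf : CMDiffAt ∞ f x) (hX : MDiffAt (T% X) x) :
    MDiffAt (fun y => mvfderiv I f y (X y)) x := by
  have := ((contMDiffAt_mvfderiv hf).mdifferentiableAt (by simp)).clm_bundle_apply (F₁ := E) hX
  simp only [mdifferentiableAt_totalSpace] at this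
  exact this.2

lemma contMDiffAt_metric (g : PseudoMetric I M) {X Y : ∀ x : M, TangentSpace I x} {x : M}
    (hX : CMDiffAt ∞ (T% X) x) (hY : CMDiffAt ∞ (T% Y) x) :
    CMDiffAt ∞ (fun y => g.toFun y (X y) (Y y)) x := by
  have : ContMDiffAt I (I.prod 𝓘(ℝ)) ∞
      (fun m ↦ TotalSpace.mk' ℝ (E := Bundle.Trivial M ℝ) m (g.toFun m (X m) (Y m))) x :=
    ContMDiffAt.clm_bundle_apply₂ (F₁ := E) (F₂ := E) g.contMDiff.contMDiffAt hX hY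
  simp only [contMDiffAt_totalSpace] at this
  exact this.2

lemma mdifferentiableAt_metric (g : PseudoMetric I M) {X Y : ∀ x : M, TangentSpace I x} {x : M}
    (hX : MDiffAt (T% X) x) (hY : MDiffAt (T% Y) x) :
    MDiffAt (fun y => g.toFun y (X y) (Y y)) x := by
  have : MDifferentiableAt I (I.prod 𝓘(ℝ))
      (fun m ↦ TotalSpace.mk' ℝ (E := Bundle.Trivial M ℝ) m (g.toFun m (X m) (Y m))) x :=
    MDifferentiableAt.clm_bundle_apply₂ (F₁ := E) (F₂ := E)
      (g.contMDiff.contMDiffAt.mdifferentiableAt (by simp)) hX hY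
  simp only [mdifferentiableAt_totalSpace] at this
  exact this.2

lemma mvfderiv_metric_add_left (g : PseudoMetric I M) {X X' Y : ∀ x : M, TangentSpace I x} {x : M}
    (hX : MDiffAt (T% X) x) (hX' : MDiffAt (T% X') x) (hY : MDiffAt (T% Y) x) :
    mvfderiv I (fun y => g.toFun y ((X + X') y) (Y y)) x
      = mvfderiv I (fun y => g.toFun y (X y) (Y y)) x
        + mvfderiv I (fun y => g.toFun y (X' y) (Y y)) x := by
  rw [← mvfderiv_add (mdifferentiableAt_metric g hX hY) (mdifferentiableAt_metric g hX' hY)]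
  congr 1
  ext y
  simp

lemma mvfderiv_metric_add_right (g : PseudoMetric I M) {X Y Y' : ∀ x : M, TangentSpace I x} {x : M}
    (hX : MDiffAt (T% X) x) (hY : MDiffAt (T% Y) x) (hY' : MDiffAt (T% Y') x) :
    mvfderiv I (fun y => g.toFun y (X y) ((Y + Y') y)) x
      = mvfderiv I (fun y => g.toFun y (X y) (Y y)) x
        + mvfderiv I (fun y => g.toFun y (X y) (Y' y)) x := by
  simp_rw [g.symm _ (X _)]
  exact mvfderiv_metric_add_left g hY hY' hX

lemma mvfderiv_metric_smul_left (g : PseudoMetric I M) {X Y : ∀ x : M, TangentSpace I x}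
    {f : M → ℝ} {x : M} (hf : MDiffAt f x) (hX : MDiffAt (T% X) x) (hY : MDiffAt (T% Y) x)
    (v : TangentSpace I x) :
    mvfderiv I (fun y => g.toFun y ((f • X) y) (Y y)) x v
      = f x * mvfderiv I (fun y => g.toFun y (X y) (Y y)) x v
        + mvfderiv I f x v * g.toFun x (X x) (Y x) := by
  have h : (fun y => g.toFun y ((f • X) y) (Y y)) = f • fun y => g.toFun y (X y) (Y y) := by
    ext y; simp
  rw [h, mvfderiv_smul hf (mdifferentiableAt_metric g hX hY)]
  rfl

lemma mvfderiv_metric_smul_right (g : PseudoMetric I M) {X Y : ∀ x : M, TangentSpace I x}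
    {f : M → ℝ} {x : M} (hf : MDiffAt f x) (hX : MDiffAt (T% X) x) (hY : MDiffAt (T% Y) x)
    (v : TangentSpace I x) :
    mvfderiv I (fun y => g.toFun y (X y) ((f • Y) y)) x v
      = f x * mvfderiv I (fun y => g.toFun y (X y) (Y y)) x v
        + mvfderiv I f x v * g.toFun x (X x) (Y x) := by
  simp_rw [g.symm _ (X _)]
  exact mvfderiv_metric_smul_left g hf hY hX v

lemma mdifferentiableAt_ext {x : M} (v : TangentSpace I x) : MDiffAt (T% (ext v)) x :=
  FiberBundle.mdifferentiableAt_extend I E v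

lemma ext_apply_self {x : M} (v : TangentSpace I x) : ext v x = v :=
  FiberBundle.extend_apply_self (F := E) v

variable [FiniteDimensional ℝ E]

lemma contMDiffAt_mlieBracket {X Y : ∀ x : M, TangentSpace I x} {x : M}
    (hX : CMDiffAt ∞ (T% X) x) (hY : CMDiffAt ∞ (T% Y) x) :
    CMDiffAt ∞ (T% (VectorField.mlieBracket I X Y)) x := by
  have : IsManifold I (((⊤ : ℕ∞) : WithTop ℕ∞) + 1) M := inferInstanceAs (IsManifold I ∞ M)
  refine ContMDiffAt.mlieBracket_vectorField (n := ⊤) (m := ⊤) hX hY ?_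
  rw [minSmoothness_of_isRCLikeNormedField]
  exact le_rfl

lemma koszul_tensorial_left (g : PseudoMetric I M) {Y Z : ∀ x : M, TangentSpace I x} {x : M}
    (hY : MDiffAt (T% Y) x) (hZ : MDiffAt (T% Z) x) :
    TensorialAt I E (fun X => koszul g X Y Z x) x where
  smul {f X} hf hX := by
    simp only [koszul]
    rw [mvfderiv_metric_smul_left g hf hX hZ, mvfderiv_metric_smul_left g hf hX hY,
      VectorField.mlieBracket_smul_left hf hX, VectorField.mlieBracket_smul_left hf hX]
    simp only [Pi.smul_apply', map_add, map_smul, add_apply, smul_apply, smul_eq_mul, neg_smul,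
      map_neg, neg_apply]
    ring
  add {X X'} hX hX' := by
    simp only [koszul]
    rw [mvfderiv_metric_add_left g hX hX' hZ, mvfderiv_metric_add_left g hX hX' hY,
      VectorField.mlieBracket_add_left hX hX', VectorField.mlieBracket_add_left hX hX']
    simp only [Pi.add_apply, map_add, add_apply]
    ring

lemma koszul_tensorial_right (g : PseudoMetric I M) {X Y : ∀ x : M, TangentSpace I x} {x : M}
    (hX : MDiffAt (T% X) x) (hY : MDiffAt (T% Y) x) :
    TensorialAt I E (fun Z => koszul g X Y Z x) x where
  smul {f Z} hf hZ := by
    simp only [koszul]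
    rw [mvfderiv_metric_smul_right g hf hX hZ, mvfderiv_metric_smul_right g hf hY hZ,
      VectorField.mlieBracket_smul_right hf hZ, VectorField.mlieBracket_smul_right hf hZ]
    simp only [Pi.smul_apply', map_add, map_smul, add_apply, smul_apply, smul_eq_mul,
      g.symm x (Z x)]
    ring
  add {Z Z'} hZ hZ' := by
    simp only [koszul]
    rw [mvfderiv_metric_add_right g hX hZ hZ', mvfderiv_metric_add_right g hY hZ hZ',
      VectorField.mlieBracket_add_right hZ hZ', VectorField.mlieBracket_add_right hZ hZ']
    simp only [Pi.add_apply, map_add, add_apply]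
    ring

lemma koszul_add (g : PseudoMetric I M) {X Y Y' Z : ∀ x : M, TangentSpace I x} {x : M}
    (hX : MDiffAt (T% X) x) (hY : MDiffAt (T% Y) x) (hY' : MDiffAt (T% Y') x)
    (hZ : MDiffAt (T% Z) x) :
    koszul g X (Y + Y') Z x = koszul g X Y Z x + koszul g X Y' Z x := by
  simp only [koszul]
  rw [mvfderiv_metric_add_left g hY hY' hZ, mvfderiv_metric_add_right g hX hY hY',
    VectorField.mlieBracket_add_right hY hY', VectorField.mlieBracket_add_left hY hY']
  simp only [Pi.add_apply, map_add, add_apply]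
  ring

lemma koszul_leibniz (g : PseudoMetric I M) {X Y Z : ∀ x : M, TangentSpace I x} {f : M → ℝ} {x : M}
    (hf : MDiffAt f x) (hX : MDiffAt (T% X) x) (hY : MDiffAt (T% Y) x) (hZ : MDiffAt (T% Z) x) :
    koszul g X (f • Y) Z x
      = f x * koszul g X Y Z x + mvfderiv I f x (X x) * g.toFun x (Y x) (Z x) := by
  simp only [koszul]
  rw [mvfderiv_metric_smul_left g hf hY hZ, mvfderiv_metric_smul_right g hf hX hY,
    VectorField.mlieBracket_smul_right hf hY, VectorField.mlieBracket_smul_left hf hY]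
  simp only [Pi.smul_apply', map_add, map_smul, map_neg, neg_smul, add_apply, neg_apply,
    smul_apply, smul_eq_mul, g.symm x (Y x) (X x)]
  ring

lemma metric_leviCivita (g : PseudoMetric I M) {X Y Z : ∀ x : M, TangentSpace I x} {x : M}
    (hX : MDiffAt (T% X) x) (hY : MDiffAt (T% Y) x) (hZ : MDiffAt (T% Z) x) :
    g.toFun x (leviCivita g Y x (X x)) (Z x) = koszul g X Y Z x := by
  let B := TensorialAt.mkHom₂ (I := I) (F := E) (F' := E) (fun X Z => koszul g X Y Z x) x
    (fun Z hZ => koszul_tensorial_left g hY hZ) (fun X hX => koszul_tensorial_right g hX hY)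
  have hB : B (X x) (Z x) = koszul g X Y Z x :=
    TensorialAt.mkHom₂_apply (fun Z hZ => koszul_tensorial_left g hY hZ)
      (fun X hX => koszul_tensorial_right g hX hY) hX hZ
  have key : leviCivita g Y x (X x) = sharp g x (B (X x)) := by
    refine metric_ext_basis g x (tangentBasis x) fun k => ?_
    rw [toFun_sharp, leviCivita, ofBasis_apply]
    conv_rhs => rw [← (tangentBasis x).sum_repr (X x), map_sum]
    simp only [map_sum, map_smul, sum_apply, smul_apply, metric_dualVec, smul_eq_mul, mul_ite,
      mul_one, mul_zero, Finset.sum_ite_eq, Finset.mem_univ, if_true]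
    rfl
  rw [key, toFun_sharp, hB]

lemma metric_leviCivita_ext (g : PseudoMetric I M) {Y : ∀ x : M, TangentSpace I x} {x : M}
    (hY : MDiffAt (T% Y) x) (v w : TangentSpace I x) :
    g.toFun x (leviCivita g Y x v) w = koszul g (ext v) Y (ext w) x := by
  rw [← metric_leviCivita g (mdifferentiableAt_ext v) hY (mdifferentiableAt_ext w),
    ext_apply_self, ext_apply_self]

lemma leviCivita_isCovariantDerivativeOn (g : PseudoMetric I M) :
    IsCovariantDerivativeOn E (leviCivita g) Set.univ where
  add {Y Y' x} hY hY' _ := by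
    ext v
    refine metric_ext g x fun w => ?_
    rw [metric_leviCivita_ext g (mdifferentiableAt_add_section hY hY'),
      koszul_add g (mdifferentiableAt_ext v) hY hY' (mdifferentiableAt_ext w), add_apply, map_add,
      add_apply, metric_leviCivita_ext g hY, metric_leviCivita_ext g hY']
  leibniz {Y f x} hY hf _ := by
    ext v
    refine metric_ext g x fun w => ?_
    rw [metric_leviCivita_ext g (hf.smul_section hY),
      koszul_leibniz g hf (mdifferentiableAt_ext v) hY (mdifferentiableAt_ext w),
      add_apply, map_add, add_apply, smul_apply, map_smul, smul_apply, metric_leviCivita_ext g hY,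
      ContinuousLinearMap.smulRight_apply, map_smul, smul_apply,
      ext_apply_self, ext_apply_self]
    rfl

end Connection

attribute [local instance] isManifold_one isManifold_minSmoothness

/-! ### Smoothness of curvature -/

section SmoothMatrices

variable {E : Type*} [NormedAddCommGroup E] [NormedSpace ℝ E]
  {H : Type*} [TopologicalSpace H] {I : ModelWithCorners ℝ E H}
  {M : Type*} [TopologicalSpace M] [ChartedSpace H M]

lemma contMDiffAt_det {ι : Type*} [Fintype ι] [DecidableEq ι] {A : M → Matrix ι ι ℝ} {x : M}
    (hA : ∀ i j, CMDiffAt ∞ (fun y => A y i j) x) : CMDiffAt ∞ (fun y => (A y).det) x := by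
  simp only [Matrix.det_apply']
  exact ContMDiffAt.sum fun σ _ =>
    contMDiffAt_const.mul (contMDiffAt_finsetProd fun i _ => hA _ _)

lemma contMDiffAt_matrix_inv {ι : Type*} [Fintype ι] [DecidableEq ι] {A : M → Matrix ι ι ℝ} {x : M}
    (hA : ∀ i j, CMDiffAt ∞ (fun y => A y i j) x) (hx : (A x).det ≠ 0) (i j : ι) :
    CMDiffAt ∞ (fun y => (A y)⁻¹ i j) x := by
  simp only [Matrix.inv_def, Ring.inverse_eq_inv', Matrix.smul_apply, smul_eq_mul,
    Matrix.adjugate_apply]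
  refine ContMDiffAt.mul ((contMDiffAt_det hA).inv₀ hx) (contMDiffAt_det fun k l => ?_)
  by_cases hk : k = j
  · subst hk
    simp only [Matrix.updateRow_self]
    exact contMDiffAt_const
  · simp only [Matrix.updateRow_ne hk]
    exact hA k l

lemma contMDiff_trivial_iff {f : M → ℝ} :
    ContMDiff I (I.prod 𝓘(ℝ)) ∞ (fun y => TotalSpace.mk' ℝ (E := Bundle.Trivial M ℝ) y (f y)) ↔
      CMDiff ∞ f :=
  forall_congr' fun x => by
    simp only [contMDiffAt_totalSpace]
    exact ⟨fun h => h.2, fun h => ⟨contMDiffAt_id, h⟩⟩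

end SmoothMatrices

section SmoothTensoriality

variable {E : Type*} [NormedAddCommGroup E] [NormedSpace ℝ E]
  {H : Type*} [TopologicalSpace H] {I : ModelWithCorners ℝ E H}
  {M : Type*} [TopologicalSpace M] [ChartedSpace H M]
  {F : Type*} [NormedAddCommGroup F] [NormedSpace ℝ F]
  {V : M → Type*} [TopologicalSpace (TotalSpace F V)]
  [∀ x, AddCommGroup (V x)] [∀ x, Module ℝ (V x)] [∀ x, TopologicalSpace (V x)]
  [FiberBundle F V] {A : Type*} [AddCommGroup A] [Module ℝ A]

variable (I F) in
/-- Linearity over smooth functions, at the point `x`, of an operation on smooth sections. Unlike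
`TensorialAt`, it only constrains the values on globally smooth arguments, so that it also
applies to operations involving second derivatives. -/
structure SmoothTensorialAt (Φ : (∀ y, V y) → A) (x : M) : Prop where
  smul : ∀ {f : M → ℝ} {s : ∀ y, V y}, CMDiff ∞ f → CMDiff ∞ (T% s) → Φ (f • s) = f x • Φ s
  add : ∀ {s s' : ∀ y, V y}, CMDiff ∞ (T% s) → CMDiff ∞ (T% s') → Φ (s + s') = Φ s + Φ s'

namespace SmoothTensorialAt

variable [VectorBundle ℝ F V] {Φ : (∀ y, V y) → A} {x : M}

lemma sum_smul (hΦ : SmoothTensorialAt I F Φ x) {ι : Type*} (t : Finset ι) {c : ι → M → ℝ}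
    {e : ι → ∀ y, V y} (hc : ∀ i, CMDiff ∞ (c i)) (he : ∀ i, CMDiff ∞ (T% (e i))) :
    Φ (∑ i ∈ t, c i • e i) = ∑ i ∈ t, c i x • Φ (e i) := by
  classical
  induction t using Finset.induction_on with
  | empty =>
    have h0 : CMDiff ∞ (T% (0 : ∀ y, V y)) := Bundle.contMDiff_zeroSection ℝ V
    have h := hΦ.smul (f := fun _ => 0) contMDiff_const h0
    rwa [smul_zero, zero_smul] at h
  | insert a t ha ih =>
    have ht : CMDiff ∞ (T% (∑ i ∈ t, c i • e i)) := by
      rw [show ∑ i ∈ t, c i • e i = fun y => ∑ i ∈ t, (c i • e i) y from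
        funext fun y => Finset.sum_apply y t _]
      exact ContMDiff.sum_section fun i _ => (hc i).smul_section (he i)
    rw [Finset.sum_insert ha, Finset.sum_insert ha, hΦ.add ((hc a).smul_section (he a)) ht, ih,
      hΦ.smul (hc a) (he a)]

end SmoothTensorialAt

variable [VectorBundle ℝ F V]
variable [FiniteDimensional ℝ E] [IsManifold I ∞ M] [T2Space M]

lemma exists_global_eventuallyEq {x : M} {u : Set M} (hu : u ∈ 𝓝 x) {s : ∀ y, V y}
    (hs : CMDiff[u] ∞ (T% s)) :
    ∃ s' : ∀ y, V y, CMDiff ∞ (T% s') ∧ ∀ᶠ y in 𝓝 x, s' y = s y := by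
  obtain ⟨χ, -, hχ⟩ := (SmoothBumpFunction.nhds_basis_tsupport (I := I) x).mem_iff.mp
    (interior_mem_nhds.mpr hu)
  refine ⟨(χ : M → ℝ) • s, ?_, ?_⟩
  · exact ContMDiffOn.smul_section_of_tsupport χ.contMDiff.contMDiffOn isOpen_interior hχ
      (hs.mono interior_subset)
  · filter_upwards [χ.eventuallyEq_one] with y hy
    simp [hy]

variable [FiniteDimensional ℝ F] [ContMDiffVectorBundle ∞ F V I]

lemma exists_smul_eq_sum_smul (x : M) {s : ∀ y, V y} (hs : CMDiff ∞ (T% s)) (h0 : s x = 0) :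
    ∃ (χ : M → ℝ) (c : Fin (Module.finrank ℝ F) → M → ℝ)
      (e : Fin (Module.finrank ℝ F) → ∀ y, V y),
      CMDiff ∞ χ ∧ (∀ i, CMDiff ∞ (c i)) ∧ (∀ i, CMDiff ∞ (T% (e i))) ∧
        χ x = 1 ∧ (∀ i, c i x = 0) ∧ χ • s = ∑ i, c i • e i := by
  let t := trivializationAt F V x
  let b := Module.finBasis ℝ F
  obtain ⟨χ, -, hχ⟩ := (SmoothBumpFunction.nhds_basis_tsupport (I := I) x).mem_iff.mp
    (t.open_baseSet.mem_nhds (FiberBundle.mem_baseSet_trivializationAt F V x))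
  have h_off : ∀ {y}, y ∉ t.baseSet → χ y = 0 := fun hy =>
    image_eq_zero_of_notMem_tsupport fun h => hy (hχ h)
  refine ⟨χ * χ, fun i y => χ y * t.localFrameCoeff I b i y (s y),
    fun i => (χ : M → ℝ) • t.localFrame b i, χ.contMDiff.mul χ.contMDiff, fun i => ?_, fun i => ?_,
    by simp, fun i => by simp [h0], ?_⟩
  · refine contMDiff_of_tsupport fun y hy => ?_
    exact χ.contMDiffAt.mul (contMDiffAt_localFrameCoeff b
      (hχ (tsupport_mul_subset_left hy)) (hs y) i)
  · exact ContMDiffOn.smul_section_of_tsupport χ.contMDiff.contMDiffOn t.open_baseSet hχ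
      (Trivialization.contMDiffOn_localFrame_baseSet (I := I) ∞ t b i)
  · ext y
    rw [Finset.sum_apply]
    by_cases hy : y ∈ t.baseSet
    · have := Trivialization.eq_sum_localFrameCoeff_smul (I := I) (e := t) (b := b) (s := s) hy
      simp only [Pi.smul_apply', Pi.mul_apply]
      conv_lhs => rw [this, Finset.smul_sum]
      exact Finset.sum_congr rfl fun i _ => by module
    · simp [h_off hy]

lemma SmoothTensorialAt.eq_of_apply_eq {Φ : (∀ y, V y) → A} {x : M}
    (hΦ : SmoothTensorialAt I F Φ x) {s s' : ∀ y, V y} (hs : CMDiff ∞ (T% s))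
    (hs' : CMDiff ∞ (T% s')) (h : s x = s' x) : Φ s = Φ s' := by
  have hd : CMDiff ∞ (T% (s - s')) := hs.sub_section hs'
  obtain ⟨χ, c, e, hχ, hc, he, hχ1, hc0, hsum⟩ :=
    exists_smul_eq_sum_smul x hd (sub_eq_zero.mpr h)
  have h0 : Φ (s - s') = 0 := by
    have := hΦ.smul hχ hd
    rw [hsum, hΦ.sum_smul _ hc he, hχ1, one_smul] at this
    simp [← this, hc0]
  rw [← sub_add_cancel s s', hΦ.add hd hs', h0, zero_add]

end SmoothTensoriality

section Frames

variable {E : Type*} [NormedAddCommGroup E] [NormedSpace ℝ E]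
  {H : Type*} [TopologicalSpace H] {I : ModelWithCorners ℝ E H}
  {M : Type*} [TopologicalSpace M] [ChartedSpace H M] [IsManifold I ∞ M] (g : PseudoMetric I M)

lemma contMDiffAt_gram_inv {e : Fin (Module.finrank ℝ E) → ∀ y : M, TangentSpace I y} {x : M}
    (he : ∀ i, CMDiff ∞ (T% (e i)))
    (hb : ∀ᶠ y in 𝓝 x, ∃ b : Module.Basis (Fin (Module.finrank ℝ E)) ℝ (TangentSpace I y),
        ∀ i, b i = e i y) (i j : Fin (Module.finrank ℝ E)) :
    CMDiffAt ∞ (fun y => (gram g y fun i => e i y)⁻¹ i j) x := by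
  obtain ⟨b, hb⟩ := hb.self_of_nhds
  refine contMDiffAt_matrix_inv (fun i j => contMDiffAt_metric g (he i x) (he j x)) ?_ i j
  have := (isUnit_det_gram g x b).ne_zero
  rwa [show (⇑b) = fun i => e i x from funext hb] at this

variable [FiniteDimensional ℝ E] [T2Space M]

lemma exists_global_eventuallyEq_ext {x : M} (v : TangentSpace I x) :
    ∃ X : ∀ y : M, TangentSpace I y, CMDiff ∞ (T% X) ∧ X =ᶠ[𝓝 x] ext v := by
  obtain ⟨u, hu, h⟩ := FiberBundle.exists_contMDiffOn_extend (k := ∞) I E v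
  exact exists_global_eventuallyEq hu h

lemma exists_global_extension {x : M} (v : TangentSpace I x) :
    ∃ X : ∀ y : M, TangentSpace I y, CMDiff ∞ (T% X) ∧ X x = v := by
  obtain ⟨X, hX, h⟩ := exists_global_eventuallyEq_ext v
  exact ⟨X, hX, h.self_of_nhds.trans (ext_apply_self v)⟩

lemma exists_global_frame (x : M) :
    ∃ e : Fin (Module.finrank ℝ E) → ∀ y : M, TangentSpace I y, (∀ i, CMDiff ∞ (T% (e i))) ∧
      ∀ᶠ y in 𝓝 x, ∃ b : Module.Basis (Fin (Module.finrank ℝ E)) ℝ (TangentSpace I y),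
        ∀ i, b i = e i y := by
  let t := trivializationAt E (TangentSpace I : M → Type _) x
  have hx : x ∈ t.baseSet := FiberBundle.mem_baseSet_trivializationAt E (TangentSpace I) x
  let b := Module.finBasis ℝ E
  choose e he heq using fun i => exists_global_eventuallyEq (t.open_baseSet.mem_nhds hx)
    (Trivialization.contMDiffOn_localFrame_baseSet (I := I) ∞ t b i)
  refine ⟨e, he, ?_⟩
  filter_upwards [Filter.eventually_all.mpr heq, t.open_baseSet.mem_nhds hx] with y hy hyt
  refine ⟨t.basisAt b hyt, fun i => ?_⟩
  rw [hy i, t.localFrame_apply_of_mem_baseSet b hyt]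

lemma contMDiff_of_metric {Z : ∀ y : M, TangentSpace I y}
    (h : ∀ X : ∀ y : M, TangentSpace I y, CMDiff ∞ (T% X) →
      CMDiff ∞ fun y => g.toFun y (Z y) (X y)) : CMDiff ∞ (T% Z) := by
  intro x
  obtain ⟨e, he, hb⟩ := exists_global_frame (I := I) x
  have : CMDiffAt ∞ (T% (fun y => ∑ i, ∑ j,
      ((gram g y fun i => e i y)⁻¹ i j * g.toFun y (Z y) (e i y)) • e j y)) x := by
    refine ContMDiffAt.sum_section fun i _ => ContMDiffAt.sum_section fun j _ => ?_
    exact ((contMDiffAt_gram_inv g he hb i j).mul (h (e i) (he i) x)).smul_section (he j x)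
  refine this.congr_of_eventuallyEq ?_
  filter_upwards [hb] with y ⟨b, hb⟩
  have := sum_gram_inv g y b (Z y)
  rw [show (⇑b) = fun i => e i y from funext hb] at this
  rw [this]

lemma contMDiff_metricTrace {F : Type*} [NormedAddCommGroup F] [NormedSpace ℝ F]
    {V : M → Type*} [TopologicalSpace (TotalSpace F V)]
    [∀ x, AddCommGroup (V x)] [∀ x, Module ℝ (V x)] [∀ x, TopologicalSpace (V x)]
    [FiberBundle F V] [VectorBundle ℝ F V]
    (β : ∀ y : M, TangentSpace I y →ₗ[ℝ] TangentSpace I y →ₗ[ℝ] V y)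
    (h : ∀ X Y : ∀ y : M, TangentSpace I y, CMDiff ∞ (T% X) → CMDiff ∞ (T% Y) →
      CMDiff ∞ (T% fun y => β y (X y) (Y y))) :
    CMDiff ∞ (T% fun y => metricTrace g y fun v w => β y v w) := by
  intro x
  obtain ⟨e, he, hb⟩ := exists_global_frame (I := I) x
  have : CMDiffAt ∞ (T% (fun y => ∑ i, ∑ j,
      ((gram g y fun i => e i y)⁻¹ i j) • β y (e i y) (e j y))) x := by
    refine ContMDiffAt.sum_section fun i _ => ContMDiffAt.sum_section fun j _ => ?_
    exact (contMDiffAt_gram_inv g he hb i j).smul_section (h _ _ (he i) (he j) x)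
  refine this.congr_of_eventuallyEq ?_
  filter_upwards [hb] with y ⟨b, hb⟩
  have := metricTrace_eq_sum g y b (β y)
  rw [show (⇑b) = fun i => e i y from funext hb] at this
  rw [this]

lemma contMDiff_scalar_metricTrace
    (β : ∀ y : M, TangentSpace I y →ₗ[ℝ] TangentSpace I y →ₗ[ℝ] ℝ)
    (h : ∀ X Y : ∀ y : M, TangentSpace I y, CMDiff ∞ (T% X) → CMDiff ∞ (T% Y) →
      CMDiff ∞ fun y => β y (X y) (Y y)) :
    CMDiff ∞ fun y => metricTrace g y fun v w => β y v w :=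
  contMDiff_trivial_iff.mp (contMDiff_metricTrace (F := ℝ) (V := Bundle.Trivial M ℝ) g β
    fun X Y hX hY => contMDiff_trivial_iff.mpr (h X Y hX hY))

end Frames

section Germs

variable {E : Type*} [NormedAddCommGroup E] [NormedSpace ℝ E]
  {H : Type*} [TopologicalSpace H] {I : ModelWithCorners ℝ E H}
  {M : Type*} [TopologicalSpace M] [ChartedSpace H M]

lemma mvfderiv_congr {G : Type*} [NormedAddCommGroup G] [NormedSpace ℝ G] {f f' : M → G} {x : M}
    (h : f =ᶠ[𝓝 x] f') : mvfderiv I f x = mvfderiv I f' x := by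
  ext v
  simp only [mvfderiv]
  rw [h.mfderiv_eq]
  simp only [ContinuousLinearMap.comp_apply]
  rfl

lemma mdifferentiableAt_of_smooth {F : Type*} [NormedAddCommGroup F] [NormedSpace ℝ F]
    {V : M → Type*} [TopologicalSpace (TotalSpace F V)] [∀ x, TopologicalSpace (V x)]
    [FiberBundle F V] {s : ∀ x, V x} (hs : CMDiff ∞ (T% s)) (x : M) : MDiffAt (T% s) x :=
  (hs x).mdifferentiableAt (by simp)

variable [IsManifold I ∞ M] (g : PseudoMetric I M)

lemma koszul_congr {X X' Y Y' Z Z' : ∀ x : M, TangentSpace I x} {x : M} (hX : X =ᶠ[𝓝 x] X')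
    (hY : Y =ᶠ[𝓝 x] Y') (hZ : Z =ᶠ[𝓝 x] Z') : koszul g X Y Z x = koszul g X' Y' Z' x := by
  have h_metric : ∀ {A A' B B' : ∀ x : M, TangentSpace I x}, A =ᶠ[𝓝 x] A' → B =ᶠ[𝓝 x] B' →
      mvfderiv I (fun y => g.toFun y (A y) (B y)) x
        = mvfderiv I (fun y => g.toFun y (A' y) (B' y)) x := fun {A A' B B'} hA hB => by
    refine mvfderiv_congr ?_
    filter_upwards [hA, hB] with y h1 h2
    rw [h1, h2]
  simp only [koszul, h_metric hY hZ, h_metric hX hZ, h_metric hX hY,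
    hX.mlieBracket_vectorField_eq hY, hX.mlieBracket_vectorField_eq hZ,
    hY.mlieBracket_vectorField_eq hZ, hX.self_of_nhds, hY.self_of_nhds, hZ.self_of_nhds]

variable [FiniteDimensional ℝ E]

lemma leviCivita_congr {Y Y' : ∀ x : M, TangentSpace I x} {x : M} (hY : Y =ᶠ[𝓝 x] Y') :
    leviCivita g Y x = leviCivita g Y' x := by
  simp only [leviCivita]
  congr 1
  ext i
  refine Finset.sum_congr rfl fun j _ => ?_
  exact congrArg (· • dualVec g x j)
    (koszul_congr g (Filter.EventuallyEq.refl _ _) hY (Filter.EventuallyEq.refl _ _))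

lemma curvature_congr {X X' Y Y' Z Z' : ∀ x : M, TangentSpace I x} {x : M} (hX : X =ᶠ[𝓝 x] X')
    (hY : Y =ᶠ[𝓝 x] Y') (hZ : Z =ᶠ[𝓝 x] Z') :
    curvature g X Y Z x = curvature g X' Y' Z' x := by
  have h : ∀ {A A' : ∀ x : M, TangentSpace I x}, A =ᶠ[𝓝 x] A' →
      (fun y => leviCivita g Z y (A y)) =ᶠ[𝓝 x] fun y => leviCivita g Z' y (A' y) :=
    fun {A A'} hA => by
      filter_upwards [hA, hZ.eventuallyEq_nhds] with y h1 h2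
      rw [h1, leviCivita_congr g h2]
  simp only [curvature, leviCivita_congr g (h hY), leviCivita_congr g (h hX), leviCivita_congr g hZ,
    hX.self_of_nhds, hY.self_of_nhds, hX.mlieBracket_vectorField_eq hY]

lemma leviCivita_add {Y Y' : ∀ x : M, TangentSpace I x} {x : M}
    (hY : MDiffAt (T% Y) x) (hY' : MDiffAt (T% Y') x) :
    leviCivita g (Y + Y') x = leviCivita g Y x + leviCivita g Y' x :=
  (leviCivita_isCovariantDerivativeOn g).add hY hY'

lemma leviCivita_smul {Y : ∀ x : M, TangentSpace I x} {f : M → ℝ} {x : M}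
    (hf : MDiffAt f x) (hY : MDiffAt (T% Y) x) :
    leviCivita g (f • Y) x = f x • leviCivita g Y x + (mvfderiv I f x).smulRight (Y x) :=
  (leviCivita_isCovariantDerivativeOn g).leibniz hY hf

lemma curvature_swap (X Y Z : ∀ x : M, TangentSpace I x) (x : M) :
    curvature g X Y Z x = -curvature g Y X Z x := by
  simp only [curvature, VectorField.mlieBracket_swap_apply (V := X) (W := Y), map_neg]
  abel

end Germs

section SmoothVectorFields

variable {E : Type*} [NormedAddCommGroup E] [NormedSpace ℝ E]
  {H : Type*} [TopologicalSpace H] {I : ModelWithCorners ℝ E H}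
  {M : Type*} [TopologicalSpace M] [ChartedSpace H M] [IsManifold I ∞ M]
  {X Y Z : ∀ x : M, TangentSpace I x} {f : M → ℝ}

lemma contMDiff_mvfderiv_apply (hf : CMDiff ∞ f) (hX : CMDiff ∞ (T% X)) :
    CMDiff ∞ (fun y => mvfderiv I f y (X y)) :=
  fun x => contMDiffAt_mvfderiv_apply (hf x) (hX x)

lemma contMDiff_metric (g : PseudoMetric I M) (hX : CMDiff ∞ (T% X)) (hY : CMDiff ∞ (T% Y)) :
    CMDiff ∞ (fun y => g.toFun y (X y) (Y y)) :=
  fun x => contMDiffAt_metric g (hX x) (hY x)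

variable [FiniteDimensional ℝ E]

lemma contMDiff_mlieBracket (hX : CMDiff ∞ (T% X)) (hY : CMDiff ∞ (T% Y)) :
    CMDiff ∞ (T% (VectorField.mlieBracket I X Y)) :=
  fun x => contMDiffAt_mlieBracket (hX x) (hY x)

lemma mlieBracket_smul_field (W : ∀ x : M, TangentSpace I x) (hf : CMDiff ∞ f)
    (hZ : CMDiff ∞ (T% Z)) :
    VectorField.mlieBracket I W (f • Z)
      = (fun y => mvfderiv I f y (W y)) • Z + f • VectorField.mlieBracket I W Z := by
  ext y
  rw [VectorField.mlieBracket_smul_right ((hf y).mdifferentiableAt (by simp))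
    (mdifferentiableAt_of_smooth hZ y)]
  rfl

lemma mlieBracket_mlieBracket_smul_field (x : M) {W : ∀ x : M, TangentSpace I x}
    (hW : CMDiff ∞ (T% W)) (hf : CMDiff ∞ f) (hZ : CMDiff ∞ (T% Z)) :
    VectorField.mlieBracket I X (VectorField.mlieBracket I W (f • Z)) x
      = mvfderiv I (fun y => mvfderiv I f y (W y)) x (X x) • Z x
        + mvfderiv I f x (W x) • VectorField.mlieBracket I X Z x
        + (mvfderiv I f x (X x) • VectorField.mlieBracket I W Z x
          + f x • VectorField.mlieBracket I X (VectorField.mlieBracket I W Z) x) := by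
  have hdf : MDiffAt f x := (hf x).mdifferentiableAt (by simp)
  have hdWf : MDiffAt (fun y => mvfderiv I f y (W y)) x :=
    (contMDiff_mvfderiv_apply hf hW x).mdifferentiableAt (by simp)
  have hdZ := mdifferentiableAt_of_smooth hZ x
  have hdWZ := mdifferentiableAt_of_smooth (contMDiff_mlieBracket hW hZ) x
  rw [mlieBracket_smul_field W hf hZ, VectorField.mlieBracket_add_right (hdWf.smul_section hdZ)
    (hdf.smul_section hdWZ), VectorField.mlieBracket_smul_right hdWf hdZ,
    VectorField.mlieBracket_smul_right hdf hdWZ]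

/-- This is the Jacobi identity for `X`, `Y`, `f • Z`, compared with that for `X`, `Y`, `Z`. -/
lemma mvfderiv_mlieBracket_smul (x : M) (hX : CMDiff ∞ (T% X)) (hY : CMDiff ∞ (T% Y))
    (hZ : CMDiff ∞ (T% Z)) (hf : CMDiff ∞ f) :
    (mvfderiv I (fun y => mvfderiv I f y (Y y)) x (X x)
      - mvfderiv I (fun y => mvfderiv I f y (X y)) x (Y x)
      - mvfderiv I f x (VectorField.mlieBracket I X Y x)) • Z x = 0 := by
  have two_le : minSmoothness ℝ 2 ≤ (∞ : WithTop ℕ∞) := by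
    rw [minSmoothness_of_isRCLikeNormedField]
    exact WithTop.coe_le_coe.mpr le_top
  have jacobi := fun (W : ∀ x : M, TangentSpace I x) (hW : CMDiff ∞ (T% W)) =>
    VectorField.leibniz_identity_mlieBracket_apply ((hX x).of_le two_le) ((hY x).of_le two_le)
      ((hW x).of_le two_le)
  have h := jacobi (f • Z) (hf.smul_section hZ)
  rw [mlieBracket_mlieBracket_smul_field x hY hf hZ, mlieBracket_mlieBracket_smul_field x hX hf hZ,
    mlieBracket_smul_field (VectorField.mlieBracket I X Y) hf hZ, jacobi Z hZ, ← sub_eq_zero] at h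
  simp only [Pi.add_apply, Pi.smul_apply'] at h
  rw [← h]
  module

variable [T2Space M]

lemma mvfderiv_mlieBracket (x : M) (hX : CMDiff ∞ (T% X)) (hY : CMDiff ∞ (T% Y))
    (hf : CMDiff ∞ f) :
    mvfderiv I f x (VectorField.mlieBracket I X Y x)
      = mvfderiv I (fun y => mvfderiv I f y (Y y)) x (X x)
        - mvfderiv I (fun y => mvfderiv I f y (X y)) x (Y x) := by
  rcases subsingleton_or_nontrivial (TangentSpace I x) with h | h
  · simp [Subsingleton.eq_zero (VectorField.mlieBracket I X Y x), Subsingleton.eq_zero (X x),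
      Subsingleton.eq_zero (Y x)]
  · obtain ⟨v, hv⟩ := exists_ne (0 : TangentSpace I x)
    obtain ⟨Z, hZ, rfl⟩ := exists_global_extension v
    have := (smul_eq_zero.mp (mvfderiv_mlieBracket_smul x hX hY hZ hf)).resolve_right hv
    linarith

end SmoothVectorFields

section Curvature

variable {E : Type*} [NormedAddCommGroup E] [NormedSpace ℝ E] [FiniteDimensional ℝ E]
  {H : Type*} [TopologicalSpace H] {I : ModelWithCorners ℝ E H}
  {M : Type*} [TopologicalSpace M] [ChartedSpace H M] [IsManifold I ∞ M]
  (g : PseudoMetric I M) {X Y Z : ∀ x : M, TangentSpace I x} {f : M → ℝ}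

lemma contMDiff_koszul (hX : CMDiff ∞ (T% X)) (hY : CMDiff ∞ (T% Y)) (hZ : CMDiff ∞ (T% Z)) :
    CMDiff ∞ (koszul g X Y Z) := by
  refine contMDiff_const.mul ?_
  refine ((((ContMDiff.add ?_ ?_).sub ?_).add ?_).sub ?_).sub ?_
  · exact contMDiff_mvfderiv_apply (contMDiff_metric g hY hZ) hX
  · exact contMDiff_mvfderiv_apply (contMDiff_metric g hX hZ) hY
  · exact contMDiff_mvfderiv_apply (contMDiff_metric g hX hY) hZ
  · exact contMDiff_metric g (contMDiff_mlieBracket hX hY) hZ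
  · exact contMDiff_metric g (contMDiff_mlieBracket hX hZ) hY
  · exact contMDiff_metric g (contMDiff_mlieBracket hY hZ) hX

variable [T2Space M]

lemma contMDiff_leviCivita (hX : CMDiff ∞ (T% X)) (hY : CMDiff ∞ (T% Y)) :
    CMDiff ∞ (T% fun y => leviCivita g Y y (X y)) := by
  refine contMDiff_of_metric g fun Z hZ => ?_
  refine (contMDiff_koszul g hX hY hZ).congr fun y => ?_
  exact metric_leviCivita g (mdifferentiableAt_of_smooth hX y) (mdifferentiableAt_of_smooth hY y)
    (mdifferentiableAt_of_smooth hZ y)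

variable (x : M)

lemma smoothTensorialAt_curvature_left (hZ : CMDiff ∞ (T% Z)) :
    SmoothTensorialAt I E (fun X => curvature g X Y Z x) x where
  smul {f X} hf hX := by
    have h : (fun y => leviCivita g Z y ((f • X) y)) = f • fun y => leviCivita g Z y (X y) := by
      ext y; simp
    have hdf : MDiffAt f x := (hf x).mdifferentiableAt (by simp)
    simp only [curvature, h]
    rw [leviCivita_smul g hdf (mdifferentiableAt_of_smooth (contMDiff_leviCivita g hX hZ) x),
      VectorField.mlieBracket_smul_left hdf (mdifferentiableAt_of_smooth hX x)]
    simp only [Pi.smul_apply', map_smul, add_apply, smul_apply,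
      ContinuousLinearMap.smulRight_apply, map_add]
    module
  add {X X'} hX hX' := by
    have h : (fun y => leviCivita g Z y ((X + X') y))
        = (fun y => leviCivita g Z y (X y)) + fun y => leviCivita g Z y (X' y) := by
      ext y; simp
    simp only [curvature, h]
    rw [leviCivita_add g (mdifferentiableAt_of_smooth (contMDiff_leviCivita g hX hZ) x)
        (mdifferentiableAt_of_smooth (contMDiff_leviCivita g hX' hZ) x),
      VectorField.mlieBracket_add_left (mdifferentiableAt_of_smooth hX x)
        (mdifferentiableAt_of_smooth hX' x)]
    simp only [Pi.add_apply, map_add, add_apply]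
    abel

lemma smoothTensorialAt_curvature_middle (hZ : CMDiff ∞ (T% Z)) :
    SmoothTensorialAt I E (fun Y => curvature g X Y Z x) x where
  smul {f Y} hf hY := by
    simp only [curvature_swap g X]
    rw [(smoothTensorialAt_curvature_left g x hZ).smul hf hY, smul_neg]
  add {Y Y'} hY hY' := by
    simp only [curvature_swap g X]
    rw [(smoothTensorialAt_curvature_left g x hZ).add hY hY', neg_add]

lemma leviCivita_leviCivita_smul (hX : CMDiff ∞ (T% X)) (hZ : CMDiff ∞ (T% Z))
    (hf : CMDiff ∞ f) (v : TangentSpace I x) :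
    leviCivita g (fun y => leviCivita g (f • Z) y (X y)) x v
      = f x • leviCivita g (fun y => leviCivita g Z y (X y)) x v
        + mvfderiv I f x v • leviCivita g Z x (X x)
        + (mvfderiv I f x (X x) • leviCivita g Z x v
          + mvfderiv I (fun y => mvfderiv I f y (X y)) x v • Z x) := by
  have hdf : ∀ y, MDiffAt f y := fun y => (hf y).mdifferentiableAt (by simp)
  have hdZ := mdifferentiableAt_of_smooth hZ
  have hdXf : MDiffAt (fun y => mvfderiv I f y (X y)) x :=
    (contMDiff_mvfderiv_apply hf hX x).mdifferentiableAt (by simp)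
  have hdXZ := mdifferentiableAt_of_smooth (contMDiff_leviCivita g hX hZ) x
  have h : (fun y => leviCivita g (f • Z) y (X y))
      = f • (fun y => leviCivita g Z y (X y)) + (fun y => mvfderiv I f y (X y)) • Z := by
    ext y
    rw [leviCivita_smul g (hdf y) (hdZ y)]
    rfl
  rw [h, leviCivita_add g ((hdf x).smul_section hdXZ) (hdXf.smul_section (hdZ x)),
    leviCivita_smul g (hdf x) hdXZ, leviCivita_smul g hdXf (hdZ x)]
  rfl

lemma smoothTensorialAt_curvature_right (hX : CMDiff ∞ (T% X)) (hY : CMDiff ∞ (T% Y)) :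
    SmoothTensorialAt I E (fun Z => curvature g X Y Z x) x where
  smul {f Z} hf hZ := by
    simp only [curvature]
    rw [leviCivita_leviCivita_smul g x hY hZ hf, leviCivita_leviCivita_smul g x hX hZ hf,
      leviCivita_smul g ((hf x).mdifferentiableAt (by simp)) (mdifferentiableAt_of_smooth hZ x)]
    simp only [add_apply, smul_apply, ContinuousLinearMap.smulRight_apply]
    rw [mvfderiv_mlieBracket x hX hY hf]
    module
  add {Z Z'} hZ hZ' := by
    have hdZ := mdifferentiableAt_of_smooth hZ
    have hdZ' := mdifferentiableAt_of_smooth hZ'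
    have h : ∀ W : ∀ x : M, TangentSpace I x, (fun y => leviCivita g (Z + Z') y (W y))
        = (fun y => leviCivita g Z y (W y)) + fun y => leviCivita g Z' y (W y) := fun W => by
      ext y
      rw [leviCivita_add g (hdZ y) (hdZ' y)]
      rfl
    simp only [curvature, h]
    rw [leviCivita_add g (mdifferentiableAt_of_smooth (contMDiff_leviCivita g hY hZ) x)
        (mdifferentiableAt_of_smooth (contMDiff_leviCivita g hY hZ') x),
      leviCivita_add g (mdifferentiableAt_of_smooth (contMDiff_leviCivita g hX hZ) x)
        (mdifferentiableAt_of_smooth (contMDiff_leviCivita g hX hZ') x),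
      leviCivita_add g (hdZ x) (hdZ' x)]
    simp only [add_apply]
    abel

lemma contMDiff_curvature (hX : CMDiff ∞ (T% X)) (hY : CMDiff ∞ (T% Y)) (hZ : CMDiff ∞ (T% Z)) :
    CMDiff ∞ (T% (curvature g X Y Z)) := by
  refine ContMDiff.sub_section (ContMDiff.sub_section ?_ ?_) ?_
  · exact contMDiff_leviCivita g hX (contMDiff_leviCivita g hY hZ)
  · exact contMDiff_leviCivita g hY (contMDiff_leviCivita g hX hZ)
  · exact contMDiff_leviCivita g (contMDiff_mlieBracket hX hY) hZ

/-- The curvature tensor at a point. -/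
def curvatureAt (u v w : TangentSpace I x) : TangentSpace I x :=
  curvature g (ext u) (ext v) (ext w) x

lemma curvatureAt_apply (hX : CMDiff ∞ (T% X)) (hY : CMDiff ∞ (T% Y)) (hZ : CMDiff ∞ (T% Z)) :
    curvatureAt g x (X x) (Y x) (Z x) = curvature g X Y Z x := by
  obtain ⟨X', hX', hXe⟩ := exists_global_eventuallyEq_ext (X x)
  obtain ⟨Y', hY', hYe⟩ := exists_global_eventuallyEq_ext (Y x)
  obtain ⟨Z', hZ', hZe⟩ := exists_global_eventuallyEq_ext (Z x)
  have h_value : ∀ {A B : ∀ x : M, TangentSpace I x}, A =ᶠ[𝓝 x] ext (B x) → A x = B x :=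
    fun {A B} h => h.self_of_nhds.trans (ext_apply_self (B x))
  calc curvatureAt g x (X x) (Y x) (Z x) = curvature g X' Y' Z' x :=
        (curvature_congr g hXe hYe hZe).symm
    _ = curvature g X Y' Z' x :=
        (smoothTensorialAt_curvature_left g x hZ').eq_of_apply_eq hX' hX (h_value hXe)
    _ = curvature g X Y Z' x :=
        (smoothTensorialAt_curvature_middle g x hZ').eq_of_apply_eq hY' hY (h_value hYe)
    _ = curvature g X Y Z x :=
        (smoothTensorialAt_curvature_right g x hX hY).eq_of_apply_eq hZ' hZ (h_value hZe)

lemma SmoothTensorialAt.isLinearMap {A : Type*} [AddCommGroup A] [Module ℝ A]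
    {Φ : (∀ y : M, TangentSpace I y) → A} {x : M} (hΦ : SmoothTensorialAt I E Φ x)
    {φ : TangentSpace I x → A}
    (h : ∀ X : ∀ y : M, TangentSpace I y, CMDiff ∞ (T% X) → φ (X x) = Φ X) :
    IsLinearMap ℝ φ where
  map_add u v := by
    obtain ⟨U, hU, rfl⟩ := exists_global_extension u
    obtain ⟨V, hV, rfl⟩ := exists_global_extension v
    rw [h U hU, h V hV, ← hΦ.add hU hV]
    exact h (U + V) (hU.add_section hV)
  map_smul c u := by
    obtain ⟨U, hU, rfl⟩ := exists_global_extension u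
    have hc : CMDiff ∞ (fun _ : M => c) := contMDiff_const
    rw [h U hU, ← hΦ.smul hc hU]
    exact h _ (hc.smul_section hU)

variable {x}

lemma isLinearMap_curvatureAt_left (v w : TangentSpace I x) :
    IsLinearMap ℝ fun u => curvatureAt g x u v w := by
  obtain ⟨V, hV, rfl⟩ := exists_global_extension v
  obtain ⟨W, hW, rfl⟩ := exists_global_extension w
  exact (smoothTensorialAt_curvature_left g x hW).isLinearMap
    fun X hX => curvatureAt_apply g x hX hV hW

lemma isLinearMap_curvatureAt_middle (u w : TangentSpace I x) :
    IsLinearMap ℝ fun v => curvatureAt g x u v w := by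
  obtain ⟨U, hU, rfl⟩ := exists_global_extension u
  obtain ⟨W, hW, rfl⟩ := exists_global_extension w
  exact (smoothTensorialAt_curvature_middle g x hW).isLinearMap
    fun Y hY => curvatureAt_apply g x hU hY hW

lemma isLinearMap_curvatureAt_right (u v : TangentSpace I x) :
    IsLinearMap ℝ fun w => curvatureAt g x u v w := by
  obtain ⟨U, hU, rfl⟩ := exists_global_extension u
  obtain ⟨V, hV, rfl⟩ := exists_global_extension v
  exact (smoothTensorialAt_curvature_right g x hU hV).isLinearMap
    fun Z hZ => curvatureAt_apply g x hU hV hZ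

variable (x)

/-- The bilinear form `u, u' ↦ g(R(u,v)w, u')`, whose trace is `Ric(v,w)`. -/
def curvatureForm (v w : TangentSpace I x) :
    TangentSpace I x →ₗ[ℝ] TangentSpace I x →ₗ[ℝ] ℝ :=
  LinearMap.mk₂ ℝ (fun u u' => g.toFun x (curvatureAt g x u v w) u')
    (fun u u' z => by simp [(isLinearMap_curvatureAt_left g v w).map_add])
    (fun c u z => by simp [(isLinearMap_curvatureAt_left g v w).map_smul])
    (fun u z z' => by simp) (fun c u z => by simp)

lemma ricci_eq_metricTrace (v w : TangentSpace I x) :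
    ricci g x v w = metricTrace g x fun u u' => curvatureForm g x v w u u' := by
  have h_coord : ∀ (i) (u : TangentSpace I x),
      (tangentBasis x).coord i u = g.toFun x u (dualVec g x i) := fun i u => by
    rw [g.symm]
    conv_rhs => rw [← (tangentBasis x).sum_repr u, map_sum]
    simp only [map_smul, metric_dualVec, smul_eq_mul, mul_ite, mul_one, mul_zero]
    simp
  rw [ricci, metricTrace]
  exact Finset.sum_congr rfl fun i _ => h_coord i _

/-- The Ricci curvature as a bilinear form. -/
def ricciForm : TangentSpace I x →ₗ[ℝ] TangentSpace I x →ₗ[ℝ] ℝ :=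
  LinearMap.mk₂ ℝ (fun v w => ∑ i, (tangentBasis x).coord i
      (curvatureAt g x (tangentBasis x i) v w))
    (fun v v' w => by
      simp only [(isLinearMap_curvatureAt_middle g _ w).map_add, map_add, Finset.sum_add_distrib])
    (fun c v w => by
      simp only [(isLinearMap_curvatureAt_middle g _ w).map_smul, map_smul, Finset.smul_sum])
    (fun v w w' => by
      simp only [(isLinearMap_curvatureAt_right g _ v).map_add, map_add, Finset.sum_add_distrib])
    (fun c v w => by
      simp only [(isLinearMap_curvatureAt_right g _ v).map_smul, map_smul, Finset.smul_sum])

lemma contMDiff_ricci (hX : CMDiff ∞ (T% X)) (hY : CMDiff ∞ (T% Y)) :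
    CMDiff ∞ fun y => ricci g y (X y) (Y y) := by
  simp_rw [ricci_eq_metricTrace]
  refine contMDiff_scalar_metricTrace g (fun y => curvatureForm g y (X y) (Y y))
    fun U U' hU hU' => ?_
  refine (contMDiff_metric g (contMDiff_curvature g hU hX hY) hU').congr fun y => ?_
  simp only [curvatureForm, LinearMap.mk₂_apply, curvatureAt_apply g y hU hX hY]

lemma contMDiff_schoutenTrace : CMDiff ∞ (schoutenTrace g) := by
  have h : CMDiff ∞ fun y => metricTrace g y (ricci g y) :=
    contMDiff_scalar_metricTrace g (ricciForm g) fun X Y hX hY => contMDiff_ricci g hX hY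
  exact (h.mul (contMDiff_const (c := (2 * (dimR g - 1))⁻¹))).congr fun y => div_eq_mul_inv _ _

end Curvature

/-! ### The degenerate Laplacian -/

lemma logWeight_apply {M : Type*} {V : M → Type*} [∀ x, AddCommGroup (V x)] [∀ x, Module ℝ (V x)]
    (w : ℝ) (x : M) (p : V x × V x) : logWeight w x p = (w • p.1 + p.2, w • p.2) := rfl

section Connections

variable {E : Type*} [NormedAddCommGroup E] [NormedSpace ℝ E]
  {H : Type*} [TopologicalSpace H] {I : ModelWithCorners ℝ E H}
  {M : Type*} [TopologicalSpace M] [ChartedSpace H M]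

lemma mdifferentiableAt_trivial_iff {f : M → ℝ} {x : M} :
    MDifferentiableAt I (I.prod 𝓘(ℝ))
      (fun y => TotalSpace.mk' ℝ (E := Bundle.Trivial M ℝ) y (f y)) x ↔ MDiffAt f x := by
  simp only [mdifferentiableAt_totalSpace]
  exact and_iff_right mdifferentiableAt_id

lemma mvfderiv_log {σ L : M → ℝ} (hσ : CMDiff ∞ σ) {x : M} (hx : 0 < σ x)
    (hL : L =ᶠ[𝓝 x] fun y => Real.log (σ y)) :
    mvfderiv I L x = (σ x)⁻¹ • mvfderiv I σ x := by
  have h1 : mvfderiv I L x = mvfderiv I (Real.log ∘ σ) x := mvfderiv_congr hL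
  have hd : MDiffAt Real.log (σ x) :=
    (Real.differentiableAt_log hx.ne').mdifferentiableAt
  have h2 : mfderiv 𝓘(ℝ, ℝ) 𝓘(ℝ, ℝ) Real.log (σ x) =
    ContinuousLinearMap.smulRight (1 : ℝ →L[ℝ] ℝ) (σ x)⁻¹ := by
    rw [mfderiv_eq_fderiv]
    exact ((Real.hasDerivAt_log hx.ne').hasFDerivAt).fderiv
  rw [h1]
  ext v
  simp only [mvfderiv]
  rw [mfderiv_comp x hd ((hσ x).mdifferentiableAt (by simp)), h2]
  simp only [ContinuousLinearMap.comp_apply, smul_apply, smul_eq_mul]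
  rw [mul_comm]
  rfl

variable [IsManifold I ∞ M]
  {F : Type*} [NormedAddCommGroup F] [NormedSpace ℝ F]
  {V : M → Type*} [TopologicalSpace (TotalSpace F V)]
  [∀ x, AddCommGroup (V x)] [∀ x, Module ℝ (V x)] [∀ x, TopologicalSpace (V x)]
  [∀ x, IsTopologicalAddGroup (V x)] [∀ x, ContinuousSMul ℝ (V x)]
  [FiberBundle F V] [VectorBundle ℝ F V]

variable (F) in
/-- A connection which maps smooth sections to smooth sections. -/
structure IsSmoothConnection (cov : (∀ x, V x) → ∀ x, TangentSpace I x →L[ℝ] V x) : Prop where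
  isCov : IsCovariantDerivativeOn F cov Set.univ
  smooth : ∀ s : ∀ x, V x, CMDiff ∞ (T% s) →
    ContMDiff I (I.prod 𝓘(ℝ, E →L[ℝ] F)) ∞
      (fun x => TotalSpace.mk' (E →L[ℝ] F) (E := fun x => TangentSpace I x →L[ℝ] V x) x (cov s x))

lemma isSmoothConnection_scalarCov :
    IsSmoothConnection (I := I) (M := M) ℝ (V := Bundle.Trivial M ℝ) scalarCov where
  isCov :=
    { add := fun hs hs' _ => mvfderiv_add (mdifferentiableAt_trivial_iff.mp hs)
        (mdifferentiableAt_trivial_iff.mp hs')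
      leibniz := fun hs hf _ => mvfderiv_smul hf (mdifferentiableAt_trivial_iff.mp hs) }
  smooth _ hs x := contMDiffAt_mvfderiv (contMDiff_trivial_iff.mp hs x)

namespace IsSmoothConnection

variable {cov : (∀ x, V x) → ∀ x, TangentSpace I x →L[ℝ] V x} (hcov : IsSmoothConnection F cov)
include hcov

lemma contMDiff_apply {s : ∀ x, V x} (hs : CMDiff ∞ (T% s)) {X : ∀ x : M, TangentSpace I x}
    (hX : CMDiff ∞ (T% X)) : CMDiff ∞ (T% fun y => cov s y (X y)) :=
  fun x => (hcov.smooth s hs x).clm_bundle_apply (F₁ := E) (hX x)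

lemma mdifferentiableAt_apply {s : ∀ x, V x} (hs : CMDiff ∞ (T% s))
    {X : ∀ x : M, TangentSpace I x} {x : M} (hX : MDiffAt (T% X) x) :
    MDiffAt (T% fun y => cov s y (X y)) x :=
  ((hcov.smooth s hs x).mdifferentiableAt (by simp)).clm_bundle_apply (F₁ := E) hX

lemma add {s s' : ∀ x, V x} {x : M} (hs : MDiffAt (T% s) x) (hs' : MDiffAt (T% s') x) :
    cov (s + s') x = cov s x + cov s' x := hcov.isCov.add hs hs'

lemma leibniz {s : ∀ x, V x} {f : M → ℝ} {x : M} (hf : MDiffAt f x) (hs : MDiffAt (T% s) x) :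
    cov (f • s) x = f x • cov s x + (mvfderiv I f x).smulRight (s x) := hcov.isCov.leibniz hs hf

lemma const_smul {s : ∀ x, V x} {x : M} (c : ℝ) (hs : MDiffAt (T% s) x) :
    cov (c • s) x = c • cov s x := hcov.isCov.smul_const c hs

lemma logCov_logWeight (a w : ℝ) {s : ∀ x, V x × V x} {x : M}
    (h1 : MDiffAt (T% fun x => (s x).1) x) (h2 : MDiffAt (T% fun x => (s x).2) x) :
    logCov cov (fun y => a • s y + (2 : ℝ) • logWeight w y (s y)) x
      = ((a + 2 * w) • cov (fun y => (s y).1) x + (2 : ℝ) • cov (fun y => (s y).2) x).prod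
        ((a + 2 * w) • cov (fun y => (s y).2) x) := by
  have e1 : (fun y => (a • s y + (2 : ℝ) • logWeight w y (s y)).1)
      = (a + 2 * w) • (fun y => (s y).1) + (2 : ℝ) • fun y => (s y).2 := by
    ext y
    simp only [logWeight_apply, Prod.fst_add, Prod.smul_fst, Pi.add_apply, Pi.smul_apply]
    module
  have e2 : (fun y => (a • s y + (2 : ℝ) • logWeight w y (s y)).2)
      = (a + 2 * w) • fun y => (s y).2 := by
    ext y
    simp only [logWeight_apply, Prod.snd_add, Prod.smul_snd, Pi.smul_apply]
    module
  have c1 : MDiffAt (T% ((a + 2 * w) • fun y => (s y).1)) x :=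
    MDifferentiableAt.smul_section (f := fun _ => a + 2 * w) mdifferentiableAt_const h1
  have c2 : MDiffAt (T% ((2 : ℝ) • fun y => (s y).2)) x :=
    MDifferentiableAt.smul_section (f := fun _ => (2 : ℝ)) mdifferentiableAt_const h2
  rw [logCov, e1, e2, hcov.add c1 c2, hcov.const_smul _ h1, hcov.const_smul _ h2,
    hcov.const_smul _ h2]

end IsSmoothConnection

end Connections

section Laplacian

variable {E : Type*} [NormedAddCommGroup E] [NormedSpace ℝ E] [FiniteDimensional ℝ E]
  {H : Type*} [TopologicalSpace H] {I : ModelWithCorners ℝ E H}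
  {M : Type*} [TopologicalSpace M] [ChartedSpace H M] [IsManifold I ∞ M]
  (g : PseudoMetric I M)

/-- The Hessian `∇_a ∇_b φ` of a function. -/
def scalarHessian (φ : M → ℝ) (x : M) (v w : TangentSpace I x) : ℝ :=
  hessian (V := fun _ => ℝ) g scalarCov φ x v w

/-- The Laplacian `g^{ab} ∇_a ∇_b φ` of a function. -/
def scalarLaplacian (φ : M → ℝ) (x : M) : ℝ :=
  laplacian (V := fun _ => ℝ) g scalarCov φ x

lemma scalarHessian_log {σ L : M → ℝ} (hσ : CMDiff ∞ σ) (hLs : CMDiff ∞ L) {x : M} (hx : 0 < σ x)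
    (hL : L =ᶠ[𝓝 x] fun y => Real.log (σ y)) (v w : TangentSpace I x) :
    scalarHessian g L x v w
      = (σ x)⁻¹ * scalarHessian g σ x v w
        - ((σ x)⁻¹) ^ 2 * (mvfderiv I σ x v * mvfderiv I σ x w) := by
  have hw := mdifferentiableAt_ext w
  have hev : ext w x = w := ext_apply_self w
  have hdL : MDiffAt (fun y => mvfderiv I L y (ext w y)) x :=
    mdifferentiableAt_mvfderiv_apply (hLs x) hw
  have hpos : ∀ᶠ y in 𝓝 x, 0 < σ y := hσ.continuous.continuousAt.eventually (lt_mem_nhds hx)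
  have hg : (fun y => mvfderiv I σ y (ext w y))
      =ᶠ[𝓝 x] σ • fun y => mvfderiv I L y (ext w y) := by
    filter_upwards [hpos, hL.eventually_nhds] with y hy hy'
    rw [Pi.smul_apply', mvfderiv_log hσ hy hy', smul_apply, smul_eq_mul, smul_eq_mul,
      mul_inv_cancel_left₀ hy.ne']
  have h3 : mvfderiv I (fun y => mvfderiv I σ y (ext w y)) x v
      = σ x * mvfderiv I (fun y => mvfderiv I L y (ext w y)) x v
        + mvfderiv I σ x v * ((σ x)⁻¹ * mvfderiv I σ x w) := by
    rw [mvfderiv_congr hg, mvfderiv_smul ((hσ x).mdifferentiableAt (by simp)) hdL]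
    simp only [add_apply, smul_apply, ContinuousLinearMap.smulRight_apply, hev, smul_eq_mul,
      mvfderiv_log hσ hx hL]
  simp only [scalarHessian, hessian, scalarCov]
  rw [h3, mvfderiv_log hσ hx hL]
  simp only [smul_apply, smul_eq_mul]
  field_simp
  ring

lemma scalarLaplacian_log {σ L : M → ℝ} (hσ : CMDiff ∞ σ) (hLs : CMDiff ∞ L) {x : M} (hx : 0 < σ x)
    (hL : L =ᶠ[𝓝 x] fun y => Real.log (σ y)) :
    scalarLaplacian g L x
      = (σ x)⁻¹ * scalarLaplacian g σ x
        - ((σ x)⁻¹) ^ 2 * mvfderiv I σ x (sharp g x (mvfderiv I σ x)) := by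
  have h1 := metricTrace_smul_left g x (mvfderiv I σ x) (mvfderiv I σ x : TangentSpace I x →ₗ[ℝ] ℝ)
  simp only [metricTrace, ContinuousLinearMap.coe_coe, smul_eq_mul] at h1
  rw [← h1]
  simp only [scalarLaplacian, laplacian, metricTrace, Finset.mul_sum, ← Finset.sum_sub_distrib]
  exact Finset.sum_congr rfl fun i _ => scalarHessian_log g hσ hLs hx hL _ _

variable {F : Type*} [NormedAddCommGroup F] [NormedSpace ℝ F]
  {V : M → Type*} [TopologicalSpace (TotalSpace F V)]
  [∀ x, AddCommGroup (V x)] [∀ x, Module ℝ (V x)] [∀ x, TopologicalSpace (V x)]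
  [∀ x, IsTopologicalAddGroup (V x)] [∀ x, ContinuousSMul ℝ (V x)]
  [FiberBundle F V] [VectorBundle ℝ F V]
  {cov : (∀ x, V x) → ∀ x, TangentSpace I x →L[ℝ] V x}

namespace IsSmoothConnection

variable (hcov : IsSmoothConnection F cov)
include hcov

lemma hessian_add {s s' : ∀ x, V x} (hs : CMDiff ∞ (T% s)) (hs' : CMDiff ∞ (T% s')) (x : M)
    (v w : TangentSpace I x) :
    hessian g cov (s + s') x v w = hessian g cov s x v w + hessian g cov s' x v w := by
  have h : (fun y => cov (s + s') y (ext w y))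
      = (fun y => cov s y (ext w y)) + fun y => cov s' y (ext w y) := by
    ext y
    rw [hcov.add (mdifferentiableAt_of_smooth hs y) (mdifferentiableAt_of_smooth hs' y)]
    rfl
  have hw := mdifferentiableAt_ext w
  simp only [hessian]
  rw [h, hcov.add (hcov.mdifferentiableAt_apply hs hw) (hcov.mdifferentiableAt_apply hs' hw),
    hcov.add (mdifferentiableAt_of_smooth hs x) (mdifferentiableAt_of_smooth hs' x)]
  simp only [add_apply]
  abel

lemma hessian_smul {s : ∀ x, V x} {φ : M → ℝ} (hφ : CMDiff ∞ φ) (hs : CMDiff ∞ (T% s)) (x : M)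
    (v w : TangentSpace I x) :
    hessian g cov (φ • s) x v w = φ x • hessian g cov s x v w + mvfderiv I φ x v • cov s x w
      + mvfderiv I φ x w • cov s x v
      + scalarHessian g φ x v w • s x := by
  have hdφ : ∀ y, MDiffAt φ y := fun y => (hφ y).mdifferentiableAt (by simp)
  have hds := mdifferentiableAt_of_smooth hs
  have h : (fun y => cov (φ • s) y (ext w y))
      = φ • (fun y => cov s y (ext w y)) + (fun y => mvfderiv I φ y (ext w y)) • s := by
    ext y
    rw [hcov.leibniz (hdφ y) (hds y)]
    rfl
  have hw := mdifferentiableAt_ext w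
  have h1 := hcov.mdifferentiableAt_apply hs hw
  have h2 : MDiffAt (fun y => mvfderiv I φ y (ext w y)) x :=
    mdifferentiableAt_mvfderiv_apply (hφ x) hw
  have hev : ext w x = w := ext_apply_self w
  simp only [hessian]
  rw [h, hcov.add ((hdφ x).smul_section h1) (h2.smul_section (hds x)),
    hcov.leibniz (hdφ x) h1, hcov.leibniz h2 (hds x), hcov.leibniz (hdφ x) (hds x)]
  simp only [add_apply, smul_apply, ContinuousLinearMap.smulRight_apply, hev,
    scalarHessian, hessian, scalarCov]
  module

lemma laplacian_add {s s' : ∀ x, V x} (hs : CMDiff ∞ (T% s)) (hs' : CMDiff ∞ (T% s')) (x : M) :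
    laplacian g cov (s + s') x = laplacian g cov s x + laplacian g cov s' x := by
  simp only [laplacian, metricTrace, hcov.hessian_add g hs hs', Finset.sum_add_distrib]

lemma laplacian_smul {s : ∀ x, V x} {φ : M → ℝ} (hφ : CMDiff ∞ φ) (hs : CMDiff ∞ (T% s)) (x : M) :
    laplacian g cov (φ • s) x = φ x • laplacian g cov s x
      + (2 : ℝ) • cov s x (sharp g x (mvfderiv I φ x))
      + scalarLaplacian g φ x • s x := by
  have h1 := metricTrace_smul_left g x (mvfderiv I φ x) (cov s x : TangentSpace I x →ₗ[ℝ] V x)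
  have h2 := metricTrace_smul_right g x (mvfderiv I φ x) (cov s x : TangentSpace I x →ₗ[ℝ] V x)
  simp only [metricTrace, ContinuousLinearMap.coe_coe] at h1 h2
  have h3 : scalarLaplacian g φ x
      = ∑ i, scalarHessian g φ x (tangentBasis x i) (dualVec g x i) := rfl
  rw [h3]
  simp only [laplacian, metricTrace, hcov.hessian_smul g hφ hs, Finset.sum_add_distrib]
  rw [h1, h2, ← Finset.smul_sum, ← Finset.sum_smul]
  module

lemma laplacian_const_smul {s : ∀ x, V x} (c : ℝ) (hs : CMDiff ∞ (T% s)) (x : M) :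
    laplacian g cov (c • s) x = c • laplacian g cov s x := by
  have hw := fun w : TangentSpace I x => hcov.mdifferentiableAt_apply hs (mdifferentiableAt_ext w)
  have h : ∀ w : TangentSpace I x, (fun y => cov (c • s) y (ext w y))
      = c • fun y => cov s y (ext w y) := fun w => by
    ext y
    rw [hcov.const_smul c (mdifferentiableAt_of_smooth hs y)]
    rfl
  simp only [laplacian, metricTrace, hessian, h, hcov.const_smul c (hw _),
    hcov.const_smul c (mdifferentiableAt_of_smooth hs x), smul_apply, ← smul_sub,
    ← Finset.smul_sum]

lemma hessian_tensorial {s : ∀ x, V x} (hs : CMDiff ∞ (T% s)) (x : M) (v : TangentSpace I x) :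
    TensorialAt I E (fun W : ∀ x : M, TangentSpace I x =>
      cov (fun y => cov s y (W y)) x v - cov s x (leviCivita g W x v)) x where
  smul {f W} hf hW := by
    have h : (fun y => cov s y ((f • W) y)) = f • fun y => cov s y (W y) := by
      ext y; simp
    rw [h, hcov.leibniz hf (hcov.mdifferentiableAt_apply hs hW), leviCivita_smul g hf hW]
    simp only [add_apply, smul_apply, ContinuousLinearMap.smulRight_apply, map_add, map_smul]
    module
  add {W W'} hW hW' := by
    have h : (fun y => cov s y ((W + W') y))
        = (fun y => cov s y (W y)) + fun y => cov s y (W' y) := by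
      ext y; simp
    rw [h, hcov.add (hcov.mdifferentiableAt_apply hs hW) (hcov.mdifferentiableAt_apply hs hW'),
      leviCivita_add g hW hW']
    simp only [add_apply, map_add]
    module

lemma hessian_eq {s : ∀ x, V x} (hs : CMDiff ∞ (T% s)) {x : M} (v : TangentSpace I x)
    {W : ∀ x : M, TangentSpace I x} (hW : MDiffAt (T% W) x) :
    hessian g cov s x v (W x)
      = cov (fun y => cov s y (W y)) x v - cov s x (leviCivita g W x v) :=
  (hcov.hessian_tensorial g hs x v).pointwise (mdifferentiableAt_ext _) hW
    (ext_apply_self _)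

variable [T2Space M]

/-- The Hessian as a bilinear form. -/
def hessianForm {s : ∀ x, V x} (hs : CMDiff ∞ (T% s)) (x : M) :
    TangentSpace I x →ₗ[ℝ] TangentSpace I x →ₗ[ℝ] V x :=
  LinearMap.mk₂ ℝ (hessian g cov s x)
    (fun v v' w => by simp only [hessian, map_add]; abel)
    (fun c v w => by simp only [hessian, map_smul, smul_sub])
    (fun v w w' => by
      obtain ⟨W, hW, rfl⟩ := exists_global_extension w
      obtain ⟨W', hW', rfl⟩ := exists_global_extension w'
      have hd := mdifferentiableAt_of_smooth hW x
      have hd' := mdifferentiableAt_of_smooth hW' x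
      rw [show W x + W' x = (W + W') x from rfl,
        hcov.hessian_eq g hs v (mdifferentiableAt_add_section hd hd'), hcov.hessian_eq g hs v hd,
        hcov.hessian_eq g hs v hd']
      exact (hcov.hessian_tensorial g hs x v).add hd hd')
    (fun c v w => by
      obtain ⟨W, hW, rfl⟩ := exists_global_extension w
      have hd := mdifferentiableAt_of_smooth hW x
      have hc : MDiffAt (fun _ : M => c) x := mdifferentiableAt_const
      rw [show c • W x = ((fun _ : M => c) • W) x from rfl,
        hcov.hessian_eq g hs v (hc.smul_section hd), hcov.hessian_eq g hs v hd]
      exact (hcov.hessian_tensorial g hs x v).smul hc hd)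

lemma contMDiff_laplacian {s : ∀ x, V x} (hs : CMDiff ∞ (T% s)) :
    CMDiff ∞ (T% (laplacian g cov s)) := by
  refine contMDiff_metricTrace g (fun y => hcov.hessianForm g hs y) fun X Y hX hY => ?_
  have h : (fun y => hcov.hessianForm g hs y (X y) (Y y))
      = (fun y => cov (fun y => cov s y (Y y)) y (X y))
        - fun y => cov s y (leviCivita g Y y (X y)) := by
    ext y
    exact hcov.hessian_eq g hs (X y) (mdifferentiableAt_of_smooth hY y)
  have h' := (hcov.contMDiff_apply (hcov.contMDiff_apply hs hY) hX).sub_section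
    (hcov.contMDiff_apply hs (contMDiff_leviCivita g hX hY))
  exact h'.congr fun y => congrArg (TotalSpace.mk' F y) (congrFun h y)

end IsSmoothConnection

variable [T2Space M]

lemma contMDiff_scalarLaplacian {φ : M → ℝ} (hφ : CMDiff ∞ φ) : CMDiff ∞ (scalarLaplacian g φ) :=
  contMDiff_trivial_iff.mp (isSmoothConnection_scalarCov.contMDiff_laplacian g
    (contMDiff_trivial_iff.mpr hφ))

lemma contMDiff_sharp_mvfderiv {φ : M → ℝ} (hφ : CMDiff ∞ φ) :
    CMDiff ∞ (T% fun y => sharp g y (mvfderiv I φ y)) := by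
  refine contMDiff_of_metric g fun X hX => ?_
  refine (contMDiff_mvfderiv_apply hφ hX).congr fun y => ?_
  rw [toFun_sharp]

end Laplacian

section ScaleTractor

variable {E : Type*} [NormedAddCommGroup E] [NormedSpace ℝ E] [FiniteDimensional ℝ E]
  {H : Type*} [TopologicalSpace H] {I : ModelWithCorners ℝ E H}
  {M : Type*} [TopologicalSpace M] [ChartedSpace H M] [IsManifold I ∞ M]
  (g : PseudoMetric I M) {σ : M → ℝ}

lemma scaleTractor_fst (hd : dimR g ≠ 0) (x : M) : (scaleTractor g σ x).1 = σ x := by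
  have h : (scaleTractor g σ x).1
      = (dimR g)⁻¹ * (1 * ((dimR g - 2) * σ x + 2 * (1 * σ x))) := rfl
  rw [h]
  field_simp
  ring

lemma scaleTractor_snd (hd : dimR g ≠ 0) {x : M} (hσ : MDiffAt σ x) :
    (scaleTractor g σ x).2.1 = mvfderiv I σ x := by
  have h : (scaleTractor g σ x).2.1
      = (dimR g)⁻¹ • mvfderiv I (fun y => (dimR g - 2) * σ y + 2 * (1 * σ y)) x := rfl
  have h' : (fun y => (dimR g - 2) * σ y + 2 * (1 * σ y)) = dimR g • σ := by
    ext y; simp only [Pi.smul_apply, smul_eq_mul]; ring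
  have h2 : mvfderiv I (dimR g • σ) x = dimR g • mvfderiv I σ x := by
    ext v
    exact congrArg (fun f => f v) (const_smul_mfderiv hσ (dimR g))
  rw [h, h', h2, smul_smul, inv_mul_cancel₀ hd, one_smul]

lemma scaleTractor_trd (x : M) : (scaleTractor g σ x).2.2
    = -((dimR g)⁻¹ * (scalarLaplacian g σ x + schoutenTrace g x * σ x)) := by
  have h : (scaleTractor g σ x).2.2
      = (dimR g)⁻¹ * (-(scalarLaplacian g σ x + schoutenTrace g x * (1 * σ x))) := rfl
  rw [h]; ring

lemma scaleNormSq_eq (hd : dimR g ≠ 0) {x : M} (hσ : MDiffAt σ x) :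
    scaleNormSq g σ x = mvfderiv I σ x (sharp g x (mvfderiv I σ x))
      + 2 * σ x * (scaleTractor g σ x).2.2 := by
  rw [scaleNormSq, scaleTractor_fst g hd, scaleTractor_snd g hd hσ]

variable [T2Space M]

lemma contMDiff_scaleTractor_trd (hσ : CMDiff ∞ σ) :
    CMDiff ∞ (fun x => (scaleTractor g σ x).2.2) :=
  (contMDiff_const.mul ((contMDiff_scalarLaplacian g hσ).add
    ((contMDiff_schoutenTrace g).mul hσ))).neg.congr fun x => scaleTractor_trd g x

lemma contMDiff_scaleNormSq (hd : dimR g ≠ 0) (hσ : CMDiff ∞ σ) :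
    CMDiff ∞ (scaleNormSq g σ) :=
  ((contMDiff_mvfderiv_apply hσ (contMDiff_sharp_mvfderiv g hσ)).add
    ((contMDiff_const.mul hσ).mul (contMDiff_scaleTractor_trd g hσ))).congr
    fun x => scaleNormSq_eq g hd ((hσ x).mdifferentiableAt (by simp))

end ScaleTractor

section DegenerateLaplacian

variable {E : Type*} [NormedAddCommGroup E] [NormedSpace ℝ E] [FiniteDimensional ℝ E]
  {H : Type*} [TopologicalSpace H] {I : ModelWithCorners ℝ E H}
  {M : Type*} [TopologicalSpace M] [ChartedSpace H M] [IsManifold I ∞ M]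
  (g : PseudoMetric I M) {σ : M → ℝ}
  {V : M → Type*} [∀ x, AddCommGroup (V x)] [∀ x, Module ℝ (V x)] [∀ x, TopologicalSpace (V x)]
  {cov : (∀ x, V x) → ∀ x, TangentSpace I x →L[ℝ] V x}

lemma laplacian_logCov (s : ∀ x, V x × V x) (x : M) :
    laplacian g (logCov cov) s x
      = (laplacian g cov (fun y => (s y).1) x, laplacian g cov (fun y => (s y).2) x) :=
  Prod.ext Prod.fst_sum Prod.snd_sum

variable (σ cov) in
/-- The derivative of `I · D` on densities of weight `w` with respect to `w`; it is the off-diagonal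
entry of `I · D` on log densities. -/
def IdotDWeightDeriv (w : ℝ) (s : ∀ x, V x) (x : M) : V x :=
  -((σ x * schoutenTrace g x) • s x) + (2 : ℝ) • cov s x (sharp g x (mvfderiv I σ x))
    + ((scaleTractor g σ x).2.2 * (dimR g - 2 + 4 * w)) • s x

variable {F : Type*} [NormedAddCommGroup F] [NormedSpace ℝ F] [TopologicalSpace (TotalSpace F V)]
  [∀ x, IsTopologicalAddGroup (V x)] [∀ x, ContinuousSMul ℝ (V x)]
  [FiberBundle F V] [VectorBundle ℝ F V]

namespace IsSmoothConnection

variable (hcov : IsSmoothConnection F cov)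
include hcov

lemma IdotDWeightDeriv_add (w : ℝ) {s s' : ∀ x, V x} (hs : CMDiff ∞ (T% s))
    (hs' : CMDiff ∞ (T% s')) :
    IdotDWeightDeriv g σ cov w (s + s') = IdotDWeightDeriv g σ cov w s
      + IdotDWeightDeriv g σ cov w s' := by
  ext x
  have h := mdifferentiableAt_of_smooth hs x
  have h' := mdifferentiableAt_of_smooth hs' x
  simp only [IdotDWeightDeriv, Pi.add_apply]
  rw [hcov.add h h', add_apply]
  module

lemma IdotDWeightDeriv_const_smul (w c : ℝ) {s : ∀ x, V x} (hs : CMDiff ∞ (T% s)) :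
    IdotDWeightDeriv g σ cov w (c • s) = c • IdotDWeightDeriv g σ cov w s := by
  ext x
  simp only [IdotDWeightDeriv, Pi.smul_apply]
  rw [hcov.const_smul c (mdifferentiableAt_of_smooth hs x), smul_apply]
  module

variable (hd : dimR g ≠ 0) (hσ : CMDiff ∞ σ)
include hd hσ

lemma IdotDWeightDeriv_scale_smul (w : ℝ) {s : ∀ x, V x} (hs : CMDiff ∞ (T% s)) (x : M) :
    IdotDWeightDeriv g σ cov (w + 1) (σ • s) x = σ x • IdotDWeightDeriv g σ cov w s x
      + (2 * scaleNormSq g σ x) • s x := by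
  have h := mdifferentiableAt_of_smooth hs x
  have hσ' := (hσ x).mdifferentiableAt (n := ∞) (by simp)
  simp only [IdotDWeightDeriv]
  rw [scaleNormSq_eq g hd hσ', hcov.leibniz hσ' h]
  simp only [add_apply, smul_apply, ContinuousLinearMap.smulRight_apply, Pi.smul_apply']
  module

lemma IdotD_weight (w : ℝ) {s : ∀ x, V x} {x : M} (hs : MDiffAt (T% s) x) :
    IdotD g σ cov (weight w) s x
      = -(σ x • (laplacian g cov s x + (schoutenTrace g x * w) • s x))
        + (dimR g - 2 + 2 * w) • cov s x (sharp g x (mvfderiv I σ x))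
        + ((scaleTractor g σ x).2.2 * (dimR g - 2 + 2 * w) * w) • s x := by
  have h : (fun y => (dimR g - 2) • s y + (2 : ℝ) • weight (V := V) w y (s y))
      = (dimR g - 2 + 2 * w) • s := by
    ext y
    simp only [weight, LinearMap.smul_apply, LinearMap.id_apply, Pi.smul_apply]
    module
  simp only [IdotD, thomasD]
  rw [h, hcov.const_smul _ hs, scaleTractor_fst g hd,
    scaleTractor_snd g hd ((hσ x).mdifferentiableAt (by simp))]
  simp only [weight, LinearMap.smul_apply, LinearMap.id_apply, smul_apply]
  module

lemma IdotD_add (w : ℝ) {s s' : ∀ x, V x} (hs : CMDiff ∞ (T% s)) (hs' : CMDiff ∞ (T% s')) :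
    IdotD g σ cov (weight w) (s + s') =
      IdotD g σ cov (weight w) s + IdotD g σ cov (weight w) s' := by
  ext x
  have h := mdifferentiableAt_of_smooth hs x
  have h' := mdifferentiableAt_of_smooth hs' x
  rw [Pi.add_apply, hcov.IdotD_weight g hd hσ w h, hcov.IdotD_weight g hd hσ w h',
    hcov.IdotD_weight g hd hσ w (mdifferentiableAt_add_section h h'), hcov.laplacian_add g hs hs',
    hcov.add h h', add_apply, Pi.add_apply]
  module

lemma IdotD_const_smul (w c : ℝ) {s : ∀ x, V x} (hs : CMDiff ∞ (T% s)) :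
    IdotD g σ cov (weight w) (c • s) = c • IdotD g σ cov (weight w) s := by
  ext x
  have h := mdifferentiableAt_of_smooth hs x
  have hc : CMDiff ∞ (T% (c • s)) := contMDiff_const.smul_section hs
  rw [Pi.smul_apply, hcov.IdotD_weight g hd hσ w h,
    hcov.IdotD_weight g hd hσ w (mdifferentiableAt_of_smooth hc x),
    hcov.laplacian_const_smul g c hs, hcov.const_smul c h, smul_apply, Pi.smul_apply]
  module

lemma IdotD_smul (w : ℝ) {φ : M → ℝ} (hφ : CMDiff ∞ φ) {s : ∀ x, V x} (hs : CMDiff ∞ (T% s))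
    (x : M) :
    IdotD g σ cov (weight w) (φ • s) x = φ x • IdotD g σ cov (weight w) s x
      - σ x • ((2 : ℝ) • cov s x (sharp g x (mvfderiv I φ x))
        + scalarLaplacian g φ x • s x)
      + ((dimR g - 2 + 2 * w) * mvfderiv I φ x (sharp g x (mvfderiv I σ x))) • s x := by
  have h := mdifferentiableAt_of_smooth hs x
  have hφ' : MDiffAt φ x := (hφ x).mdifferentiableAt (by simp)
  rw [hcov.IdotD_weight g hd hσ w h, hcov.IdotD_weight g hd hσ w (hφ'.smul_section h),
    hcov.laplacian_smul g hφ hs, hcov.leibniz hφ' h, Pi.smul_apply']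
  simp only [add_apply, smul_apply, ContinuousLinearMap.smulRight_apply]
  module

lemma IdotD_scale_smul (w : ℝ) {s : ∀ x, V x} (hs : CMDiff ∞ (T% s)) (x : M) :
    IdotD g σ cov (weight (w + 1)) (σ • s) x = σ x • IdotD g σ cov (weight w) s x
      + (scaleNormSq g σ x * (dimR g + 2 * w)) • s x := by
  have h := mdifferentiableAt_of_smooth hs x
  rw [hcov.IdotD_smul g hd hσ (w + 1) hσ hs, hcov.IdotD_weight g hd hσ (w + 1) h,
    hcov.IdotD_weight g hd hσ w h, scaleNormSq_eq g hd ((hσ x).mdifferentiableAt (by simp))]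
  have hρ : scalarLaplacian g σ x
      = -(dimR g * (scaleTractor g σ x).2.2) - schoutenTrace g x * σ x := by
    rw [scaleTractor_trd]; field_simp; ring
  rw [hρ]
  module

lemma IdotD_log_smul (w : ℝ) {L : M → ℝ} (hLs : CMDiff ∞ L) {s : ∀ x, V x} (hs : CMDiff ∞ (T% s))
    {x : M} (hx : 0 < σ x) (hL : L =ᶠ[𝓝 x] fun y => Real.log (σ y)) :
    IdotD g σ cov (weight w) (L • s) x = L x • IdotD g σ cov (weight w) s x
      - IdotDWeightDeriv g σ cov w s x
      + (scaleNormSq g σ x * (dimR g + 2 * w - 1) * (σ x)⁻¹) • s x := by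
  rw [hcov.IdotD_smul g hd hσ w hLs hs, scaleNormSq_eq g hd ((hσ x).mdifferentiableAt (by simp))]
  have hρ : scalarLaplacian g L x
      = (σ x)⁻¹ * (-(dimR g * (scaleTractor g σ x).2.2) - schoutenTrace g x * σ x)
       - ((σ x)⁻¹) ^ 2 * mvfderiv I σ x (sharp g x (mvfderiv I σ x)) := by
    rw [scalarLaplacian_log g hσ hLs hx hL, scaleTractor_trd]; field_simp; ring
  rw [hρ, mvfderiv_log hσ hx hL, IdotDWeightDeriv]
  simp only [map_smul, smul_apply, smul_eq_mul]
  match_scalars <;> field_simp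
  ring

lemma IdotD_logWeight (w : ℝ) {s : ∀ x, V x × V x} (h1 : CMDiff ∞ (T% fun x => (s x).1))
    (h2 : CMDiff ∞ (T% fun x => (s x).2)) (x : M) :
    IdotD g σ (logCov cov) (logWeight w) s x
      = (IdotD g σ cov (weight w) (fun y => (s y).1) x
          + IdotDWeightDeriv g σ cov w (fun y => (s y).2) x,
        IdotD g σ cov (weight w) (fun y => (s y).2) x) := by
  have d1 := mdifferentiableAt_of_smooth h1 x
  have d2 := mdifferentiableAt_of_smooth h2 x
  rw [hcov.IdotD_weight g hd hσ w d1, hcov.IdotD_weight g hd hσ w d2]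
  simp only [IdotD, thomasD, IdotDWeightDeriv]
  rw [laplacian_logCov, hcov.logCov_logWeight _ _ d1 d2, scaleTractor_fst g hd,
    scaleTractor_snd g hd ((hσ x).mdifferentiableAt (by simp))]
  simp only [logWeight_apply, ContinuousLinearMap.prod_apply, add_apply, smul_apply,
    Prod.fst_add, Prod.snd_add, Prod.smul_fst, Prod.smul_snd, Prod.smul_mk, Prod.mk_add_mk,
    Prod.neg_mk]
  refine Prod.ext ?_ ?_ <;> dsimp only <;> module

variable [T2Space M]

lemma contMDiff_IdotD (w : ℝ) {s : ∀ x, V x} (hs : CMDiff ∞ (T% s)) :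
    CMDiff ∞ (T% (IdotD g σ cov (weight w) s)) := by
  have h : IdotD g σ cov (weight w) s
      = -(σ • (laplacian g cov s + (fun x => schoutenTrace g x * w) • s))
        + (fun _ : M => dimR g - 2 + 2 * w) • (fun x => cov s x (sharp g x (mvfderiv I σ x)))
        + (fun x => (scaleTractor g σ x).2.2 * (dimR g - 2 + 2 * w) * w) • s := by
    ext x
    exact hcov.IdotD_weight g hd hσ w (mdifferentiableAt_of_smooth hs x)
  rw [h]
  have hX := hcov.contMDiff_apply hs (contMDiff_sharp_mvfderiv g hσ)
  exact ((hσ.smul_section ((hcov.contMDiff_laplacian g hs).add_section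
    (((contMDiff_schoutenTrace g).mul contMDiff_const).smul_section hs))).neg_section.add_section
    (contMDiff_const.smul_section hX)).add_section
    ((((contMDiff_scaleTractor_trd g hσ).mul contMDiff_const).mul contMDiff_const).smul_section hs)

omit hd in
lemma contMDiff_IdotDWeightDeriv (w : ℝ) {s : ∀ x, V x} (hs : CMDiff ∞ (T% s)) :
    CMDiff ∞ (T% (IdotDWeightDeriv g σ cov w s)) := by
  have h : IdotDWeightDeriv g σ cov w s
      = -((fun x => σ x * schoutenTrace g x) • s)
        + (fun _ : M => (2 : ℝ)) • (fun x => cov s x (sharp g x (mvfderiv I σ x)))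
        + (fun x => (scaleTractor g σ x).2.2 * (dimR g - 2 + 4 * w)) • s := rfl
  rw [h]
  have hX := hcov.contMDiff_apply hs (contMDiff_sharp_mvfderiv g hσ)
  exact ((((hσ.mul (contMDiff_schoutenTrace g)).smul_section hs).neg_section).add_section
    (contMDiff_const.smul_section hX)).add_section
    (((contMDiff_scaleTractor_trd g hσ).mul contMDiff_const).smul_section hs)

end IsSmoothConnection

end DegenerateLaplacian

/-! ### The algebra of `x` and `y` -/

section SolutionAlgebra

variable {A : Type*} [AddCommGroup A] [Module ℝ A]

/-- Multiplication by `x` and the operators `y` in each weight, with the commutator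
`[y, x] = -(d + 2w) - 2ε`, where `ε` is the nilpotent part of the weight operator. -/
structure ScaleAlgebra (d : ℝ) (X ε : A →ₗ[ℝ] A) (Y : ℝ → A →ₗ[ℝ] A) : Prop where
  comm : ∀ w a, Y (w + 1) (X a) = X (Y w a) - (d + 2 * w) • a - (2 : ℝ) • ε a
  nil_X : ∀ a, ε (X a) = X (ε a)
  nil_Y : ∀ w a, ε (Y w a) = Y w (ε a)

/-- The iterates of `y`, each factor lowering the weight by one. -/
def iterY (Y : ℝ → A →ₗ[ℝ] A) (w : ℝ) : ℕ → A →ₗ[ℝ] A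
  | 0 => LinearMap.id
  | k + 1 => Y (w - k) ∘ₗ iterY Y w k

lemma iterY_zero (Y : ℝ → A →ₗ[ℝ] A) (w : ℝ) (a : A) : iterY Y w 0 a = a := rfl

lemma iterY_succ (Y : ℝ → A →ₗ[ℝ] A) (w : ℝ) (k : ℕ) (a : A) :
    iterY Y w (k + 1) a = Y (w - k) (iterY Y w k a) := rfl

lemma iterY_add (Y : ℝ → A →ₗ[ℝ] A) (w : ℝ) (m j : ℕ) (a : A) :
    iterY Y (w - m) j (iterY Y w m a) = iterY Y w (m + j) a := by
  induction j with
  | zero => rfl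
  | succ j ih =>
    rw [iterY_succ, ih, ← add_assoc, iterY_succ]
    congr 2
    push_cast; ring

namespace ScaleAlgebra

variable {d : ℝ} {X ε : A →ₗ[ℝ] A} {Y : ℝ → A →ₗ[ℝ] A} (hA : ScaleAlgebra d X ε Y)
include hA

lemma nil_pow_X (k : ℕ) (a : A) : ε ((X ^ k) a) = (X ^ k) (ε a) := by
  induction k with
  | zero => rfl
  | succ k ih => rw [pow_succ', Module.End.mul_apply, hA.nil_X, ih, Module.End.mul_apply]

lemma nil_iterY (w : ℝ) (k : ℕ) (a : A) : ε (iterY Y w k a) = iterY Y w k (ε a) := by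
  induction k with
  | zero => rfl
  | succ k ih => rw [iterY_succ, hA.nil_Y, ih, iterY_succ]

lemma Y_pow_X (w : ℝ) (k : ℕ) (a : A) :
    Y w ((X ^ (k + 1)) a) = (X ^ (k + 1)) (Y (w - (k + 1)) a)
      - ((k + 1) * (d + 2 * w - k - 2)) • (X ^ k) a - (2 * ((k : ℝ) + 1)) • (X ^ k) (ε a) := by
  have h (w : ℝ) (a : A) :
      Y w (X a) = X (Y (w - 1) a) - (d + 2 * (w - 1)) • a - (2 : ℝ) • ε a := by
    have := hA.comm (w - 1) a
    rwa [sub_add_cancel] at this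
  induction k generalizing w with
  | zero =>
    simp only [zero_add, pow_one, pow_zero, Module.End.one_apply, Nat.cast_zero]
    rw [h]
    module
  | succ k ih =>
    rw [pow_succ' X (k + 1), Module.End.mul_apply, h, ih (w - 1), hA.nil_pow_X,
      Module.End.mul_apply]
    simp only [map_sub, map_smul]
    rw [← Module.End.mul_apply X (X ^ k), ← Module.End.mul_apply X (X ^ k), ← pow_succ',
      show w - 1 - ((k : ℝ) + 1) = w - (((k + 1 : ℕ) : ℝ) + 1) by push_cast; ring]
    push_cast
    module

lemma iterY_X (w : ℝ) (k : ℕ) (a : A) :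
    iterY Y (w + 1) (k + 1) (X a) = X (iterY Y w (k + 1) a)
      - ((k + 1) * (d + 2 * w - k)) • iterY Y w k a
      - (2 * ((k : ℝ) + 1)) • iterY Y w k (ε a) := by
  induction k with
  | zero =>
    simp only [iterY_succ, iterY_zero, Nat.cast_zero, sub_zero]
    rw [hA.comm]
    module
  | succ k ih =>
    rw [iterY_succ, ih, map_sub, map_sub, map_smul, map_smul,
      show w + 1 - ((k + 1 : ℕ) : ℝ) = w - k by push_cast; ring, ← iterY_succ, ← iterY_succ,
      show w - (k : ℝ) = (w - ((k + 1 : ℕ) : ℝ)) + 1 by push_cast; ring, hA.comm, hA.nil_iterY,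
      ← iterY_succ]
    push_cast
    module

end ScaleAlgebra

/-- The operator `y` on pairs, where `N` is the derivative of `y` in the weight. -/
def pairY (Y N : ℝ → A →ₗ[ℝ] A) (w : ℝ) : A × A →ₗ[ℝ] A × A :=
  (Y w ∘ₗ LinearMap.fst ℝ A A + N w ∘ₗ LinearMap.snd ℝ A A).prod (Y w ∘ₗ LinearMap.snd ℝ A A)

lemma pairY_apply (Y N : ℝ → A →ₗ[ℝ] A) (w : ℝ) (p : A × A) :
    pairY Y N w p = (Y w p.1 + N w p.2, Y w p.2) := rfl

variable (A) in
/-- The nilpotent part of the weight operator on pairs. -/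
def pairNil : A × A →ₗ[ℝ] A × A := (LinearMap.snd ℝ A A).prod 0

lemma pairNil_apply (p : A × A) : pairNil A p = (p.2, 0) := rfl

lemma ScaleAlgebra.pair {d : ℝ} {X : A →ₗ[ℝ] A} {Y N : ℝ → A →ₗ[ℝ] A}
    (hA : ScaleAlgebra d X 0 Y) (hN : ∀ w a, N (w + 1) (X a) = X (N w a) - (2 : ℝ) • a) :
    ScaleAlgebra d (X.prodMap X) (pairNil A) (pairY Y N) where
  comm w p := by
    have h := hA.comm
    simp only [LinearMap.zero_apply, smul_zero, sub_zero] at h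
    refine Prod.ext ?_ ?_
    · simp only [pairY_apply, LinearMap.prodMap_apply, pairNil_apply, Prod.fst_sub, Prod.smul_fst,
        map_add, h, hN]
      module
    · simp only [pairY_apply, LinearMap.prodMap_apply, pairNil_apply, Prod.snd_sub, Prod.smul_snd,
        h]
      module
  nil_X p := by simp [pairNil_apply]
  nil_Y w p := by simp [pairNil_apply, pairY_apply]

lemma iterY_pair_snd (Y N : ℝ → A →ₗ[ℝ] A) (w : ℝ) (k : ℕ) (p : A × A) :
    (iterY (pairY Y N) w k p).2 = iterY Y w k p.2 := by
  induction k with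
  | zero => rfl
  | succ k ih => rw [iterY_succ, pairY_apply, iterY_succ, ih]

lemma iterY_pair_inl (Y N : ℝ → A →ₗ[ℝ] A) (w : ℝ) (k : ℕ) (a : A) :
    iterY (pairY Y N) w k (a, 0) = (iterY Y w k a, 0) := by
  induction k with
  | zero => rfl
  | succ k ih => rw [iterY_succ, ih, pairY_apply, iterY_succ]; simp

lemma prodMap_pow_apply (X : A →ₗ[ℝ] A) (k : ℕ) (p : A × A) :
    ((X.prodMap X) ^ k) p = ((X ^ k) p.1, (X ^ k) p.2) := by
  induction k with
  | zero => rfl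
  | succ k ih => rw [pow_succ', Module.End.mul_apply, ih, pow_succ', Module.End.mul_apply,
      Module.End.mul_apply]; rfl

/-- The coefficient conditions for a formal solution whose logarithms start at order `m`. The
series applied to the leading datum has coefficients `P` in its regular part and `L` in its
logarithmic part; `Q` weights the iterates of the auxiliary datum entering at order `m`. -/
structure LogRecurrence (m : ℕ) (P Q L : ℕ → ℝ) : Prop where
  below : ∀ k, k < m → L k = 0
  above : ∀ j, L (m + j) = -Q j
  log_step : ∀ k : ℕ, ((k : ℝ) + 1) * (m - (k + 1)) * L (k + 1) = L k
  reg_step : ∀ k : ℕ,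
    ((k : ℝ) + 1) * (m - (k + 1)) * P (k + 1) + (m - 2 * (k + 1)) * L (k + 1) = P k

/-- The logarithmic coefficients of a formal solution. -/
def logCoeff (Y : ℝ → A →ₗ[ℝ] A) (w : ℝ) (L : ℕ → ℝ) (f : A) (k : ℕ) : A := L k • iterY Y w k f

/-- The coefficients of a formal series starting at order `m` with the datum `b`. -/
def tailCoeff (Y : ℝ → A →ₗ[ℝ] A) (w : ℝ) (m : ℕ) (Q : ℕ → ℝ) (b : A) (k : ℕ) : A :=
  if m ≤ k then Q (k - m) • iterY Y (w - m) (k - m) b else 0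

/-- The regular coefficients of a formal solution, as pairs `(a, b)` standing for the log densities
`a + b log t`. The datum `W` is the one that cancels the obstruction at order `m`. -/
def regCoeff (Y N : ℝ → A →ₗ[ℝ] A) (w : ℝ) (m : ℕ) (P Q : ℕ → ℝ) (f : A) (W : A × A) (k : ℕ) :
    A × A :=
  (P k • iterY Y w k f, 0) + tailCoeff (pairY Y N) w m Q W k

section FormalSolution

variable {d : ℝ} {X : A →ₗ[ℝ] A} {Y N : ℝ → A →ₗ[ℝ] A} {m : ℕ} {P Q L : ℕ → ℝ}

lemma tailCoeff_lt {w : ℝ} {b : A} {k : ℕ} (hk : k < m) : tailCoeff Y w m Q b k = 0 :=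
  if_neg (by lia)

lemma tailCoeff_add {w : ℝ} {b : A} (j : ℕ) :
    tailCoeff Y w m Q b (m + j) = Q j • iterY Y (w - m) j b := by
  rw [tailCoeff, if_pos (by lia), Nat.add_sub_cancel_left]

lemma tailCoeff_zero {w : ℝ} {b : A} (k : ℕ) : tailCoeff Y w 0 Q b k = Q k • iterY Y w k b := by
  simp [tailCoeff]

lemma tailCoeff_mul_left {w : ℝ} {b : A} (c : ℝ) (k : ℕ) :
    tailCoeff Y w m (fun j => c * Q j) b k = c • tailCoeff Y w m Q b k := by
  simp only [tailCoeff, mul_smul, smul_ite, smul_zero]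

lemma regCoeff_lt {w : ℝ} {f : A} {W : A × A} {k : ℕ} (hk : k < m) :
    regCoeff Y N w m P Q f W k = (P k • iterY Y w k f, 0) := by
  rw [regCoeff, tailCoeff_lt hk, add_zero]

lemma regCoeff_add {w : ℝ} {f : A} {W : A × A} (j : ℕ) :
    regCoeff Y N w m P Q f W (m + j)
      = (P (m + j) • iterY Y w (m + j) f, 0) + Q j • iterY (pairY Y N) (w - m) j W := by
  rw [regCoeff, tailCoeff_add]

lemma ScaleAlgebra.iterY_X_of_weight (hA : ScaleAlgebra d X 0 Y) {w c : ℝ} (hw : d + 2 * w = c - 1)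
    (k : ℕ) (a : A) :
    iterY Y (w + 1) (k + 1) (X a)
      = X (iterY Y w (k + 1) a) - (((k : ℝ) + 1) * (c - (k + 1))) • iterY Y w k a := by
  rw [hA.iterY_X, hw]
  simp only [LinearMap.zero_apply, map_zero, smul_zero, sub_zero]
  module

lemma natCast_smul_iterY_pred (w : ℝ) (m j : ℕ) (a : A) :
    (m : ℝ) • iterY Y (w + 1 - m) (j + 1) (iterY Y w (m - 1) a)
      = (m : ℝ) • iterY Y w (m + j) a := by
  cases m with
  | zero => simp
  | succ m =>
    rw [show w + 1 - ((m + 1 : ℕ) : ℝ) = w - m by push_cast; ring, Nat.add_sub_cancel, iterY_add,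
      show m + (j + 1) = m + 1 + j by ring]

namespace LogRecurrence

variable (hR : LogRecurrence m P Q L)
include hR

lemma Q_step (j : ℕ) :
    (((m + j : ℕ) : ℝ) + 1) * (m - ((m + j : ℕ) + 1)) * Q (j + 1) = Q j := by
  have h := hR.log_step (m + j)
  rw [add_assoc m j 1, hR.above, hR.above] at h
  linarith

lemma regCoeff_snd {w : ℝ} {f : A} {W : A × A} (hW : W.2 = iterY Y w m f) (k : ℕ) :
    (regCoeff Y N w m P Q f W k).2 = -logCoeff Y w L f k := by
  rcases lt_or_ge k m with hk | hk
  · simp [regCoeff_lt hk, logCoeff, hR.below k hk]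
  · obtain ⟨j, rfl⟩ := Nat.exists_eq_add_of_le hk
    rw [regCoeff_add, Prod.snd_add, Prod.smul_snd, iterY_pair_snd, hW, iterY_add, logCoeff,
      hR.above]
    simp

lemma Y_logCoeff {w : ℝ} (f : A) (k : ℕ) :
    Y (w - k) (logCoeff Y w L f k)
      = (((k : ℝ) + 1) * (m - (k + 1))) • logCoeff Y w L f (k + 1) := by
  rw [logCoeff, logCoeff, smul_smul, hR.log_step, map_smul, iterY_succ]

lemma Y_tailCoeff {w : ℝ} (b : A) (k : ℕ) :
    Y (w - k) (tailCoeff Y w m Q b k)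
      = (((k : ℝ) + 1) * (m - (k + 1))) • tailCoeff Y w m Q b (k + 1) := by
  rcases lt_trichotomy (k + 1) m with hk | hk | hk
  · rw [tailCoeff_lt (by lia), tailCoeff_lt hk, map_zero, smul_zero]
  · have hz : ((k : ℝ) + 1) * (m - (k + 1)) = 0 := by rw [← hk]; push_cast; ring
    rw [tailCoeff_lt (by lia), map_zero, hz, zero_smul]
  · obtain ⟨j, rfl⟩ := Nat.exists_eq_add_of_le (by lia : m ≤ k)
    rw [add_assoc, tailCoeff_add, tailCoeff_add, smul_smul, hR.Q_step, map_smul, iterY_succ,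
      show w - ((m + j : ℕ) : ℝ) = w - m - j by push_cast; ring]

lemma pairY_regCoeff {w : ℝ} (f : A) (W : A × A) (k : ℕ) :
    pairY Y N (w - k) (regCoeff Y N w m P Q f W k)
      = (((k : ℝ) + 1) * (m - (k + 1))) • regCoeff Y N w m P Q f W (k + 1)
        + ((m : ℝ) - 2 * (k + 1)) • (logCoeff Y w L f (k + 1), 0) := by
  have hfree : pairY Y N (w - k) (P k • iterY Y w k f, 0)
      = (((k : ℝ) + 1) * (m - (k + 1))) • (P (k + 1) • iterY Y w (k + 1) f, (0 : A))
        + ((m : ℝ) - 2 * (k + 1)) • (logCoeff Y w L f (k + 1), 0) := by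
    refine Prod.ext ?_ (by simp [pairY_apply])
    simp only [pairY_apply, map_zero, add_zero, map_smul, ← iterY_succ, Prod.fst_add,
      Prod.smul_fst, logCoeff, ← hR.reg_step k]
    module
  rw [regCoeff, regCoeff, map_add, hfree, hR.Y_tailCoeff]
  module

lemma sum_pairY_regCoeff (hA : ScaleAlgebra d X 0 Y)
    (hN : ∀ w a, N (w + 1) (X a) = X (N w a) - (2 : ℝ) • a) {w : ℝ} (hw : d + 2 * w = m + 1)
    {f : A} {W : A × A} (hW : W.2 = iterY Y w m f) (n : ℕ) :
    ∑ k ∈ Finset.range (n + 1), pairY Y N w (((X.prodMap X) ^ k) (regCoeff Y N w m P Q f W k))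
      = ((X.prodMap X) ^ n) (pairY Y N (w - n) (regCoeff Y N w m P Q f W n))
        + (m : ℝ) • ∑ k ∈ Finset.range n, ((X ^ k) (logCoeff Y w L f (k + 1)), (0 : A)) := by
  induction n with
  | zero => simp
  | succ n ih =>
    have hε : pairNil A (regCoeff Y N w m P Q f W (n + 1)) = -(logCoeff Y w L f (n + 1), 0) := by
      rw [pairNil_apply, hR.regCoeff_snd hW]; simp
    have hX : ((X.prodMap X) ^ n) (logCoeff Y w L f (n + 1), (0 : A))
        = ((X ^ n) (logCoeff Y w L f (n + 1)), 0) := by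
      rw [prodMap_pow_apply]; simp
    rw [Finset.sum_range_succ, ih, hR.pairY_regCoeff, (hA.pair hN).Y_pow_X, hε,
      Finset.sum_range_succ, map_add, map_smul, map_smul, map_neg, hX, hw]
    push_cast
    module

lemma sum_Y_logCoeff (hA : ScaleAlgebra d X 0 Y) {w : ℝ} (hw : d + 2 * w = m + 1) (f : A)
    (n : ℕ) :
    ∑ k ∈ Finset.range (n + 1), Y w ((X ^ k) (logCoeff Y w L f k))
      = (X ^ n) (Y (w - n) (logCoeff Y w L f n)) := by
  induction n with
  | zero => simp
  | succ n ih =>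
    rw [Finset.sum_range_succ, ih, hR.Y_logCoeff, hA.Y_pow_X, map_smul, hw]
    simp only [LinearMap.zero_apply, map_zero, smul_zero, sub_zero]
    push_cast
    module

lemma logCoeff_X (hA : ScaleAlgebra d X 0 Y) {w : ℝ} (hw : d + 2 * w = m - 1) (a : A) (k : ℕ) :
    logCoeff Y (w + 1) L (X a) (k + 1)
      = X (logCoeff Y w L a (k + 1)) - logCoeff Y w L a k := by
  rw [logCoeff, logCoeff, logCoeff, hA.iterY_X_of_weight hw, map_smul, ← hR.log_step k]
  module

lemma tailCoeff_X (hA : ScaleAlgebra d X 0 Y)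
    (hN : ∀ w a, N (w + 1) (X a) = X (N w a) - (2 : ℝ) • a) {w : ℝ} (hw : d + 2 * w = m - 1)
    {a : A} {W : A × A} (hW : W.2 = iterY Y w m a) (k : ℕ) :
    tailCoeff (pairY Y N) (w + 1) m Q (X.prodMap X W - (m : ℝ) • (iterY Y w (m - 1) a, 0)) (k + 1)
      = X.prodMap X (tailCoeff (pairY Y N) w m Q W (k + 1)) - tailCoeff (pairY Y N) w m Q W k
        - (((m : ℝ) - 2 * (k + 1)) * L (k + 1)) • (iterY Y w k a, (0 : A)) := by
  rcases lt_trichotomy (k + 1) m with hk | hk | hk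
  · rw [tailCoeff_lt hk, tailCoeff_lt hk, tailCoeff_lt (by lia : k < m), hR.below _ hk,
      mul_zero, zero_smul, map_zero, sub_zero, sub_zero]
  · subst hk
    have hL : L (k + 1) = -Q 0 := hR.above 0
    have htail (w : ℝ) (V : A × A) : tailCoeff (pairY Y N) w (k + 1) Q V (k + 1) = Q 0 • V :=
      tailCoeff_add 0
    rw [htail, htail, tailCoeff_lt (by lia), hL, Nat.add_sub_cancel, map_smul]
    push_cast
    module
  · obtain ⟨j, rfl⟩ := Nat.exists_eq_add_of_le (by lia : m ≤ k)
    have hpred : iterY (pairY Y N) (w + 1 - m) (j + 1) ((m : ℝ) • (iterY Y w (m - 1) a, 0))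
        = (m : ℝ) • (iterY Y w (m + j) a, 0) := by
      rw [map_smul, iterY_pair_inl]
      exact Prod.ext (natCast_smul_iterY_pred w m j a) (by simp)
    have hX := (hA.pair hN).iterY_X (w - m) j W
    have hd : d + 2 * (w - m) = -m - 1 := by linarith
    rw [pairNil_apply, hW, iterY_pair_inl, iterY_add, hd, sub_add_eq_add_sub] at hX
    rw [add_assoc m j 1, tailCoeff_add, tailCoeff_add, tailCoeff_add, map_sub, hpred, hX,
      hR.above, ← hR.Q_step j, map_smul]
    push_cast
    module

lemma regCoeff_X (hA : ScaleAlgebra d X 0 Y)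
    (hN : ∀ w a, N (w + 1) (X a) = X (N w a) - (2 : ℝ) • a) {w : ℝ} (hw : d + 2 * w = m - 1)
    {a : A} {W : A × A} (hW : W.2 = iterY Y w m a) (k : ℕ) :
    regCoeff Y N (w + 1) m P Q (X a)
        (X.prodMap X W - (m : ℝ) • (iterY Y w (m - 1) a, 0)) (k + 1)
      = X.prodMap X (regCoeff Y N w m P Q a W (k + 1)) - regCoeff Y N w m P Q a W k := by
  have hfree : (P (k + 1) • iterY Y (w + 1) (k + 1) (X a), (0 : A))
      = X.prodMap X (P (k + 1) • iterY Y w (k + 1) a, 0) - (P k • iterY Y w k a, 0)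
        + (((m : ℝ) - 2 * (k + 1)) * L (k + 1)) • (iterY Y w k a, (0 : A)) := by
    refine Prod.ext ?_ (by simp)
    simp only [hA.iterY_X_of_weight hw, LinearMap.prodMap_apply, Prod.fst_add, Prod.fst_sub,
      Prod.smul_fst, map_smul, ← hR.reg_step k]
    module
  rw [regCoeff, regCoeff, regCoeff, hfree, hR.tailCoeff_X hA hN hw hW, map_add]
  abel

lemma natCast_smul_sum_logCoeff {w : ℝ} (f : A) (n : ℕ) :
    (m : ℝ) • ∑ k ∈ Finset.range (n + 1), (X ^ k) (logCoeff Y w L f k)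
      = (m : ℝ) • X (∑ k ∈ Finset.range n, (X ^ k) (logCoeff Y w L f (k + 1))) := by
  have h0 : (m : ℝ) • logCoeff Y w L f 0 = 0 := by
    rcases Nat.eq_zero_or_pos m with rfl | hm
    · rw [Nat.cast_zero, zero_smul]
    · rw [logCoeff, hR.below 0 hm, zero_smul, smul_zero]
  simp only [Finset.sum_range_succ', pow_zero, Module.End.one_apply, smul_add, h0, add_zero,
    map_sum, pow_succ', Module.End.mul_apply]

lemma Y_sum_regCoeff (hA : ScaleAlgebra d X 0 Y)
    (hN : ∀ w a, N (w + 1) (X a) = X (N w a) - (2 : ℝ) • a) {w : ℝ} (hw : d + 2 * w = m + 1)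
    {f : A} {W : A × A} (hW : W.2 = iterY Y w m f) (n : ℕ) :
    Y w (∑ k ∈ Finset.range (n + 1), (X ^ k) (regCoeff Y N w m P Q f W k).1)
      = N w (∑ k ∈ Finset.range (n + 1), (X ^ k) (logCoeff Y w L f k))
        + (X ^ n) (pairY Y N (w - n) (regCoeff Y N w m P Q f W n)).1
        + (m : ℝ) • ∑ k ∈ Finset.range n, (X ^ k) (logCoeff Y w L f (k + 1)) := by
  have h := congrArg Prod.fst (hR.sum_pairY_regCoeff hA hN hw hW n)
  simp only [Prod.fst_sum, Prod.fst_add, Prod.smul_fst, prodMap_pow_apply] at h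
  rw [add_assoc, ← h, map_sum, map_sum, ← Finset.sum_add_distrib]
  refine Finset.sum_congr rfl fun k _ => ?_
  rw [pairY_apply, hR.regCoeff_snd hW, map_neg, map_neg, add_neg_cancel_comm_assoc]

end LogRecurrence

/-- The Weyl average `(T y ^ m + y ^ m T) / 2`, where `T` is multiplication by a logarithm. -/
def algWeyl (Y N : ℝ → A →ₗ[ℝ] A) (T : A →ₗ[ℝ] A) (w : ℝ) (m : ℕ) (f : A) : A × A :=
  (1 / 2 : ℝ) • ((T (iterY Y w m f), iterY Y w m f) + iterY (pairY Y N) w m (T f, f))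

lemma algWeyl_snd (T : A →ₗ[ℝ] A) (w : ℝ) (m : ℕ) (f : A) :
    (algWeyl Y N T w m f).2 = iterY Y w m f := by
  simp only [algWeyl, Prod.smul_snd, Prod.snd_add, iterY_pair_snd]
  module

lemma algWeyl_X (hA : ScaleAlgebra d X 0 Y)
    (hN : ∀ w a, N (w + 1) (X a) = X (N w a) - (2 : ℝ) • a) {T : A →ₗ[ℝ] A}
    (hT : ∀ a, T (X a) = X (T a)) {w : ℝ} (hw : d + 2 * w = m - 1) (a : A) :
    algWeyl Y N T (w + 1) m (X a)
      = X.prodMap X (algWeyl Y N T w m a) - (m : ℝ) • (iterY Y w (m - 1) a, 0) := by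
  cases m with
  | zero =>
    refine Prod.ext ?_ ?_ <;> simp [algWeyl, iterY_zero, hT]
  | succ k =>
    have h1 : iterY Y (w + 1) (k + 1) (X a) = X (iterY Y w (k + 1) a) := by
      rw [hA.iterY_X, hw]
      push_cast
      simp
    have h2 := (hA.pair hN).iterY_X w k (T a, a)
    rw [hw, pairNil_apply, iterY_pair_inl] at h2
    have h3 : (T (X a), X a) = X.prodMap X (T a, a) := by rw [hT]; rfl
    simp only [algWeyl]
    rw [h1, h3, h2, Nat.add_sub_cancel, hT]
    refine Prod.ext ?_ ?_
    · simp only [LinearMap.prodMap_apply, Prod.fst_sub, Prod.fst_add, Prod.smul_fst, map_smul,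
        map_add]
      push_cast
      module
    · simp only [LinearMap.prodMap_apply, Prod.snd_sub, Prod.snd_add, Prod.smul_snd, map_smul,
        map_add, smul_zero, sub_zero]
      push_cast
      module

lemma tailCoeff_pair_inl {w : ℝ} (b : A) (k : ℕ) :
    tailCoeff (pairY Y N) w m Q (b, 0) k = (tailCoeff Y w m Q b k, 0) := by
  rw [tailCoeff, tailCoeff]
  split_ifs
  · rw [iterY_pair_inl, Prod.smul_mk, smul_zero]
  · rfl

lemma regCoeff_sub_regCoeff {w : ℝ} (f f' : A) (W W' : A × A) :
    regCoeff Y N w m P Q f W - regCoeff Y N w m P Q f' W'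
      = regCoeff Y N w m P Q (f - f') (W - W') := by
  funext k
  refine Prod.ext ?_ ?_ <;> simp only [regCoeff, tailCoeff, Pi.sub_apply, map_sub] <;> split_ifs <;>
  · simp only [Prod.fst_sub, Prod.snd_sub, Prod.fst_add, Prod.snd_add, Prod.smul_fst,
      Prod.smul_snd, Prod.fst_zero, Prod.snd_zero]
    module

lemma regCoeff_add_datum {w : ℝ} (f : A) (W W' : A × A) :
    regCoeff Y N w m P Q f (W + W')
      = regCoeff Y N w m P Q f W + tailCoeff (pairY Y N) w m Q W' := by
  funext k
  simp only [regCoeff, tailCoeff, Pi.add_apply, map_add]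
  split_ifs <;> module

lemma logCoeff_sub_logCoeff {w : ℝ} (f f' : A) :
    logCoeff Y w L f - logCoeff Y w L f' = logCoeff Y w L (f - f') := by
  funext k
  simp only [logCoeff, Pi.sub_apply, map_sub, smul_sub]

lemma algWeyl_sub {w : ℝ} (T : A →ₗ[ℝ] A) (f f' : A) :
    algWeyl Y N T w m (f - f') = algWeyl Y N T w m f - algWeyl Y N T w m f' := by
  have h (a b : A) : (T (a - b), a - b) = (T a, a) - (T b, b) := by rw [map_sub]; rfl
  rw [algWeyl, map_sub, h, h, map_sub, algWeyl, algWeyl]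
  module

lemma algWeyl_scale_change (hA : ScaleAlgebra d X 0 Y) {w : ℝ} (hw : d + 2 * w = m - 1)
    {T T' : A →ₗ[ℝ] A} (hT : ∀ a, ∃ v, T a - T' a = X v) (f : A) :
    ∃ v, algWeyl Y N T (w + 1) m f - algWeyl Y N T' (w + 1) m f = (X v, 0) := by
  obtain ⟨v₁, h₁⟩ := hT (iterY Y (w + 1) m f)
  obtain ⟨v₂, h₂⟩ := hT f
  have hX : iterY Y (w + 1) m (X v₂) = X (iterY Y w m v₂) := by
    cases m with
    | zero => rfl
    | succ k =>
      rw [hA.iterY_X_of_weight hw]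
      push_cast
      rw [sub_self, mul_zero, zero_smul, sub_zero]
  have hsub {a v : A} (h : T a - T' a = X v) : ((T a, a) : A × A) - (T' a, a) = (X v, 0) :=
    Prod.ext h (sub_self a)
  refine ⟨(1 / 2 : ℝ) • (v₁ + iterY Y w m v₂), ?_⟩
  rw [algWeyl, algWeyl, ← smul_sub, add_sub_add_comm, hsub h₁, ← map_sub, hsub h₂,
    iterY_pair_inl, hX, map_smul, map_add, Prod.mk_add_mk, add_zero, Prod.smul_mk, smul_zero]

end FormalSolution

/-- The formal series `∑ X ^ k (a k)` telescopes, its partial sums being `X ^ (n + 1) (e n)`. -/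
structure Telescopes (X : A →ₗ[ℝ] A) (a e : ℕ → A) : Prop where
  zero : a 0 = X (e 0)
  succ : ∀ k, a (k + 1) = X (e (k + 1)) - e k

namespace Telescopes

variable {X : A →ₗ[ℝ] A} {a e a' e' : ℕ → A} (h : Telescopes X a e)
include h

lemma add (h' : Telescopes X a' e') : Telescopes X (a + a') (e + e') where
  zero := by simp only [Pi.add_apply, h.zero, h'.zero, map_add]
  succ k := by
    simp only [Pi.add_apply, h.succ, h'.succ, map_add]
    abel

lemma sum_pow (n : ℕ) : ∑ k ∈ Finset.range (n + 1), (X ^ k) (a k) = (X ^ (n + 1)) (e n) := by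
  induction n with
  | zero => simp [h.zero]
  | succ n ih =>
    rw [Finset.sum_range_succ, ih, h.succ, map_sub, ← Module.End.mul_apply, ← pow_succ]
    abel

end Telescopes

namespace LogRecurrence

variable {d : ℝ} {X : A →ₗ[ℝ] A} {Y N : ℝ → A →ₗ[ℝ] A} {m : ℕ} {P Q L : ℕ → ℝ}
  (hR : LogRecurrence m P Q L) (hA : ScaleAlgebra d X 0 Y) {w : ℝ} (hw : d + 2 * w = m - 1)
include hR hA hw

lemma telescopes_logCoeff_X (a : A) :
    Telescopes X (logCoeff Y (w + 1) L (X a)) (logCoeff Y w L a) where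
  zero := by rw [logCoeff, logCoeff, iterY_zero, iterY_zero, map_smul]
  succ := hR.logCoeff_X hA hw a

lemma telescopes_tailCoeff_inl (v : A) :
    Telescopes (X.prodMap X) (tailCoeff (pairY Y N) (w + 1) m Q (X v, 0))
      (fun k => (tailCoeff Y w m Q v k, 0)) where
  zero := by
    rw [tailCoeff_pair_inl, LinearMap.prodMap_apply, map_zero, tailCoeff, tailCoeff]
    split_ifs
    · rw [Nat.zero_sub, iterY_zero, iterY_zero, map_smul]
    · rw [map_zero]
  succ k := by
    rw [tailCoeff_pair_inl, LinearMap.prodMap_apply, map_zero, Prod.mk_sub_mk, sub_zero]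
    congr 1
    rcases lt_trichotomy (k + 1) m with hk | hk | hk
    · rw [tailCoeff_lt hk, tailCoeff_lt hk, tailCoeff_lt (by lia), map_zero, sub_zero]
    · subst hk
      have htail (w : ℝ) (b : A) : tailCoeff Y w (k + 1) Q b (k + 1) = Q 0 • b := tailCoeff_add 0
      rw [htail, htail, tailCoeff_lt (by lia), map_smul, sub_zero]
    · obtain ⟨j, rfl⟩ := Nat.exists_eq_add_of_le (by lia : m ≤ k)
      have hd : d + 2 * (w - m) = -m - 1 := by linarith
      rw [add_assoc m j 1, tailCoeff_add, tailCoeff_add, tailCoeff_add, add_sub_right_comm,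
        hA.iterY_X_of_weight hd, ← hR.Q_step j, map_smul]
      push_cast
      module

variable (hN : ∀ w a, N (w + 1) (X a) = X (N w a) - (2 : ℝ) • a)
include hN

lemma telescopes_regCoeff_X {a : A} {W : A × A} (hW : W.2 = iterY Y w m a) :
    Telescopes (X.prodMap X)
      (regCoeff Y N (w + 1) m P Q (X a) (X.prodMap X W - (m : ℝ) • (iterY Y w (m - 1) a, 0)))
      (regCoeff Y N w m P Q a W) where
  zero := by
    rcases Nat.eq_zero_or_pos m with rfl | hm
    · simp [regCoeff, tailCoeff_zero, iterY_zero]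
    · simp [regCoeff_lt hm, iterY_zero]
  succ := hR.regCoeff_X hA hN hw hW

lemma exists_telescopes_regCoeff_sub {T T' : A →ₗ[ℝ] A} (hTX : ∀ a, T (X a) = X (T a))
    (hT : ∀ a, ∃ v, T a - T' a = X v) {f f' v : A} (hf : f - f' = X v) :
    ∃ e, Telescopes (X.prodMap X)
      (regCoeff Y N (w + 1) m P Q f (algWeyl Y N T (w + 1) m f)
        - regCoeff Y N (w + 1) m P Q f' (algWeyl Y N T' (w + 1) m f')) e := by
  obtain ⟨v', hv'⟩ := algWeyl_scale_change (N := N) hA hw hT f'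
  have hW : algWeyl Y N T (w + 1) m f - algWeyl Y N T' (w + 1) m f'
      = X.prodMap X (algWeyl Y N T w m v) - (m : ℝ) • (iterY Y w (m - 1) v, 0) + (X v', 0) := by
    rw [← algWeyl_X hA hN hTX hw, ← hf, algWeyl_sub, ← hv']
    abel
  rw [regCoeff_sub_regCoeff, hW, hf, regCoeff_add_datum]
  exact ⟨_, (hR.telescopes_regCoeff_X hA hw hN (algWeyl_snd T w m v)).add
    (hR.telescopes_tailCoeff_inl hA hw v')⟩

end LogRecurrence

end SolutionAlgebra

section Recurrences

/-- The coefficients of the series `K^{1-m}`, with the descending factorials evaluated. -/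
def kernelCoeff (m j : ℕ) : ℝ :=
  (-1) ^ j * (m.factorial : ℝ) / ((j.factorial : ℝ) * ((m + j).factorial : ℝ))

lemma kernelCoeff_zero (m : ℕ) : kernelCoeff m 0 = 1 := by
  have : (m.factorial : ℝ) ≠ 0 := by exact_mod_cast m.factorial_ne_zero
  simp [kernelCoeff, this]

lemma kernelCoeff_succ (m j : ℕ) :
    ((j : ℝ) + 1) * (m + j + 1) * kernelCoeff m (j + 1) = -kernelCoeff m j := by
  have := j.factorial_ne_zero
  have := (m + j).factorial_ne_zero
  have h3 : ((m + j : ℝ) + 1) ≠ 0 := by positivity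
  rw [kernelCoeff, kernelCoeff, ← add_assoc, Nat.factorial_succ, Nat.factorial_succ]
  push_cast
  field_simp
  ring

lemma descPochhammer_eval_add (m j : ℕ) :
    (m.factorial : ℝ) * (descPochhammer ℝ j).eval ((m : ℝ) + j) = (m + j).factorial := by
  have h := Nat.factorial_mul_descFactorial (Nat.le_add_left j m)
  rw [Nat.add_sub_cancel] at h
  rw [show (m : ℝ) + j = ((m + j : ℕ) : ℝ) by push_cast; ring,
    descPochhammer_eval_eq_descFactorial, ← h]
  push_cast
  ring

lemma coeff_seriesK (m j : ℕ) :
    PowerSeries.coeff j (seriesK (1 - (m : ℝ))) = kernelCoeff m j := by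
  have h := descPochhammer_eval_add m j
  have h1 := j.factorial_ne_zero
  have h2 := m.factorial_ne_zero
  have h3 : (descPochhammer ℝ j).eval ((m : ℝ) + j) ≠ 0 := by
    intro h0
    rw [h0, mul_zero] at h
    exact (m + j).factorial_ne_zero (by exact_mod_cast h.symm)
  rw [seriesK, PowerSeries.coeff_mk, kernelCoeff, ← h,
    show (j : ℝ) + 1 - (1 - m) = m + j by ring]
  field_simp

lemma coeff_seriesJ0 (j : ℕ) : PowerSeries.coeff j seriesJ0 = kernelCoeff 0 j := by
  rw [seriesJ0, PowerSeries.coeff_mk, kernelCoeff, zero_add, Nat.factorial_zero]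
  ring_nf

lemma gammaH_zero (m : ℕ) : ((m : ℝ) + 1) * gammaH (m + 1) 0 = -((m + 2) * kernelCoeff m 1) := by
  have h := kernelCoeff_succ m 0
  rw [kernelCoeff_zero] at h
  have hm : (m : ℝ) + 1 ≠ 0 := by positivity
  have h' : kernelCoeff m 1 = -(1 / ((m : ℝ) + 1)) := by
    field_simp
    push_cast at h
    linarith
  rw [h', gammaH]
  push_cast
  field_simp
  ring

lemma gammaH_succ (m j : ℕ) :
    ((j : ℝ) + 2) * (m + j + 2) * gammaH (m + 1) (j + 1)
      = -gammaH (m + 1) j - (m + 2 * j + 4) * kernelCoeff m (j + 2) := by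
  have h := coeff_seriesK m (j + 2)
  rw [seriesK, PowerSeries.coeff_mk,
    show ((j + 2 : ℕ) : ℝ) + 1 - (1 - m) = ((m + 1 : ℕ) : ℝ) + j + 1 by push_cast; ring] at h
  have h1 : (j : ℝ) + 2 ≠ 0 := by positivity
  have h2 : (m : ℝ) + 1 + j + 1 ≠ 0 := by positivity
  rw [← h, gammaH]
  simp only [div_eq_mul_inv]
  generalize (((j + 2).factorial : ℝ) * Polynomial.eval _ _)⁻¹ = q
  push_cast
  field_simp
  ring

/-- The coefficients in `z` of the logarithmic part of the solution with `h₀ = m + 1`, whose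
leading logarithmic coefficient is `-c`. -/
def logSeq (m : ℕ) (c : ℝ) (k : ℕ) : ℝ := if m ≤ k then -(c * kernelCoeff m (k - m)) else 0

lemma logSeq_lt {m k : ℕ} (c : ℝ) (hk : k < m) : logSeq m c k = 0 := if_neg (by lia)

lemma logSeq_add (m j : ℕ) (c : ℝ) : logSeq m c (m + j) = -(c * kernelCoeff m j) := by
  rw [logSeq, if_pos (by lia), Nat.add_sub_cancel_left]

lemma logCoeff_logSeq {A : Type*} [AddCommGroup A] [Module ℝ A] (Y : ℝ → A →ₗ[ℝ] A) (w : ℝ)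
    (m : ℕ) (c : ℝ) (f : A) (k : ℕ) :
    logCoeff Y w (logSeq m c) f k
      = -(c • tailCoeff Y w m (kernelCoeff m) (iterY Y w m f) k) := by
  rcases lt_or_ge k m with hk | hk
  · rw [logCoeff, logSeq_lt c hk, tailCoeff_lt hk, zero_smul, smul_zero, neg_zero]
  · obtain ⟨j, rfl⟩ := Nat.exists_eq_add_of_le hk
    rw [logCoeff, logSeq_add, tailCoeff_add, iterY_add, neg_smul, mul_smul]

lemma logSeq_step (m : ℕ) (c : ℝ) (k : ℕ) :
    ((k : ℝ) + 1) * (m - (k + 1)) * logSeq m c (k + 1) = logSeq m c k := by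
  rcases lt_trichotomy (k + 1) m with hk | hk | hk
  · rw [logSeq_lt c hk, logSeq_lt c (by lia), mul_zero]
  · rw [logSeq_lt (k := k) c (by lia), ← hk]
    push_cast
    ring
  · obtain ⟨j, rfl⟩ := Nat.exists_eq_add_of_le (by lia : m ≤ k)
    rw [add_assoc m j 1, logSeq_add, logSeq_add]
    push_cast
    linear_combination c * kernelCoeff_succ m j

lemma gammaH_step {m : ℕ} {c : ℝ} {P : ℕ → ℝ} (hm : P m = 0)
    (hhigh : ∀ j, P (m + 1 + j) = -(c * gammaH (m + 1) j)) (j : ℕ) :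
    ((m + j : ℕ) + 1 : ℝ) * (m - ((m + j : ℕ) + 1)) * P (m + (j + 1))
      + (m - 2 * ((m + j : ℕ) + 1)) * logSeq m c (m + (j + 1)) = P (m + j) := by
  rw [logSeq_add, show m + (j + 1) = m + 1 + j by ring, hhigh]
  cases j with
  | zero =>
    rw [add_zero, zero_add, hm]
    linear_combination c * gammaH_zero m
  | succ j =>
    rw [show m + (j + 1) = m + 1 + j by ring, hhigh]
    push_cast
    linear_combination c * gammaH_succ m j

lemma logRecurrence_of_gamma {m : ℕ} {c : ℝ} {P : ℕ → ℝ}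
    (hlow : ∀ k, k + 1 < m → ((k : ℝ) + 1) * (m - (k + 1)) * P (k + 1) = P k)
    (hcrit : ∀ k, k + 1 = m → P k = m * c) (hm : P m = 0)
    (hhigh : ∀ j, P (m + 1 + j) = -(c * gammaH (m + 1) j)) :
    LogRecurrence m P (fun j => c * kernelCoeff m j) (logSeq m c) where
  below _ hk := logSeq_lt c hk
  above j := logSeq_add m j c
  log_step := logSeq_step m c
  reg_step k := by
    rcases lt_trichotomy (k + 1) m with hk | rfl | hk
    · rw [logSeq_lt c hk, mul_zero, add_zero, hlow k hk]
    · have h : logSeq (k + 1) c (k + 1) = -(c * kernelCoeff (k + 1) 0) := logSeq_add (k + 1) 0 c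
      rw [hcrit k rfl, h, kernelCoeff_zero]
      push_cast
      ring
    · obtain ⟨j, rfl⟩ := Nat.exists_eq_add_of_le (by lia : m ≤ k)
      exact gammaH_step hm hhigh j

lemma coeff_polyF (m k : ℕ) : PowerSeries.coeff k (polyF (m + 1) : PowerSeries ℝ)
    = if k < m then 1 / ((k.factorial : ℝ) * ((m - 1).descFactorial k : ℝ)) else 0 := by
  rw [Polynomial.coeff_coe, polyF, Polynomial.finsetSum_coeff]
  simp only [Polynomial.coeff_monomial, Finset.sum_ite_eq', Finset.mem_range, Nat.add_sub_cancel]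
  rfl

lemma coeff_X_pow_mul_seriesH (n h k : ℕ) :
    PowerSeries.coeff k (PowerSeries.X ^ n * seriesH h)
      = if n ≤ k then gammaH h (k - n) else 0 := by
  rw [PowerSeries.coeff_X_pow_mul']
  simp only [seriesH, PowerSeries.coeff_mk]

lemma coeff_polyF_step {m k : ℕ} (hk : k + 1 < m) :
    ((k : ℝ) + 1) * (m - (k + 1)) * PowerSeries.coeff (k + 1) (polyF (m + 1) : PowerSeries ℝ)
      = PowerSeries.coeff k (polyF (m + 1) : PowerSeries ℝ) := by
  have := k.factorial_ne_zero
  have : ((m - 1).descFactorial k : ℝ) ≠ 0 := by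
    exact_mod_cast (Nat.descFactorial_pos.mpr (by lia)).ne'
  have h3 : ((m - 1 - k : ℕ) : ℝ) = m - (k + 1) := by
    rw [Nat.sub_sub, Nat.cast_sub (by lia)]; push_cast; ring
  have h4 : (m : ℝ) - (k + 1) ≠ 0 := by
    rw [← h3]; exact_mod_cast (by lia : m - 1 - k ≠ 0)
  rw [coeff_polyF, coeff_polyF, if_pos hk, if_pos (by lia), Nat.factorial_succ,
    Nat.descFactorial_succ]
  push_cast
  rw [h3]
  field_simp

/-- The constant `1 / ((h₀ - 1)! (h₀ - 2)!)` of the logarithmic terms, for `h₀ = m + 1`. -/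
def logConst (m : ℕ) : ℝ := 1 / ((m.factorial : ℝ) * ((m - 1).factorial : ℝ))

lemma coeff_polyF_pred (k : ℕ) :
    PowerSeries.coeff k (polyF (k + 1 + 1) : PowerSeries ℝ)
      = ((k + 1 : ℕ) : ℝ) * logConst (k + 1) := by
  have := k.factorial_ne_zero
  rw [coeff_polyF, if_pos (by lia), logConst, Nat.add_sub_cancel, Nat.descFactorial_self,
    Nat.factorial_succ]
  push_cast
  field_simp

/-- The coefficients in `z` of the regular part of the solution with `h₀ = m + 1 ≥ 2`, without the
Weyl-averaged term. -/
def regSeq (m : ℕ) (k : ℕ) : ℝ :=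
  PowerSeries.coeff k (polyF (m + 1) : PowerSeries ℝ)
    - logConst m * PowerSeries.coeff k (PowerSeries.X ^ (m + 1) * seriesH (m + 1))

lemma regSeq_le {m k : ℕ} (hk : k ≤ m) :
    regSeq m k = PowerSeries.coeff k (polyF (m + 1) : PowerSeries ℝ) := by
  rw [regSeq, coeff_X_pow_mul_seriesH, if_neg (by lia), mul_zero, sub_zero]

lemma regSeq_zero {m : ℕ} (hm : 1 ≤ m) : regSeq m 0 = 1 := by
  rw [regSeq_le m.zero_le, coeff_polyF, if_pos (by lia)]
  simp

lemma regSeq_self (m : ℕ) : regSeq m m = 0 := by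
  rw [regSeq_le le_rfl, coeff_polyF, if_neg (lt_irrefl m)]

lemma regSeq_add (m j : ℕ) : regSeq m (m + 1 + j) = -(logConst m * gammaH (m + 1) j) := by
  rw [regSeq, coeff_polyF, coeff_X_pow_mul_seriesH, if_neg (by lia), if_pos (by lia),
    Nat.add_sub_cancel_left, zero_sub]

lemma logRecurrence_regSeq (m : ℕ) :
    LogRecurrence m (regSeq m) (fun j => logConst m * kernelCoeff m j) (logSeq m (logConst m)) := by
  refine logRecurrence_of_gamma (fun k hk => ?_) (fun k hk => ?_) (regSeq_self m) (regSeq_add m)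
  · rw [regSeq_le hk.le, regSeq_le (by lia), coeff_polyF_step hk]
  · subst hk
    rw [regSeq_le (by lia), coeff_polyF_pred]

lemma coeff_X_mul_seriesH (k : ℕ) :
    PowerSeries.coeff (k + 1) (PowerSeries.X * seriesH 1) = gammaH 1 k := by
  rw [PowerSeries.coeff_succ_X_mul, seriesH, PowerSeries.coeff_mk]

lemma logRecurrence_one :
    LogRecurrence 0 (fun k => PowerSeries.coeff k (PowerSeries.X * seriesH 1))
      (fun j => -1 * kernelCoeff 0 j) (logSeq 0 (-1)) := by
  refine logRecurrence_of_gamma (fun k hk => by lia) (fun k hk => by lia) (by simp) (fun j => ?_)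
  rw [show 0 + 1 + j = j + 1 by ring, coeff_X_mul_seriesH]
  ring

end Recurrences

/-! ### Division by a defining function -/

section ParametricIntegral

universe u v

open Set

lemma hasFDerivWithinAt_slice {E F : Type*} [NormedAddCommGroup E] [NormedSpace ℝ E]
    [NormedAddCommGroup F] [NormedSpace ℝ F] {s : Set E} {K : Set ℝ} {G : E × ℝ → F}
    (hG : DifferentiableOn ℝ G (s ×ˢ K)) {z : E} (hz : z ∈ s) {t : ℝ} (ht : t ∈ K) :
    HasFDerivWithinAt (fun z => G (z, t))
      ((fderivWithin ℝ G (s ×ˢ K) (z, t)).comp (ContinuousLinearMap.inl ℝ E ℝ)) s z := by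
  have hinl : HasFDerivWithinAt (fun z : E => (z, t)) (ContinuousLinearMap.inl ℝ E ℝ) s z :=
    (hasFDerivAt_prodMk_left z t).hasFDerivWithinAt
  have hmaps : MapsTo (fun z : E => (z, t)) s (s ×ˢ K) := fun y hy => ⟨hy, ht⟩
  exact (hG (z, t) ⟨hz, ht⟩).hasFDerivWithinAt.comp z hinl hmaps

lemma eventually_forall_norm_sub_sub_le {E F : Type*} [NormedAddCommGroup E] [NormedSpace ℝ E]
    [NormedAddCommGroup F] [NormedSpace ℝ F] {s : Set E} (hs : Convex ℝ s) {K : Set ℝ}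
    (hK : IsCompact K) {G : E × ℝ → F} {G' : E × ℝ → E →L[ℝ] F} (hG' : ContinuousOn G' (s ×ˢ K))
    (hd : ∀ z ∈ s, ∀ t ∈ K, HasFDerivWithinAt (fun z => G (z, t)) (G' (z, t)) s z)
    {z : E} (hz : z ∈ s) {c : ℝ} (hc : 0 < c) :
    ∀ᶠ y in 𝓝[s] z, ∀ t ∈ K, ‖G (y, t) - G (z, t) - G' (z, t) (y - z)‖ ≤ c * ‖y - z‖ := by
  obtain ⟨v, hv, hv'⟩ := hK.mem_uniformity_of_prod (f := fun y t => G' (y, t))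
    (s := s) (q := z) hG' hz (Metric.dist_mem_uniformity hc)
  obtain ⟨r, hr, hrv⟩ := Metric.mem_nhdsWithin_iff.mp hv
  filter_upwards [Metric.mem_nhdsWithin_iff.mpr ⟨r, hr, subset_rfl⟩] with y hy t ht
  refine Convex.norm_image_sub_le_of_norm_hasFDerivWithin_le' (f := fun z => G (z, t))
    (f' := fun z => G' (z, t)) (φ := G' (z, t))
    (fun x hx => (hd x hx.2 t ht).mono inter_subset_right) (fun x hx => ?_)
    ((convex_ball z r).inter hs) ⟨Metric.mem_ball_self hr, hz⟩ hy
  rw [← dist_eq_norm]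
  exact le_of_lt (hv' x (hrv hx) t ht)

lemma intervalIntegrable_slice {E F : Type*} [TopologicalSpace E] [NormedAddCommGroup F]
    {s : Set E} {f : E × ℝ → F} {a b : ℝ} (hab : a ≤ b) (hf : ContinuousOn f (s ×ˢ Icc a b)) {y : E}
    (hy : y ∈ s) : IntervalIntegrable (fun t => f (y, t)) MeasureTheory.volume a b :=
  ContinuousOn.intervalIntegrable_of_Icc hab (hf.comp (by fun_prop) fun _ ht => ⟨hy, ht⟩)

lemma hasFDerivWithinAt_integral_of_convex {E F : Type*} [NormedAddCommGroup E] [NormedSpace ℝ E]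
    [NormedAddCommGroup F] [NormedSpace ℝ F] {s : Set E} (hs : Convex ℝ s)
    {G : E × ℝ → F} {G' : E × ℝ → E →L[ℝ] F} (hG : ContinuousOn G (s ×ˢ Icc 0 1))
    (hG' : ContinuousOn G' (s ×ˢ Icc 0 1))
    (hd : ∀ z ∈ s, ∀ t ∈ Icc (0 : ℝ) 1, HasFDerivWithinAt (fun z => G (z, t)) (G' (z, t)) s z)
    {z : E} (hz : z ∈ s) :
    HasFDerivWithinAt (fun z => ∫ t in (0 : ℝ)..1, G (z, t))
      (∫ t in (0 : ℝ)..1, G' (z, t)) s z := by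
  refine .of_isLittleO (Asymptotics.isLittleO_iff.mpr fun c hc => ?_)
  filter_upwards [eventually_forall_norm_sub_sub_le hs isCompact_Icc hG' hd hz hc,
    self_mem_nhdsWithin] with y hbound hy
  have hGy := intervalIntegrable_slice zero_le_one hG hy
  have hGz := intervalIntegrable_slice zero_le_one hG hz
  have hG'z := intervalIntegrable_slice zero_le_one hG' hz
  have hG'zy : IntervalIntegrable (fun t => G' (z, t) (y - z)) MeasureTheory.volume 0 1 :=
    intervalIntegrable_slice (f := fun p => G' p (y - z)) zero_le_one
      (hG'.clm_apply continuousOn_const) hz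
  rw [ContinuousLinearMap.intervalIntegral_apply hG'z, ← intervalIntegral.integral_sub hGy hGz,
    ← intervalIntegral.integral_sub (hGy.sub hGz) hG'zy]
  refine (intervalIntegral.norm_integral_le_of_norm_le_const (C := c * ‖y - z‖)
    fun t ht => ?_).trans (by simp)
  rw [uIoc_of_le zero_le_one] at ht
  exact hbound t ⟨ht.1.le, ht.2⟩

lemma exists_contDiffOn_hasFDerivWithinAt_integral {E F : Type*} [NormedAddCommGroup E]
    [NormedSpace ℝ E] [NormedAddCommGroup F] [NormedSpace ℝ F] {s : Set E} (hs : Convex ℝ s)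
    (hu : UniqueDiffOn ℝ s) {G : E × ℝ → F} (hG : ContDiffOn ℝ ∞ G (s ×ˢ Icc 0 1)) :
    ∃ G' : E × ℝ → E →L[ℝ] F, ContDiffOn ℝ ∞ G' (s ×ˢ Icc 0 1) ∧ ∀ z ∈ s, HasFDerivWithinAt
      (fun z => ∫ t in (0 : ℝ)..1, G (z, t)) (∫ t in (0 : ℝ)..1, G' (z, t)) s z := by
  have hG' : ContDiffOn ℝ ∞ (fun p => (fderivWithin ℝ G (s ×ˢ Icc (0 : ℝ) 1) p).comp
      (ContinuousLinearMap.inl ℝ E ℝ)) (s ×ˢ Icc (0 : ℝ) 1) :=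
    (hG.fderivWithin (hu.prod (uniqueDiffOn_Icc zero_lt_one)) (by simp)).clm_comp contDiffOn_const
  exact ⟨_, hG', fun z hz => hasFDerivWithinAt_integral_of_convex hs hG.continuousOn
    hG'.continuousOn (fun y hy t ht => hasFDerivWithinAt_slice
      (hG.differentiableOn (by simp)) hy ht) hz⟩

-- The universe of the target absorbs that of the source, so that the derivatives stay inside it.
lemma contDiffOn_nat_integral_of_convex {E : Type u} [NormedAddCommGroup E] [NormedSpace ℝ E]
    {s : Set E} (hs : Convex ℝ s) (hu : UniqueDiffOn ℝ s) (n : ℕ) {F : Type (max u v)}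
    [NormedAddCommGroup F] [NormedSpace ℝ F] {G : E × ℝ → F}
    (hG : ContDiffOn ℝ ∞ G (s ×ˢ Icc 0 1)) :
    ContDiffOn ℝ n (fun z => ∫ t in (0 : ℝ)..1, G (z, t)) s := by
  induction n generalizing F with
  | zero =>
    obtain ⟨G', -, h⟩ := exists_contDiffOn_hasFDerivWithinAt_integral hs hu hG
    exact contDiffOn_zero.mpr fun z hz => (h z hz).continuousWithinAt
  | succ n ih =>
    obtain ⟨G', hG', h⟩ := exists_contDiffOn_hasFDerivWithinAt_integral hs hu hG
    exact_mod_cast (contDiffOn_succ_iff_hasFDerivWithinAt_of_uniqueDiffOn hu).mpr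
      ⟨by simp, _, ih hG', h⟩

lemma contDiffOn_integral_of_convex {E : Type u} {F : Type (max u v)} [NormedAddCommGroup E]
    [NormedSpace ℝ E] [NormedAddCommGroup F] [NormedSpace ℝ F] {s : Set E} (hs : Convex ℝ s)
    (hu : UniqueDiffOn ℝ s) {G : E × ℝ → F} (hG : ContDiffOn ℝ ∞ G (s ×ˢ Icc 0 1)) :
    ContDiffOn ℝ ∞ (fun z => ∫ t in (0 : ℝ)..1, G (z, t)) s :=
  contDiffOn_infty.mpr fun n => contDiffOn_nat_integral_of_convex.{u, v} hs hu n hG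

lemma integral_fderivWithin_lineMap {E F : Type*} [NormedAddCommGroup E] [NormedSpace ℝ E]
    [NormedAddCommGroup F] [NormedSpace ℝ F] [CompleteSpace F] {s : Set E} (hs : Convex ℝ s)
    (hu : UniqueDiffOn ℝ s) {φ : E → F} (hφ : ContDiffOn ℝ 1 φ s) {a b : E} (ha : a ∈ s)
    (hb : b ∈ s) :
    ∫ t in (0 : ℝ)..1, fderivWithin ℝ φ s (AffineMap.lineMap a b t) (b - a) = φ b - φ a := by
  have hmaps : MapsTo (AffineMap.lineMap a b) (Icc (0 : ℝ) 1) s := fun _ => hs.lineMap_mem ha hb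
  have hderiv (t : ℝ) (ht : t ∈ Icc (0 : ℝ) 1) :
      HasDerivWithinAt (fun t => φ (AffineMap.lineMap a b t))
        (fderivWithin ℝ φ s (AffineMap.lineMap a b t) (b - a)) (Icc 0 1) t :=
    (hφ.differentiableOn one_ne_zero _ (hmaps ht)).hasFDerivWithinAt.comp_hasDerivWithinAt t
      AffineMap.hasDerivWithinAt_lineMap hmaps
  have hcont : ContinuousOn (fun t : ℝ => fderivWithin ℝ φ s (AffineMap.lineMap a b t) (b - a))
      (Icc 0 1) :=
    ((hφ.continuousOn_fderivWithin hu le_rfl).comp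
      (AffineMap.lineMap_continuous.continuousOn) hmaps).clm_apply continuousOn_const
  rw [intervalIntegral.integral_eq_sub_of_hasDerivAt_of_le zero_le_one
    (fun t ht => (hderiv t ht).continuousWithinAt)
    (fun t ht => (hderiv t (Ioo_subset_Icc_self ht)).hasDerivAt (Icc_mem_nhds ht.1 ht.2))
    (hcont.intervalIntegrable_of_Icc zero_le_one), AffineMap.lineMap_apply_one,
    AffineMap.lineMap_apply_zero]

/-- Hadamard's lemma. -/
lemma exists_smooth_quotient {E : Type u} {F : Type (max u v)} [NormedAddCommGroup E]
    [NormedSpace ℝ E] [NormedAddCommGroup F] [NormedSpace ℝ F] [CompleteSpace F] {s : Set E}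
    (hs : Convex ℝ s) (hu : UniqueDiffOn ℝ s) (ℓ : E →L[ℝ] ℝ) (e : E)
    (hproj : ∀ z ∈ s, z - ℓ z • e ∈ s) {φ : E → F}
    (hφ : ContDiffOn ℝ ∞ φ s) (hφ0 : ∀ z ∈ s, φ (z - ℓ z • e) = 0) :
    ∃ ψ : E → F, ContDiffOn ℝ ∞ ψ s ∧ ∀ z ∈ s, φ z = ℓ z • ψ z := by
  let A : E × ℝ → E := fun p => AffineMap.lineMap (p.1 - ℓ p.1 • e) p.1 p.2
  have hA : ContDiff ℝ ∞ A := by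
    simp only [A, AffineMap.lineMap_apply_module]
    fun_prop
  have hmaps : MapsTo A (s ×ˢ Icc (0 : ℝ) 1) s := fun p hp =>
    hs.lineMap_mem (hproj p.1 hp.1) hp.1 hp.2
  have hG : ContDiffOn ℝ ∞ (fun p : E × ℝ => fderivWithin ℝ φ s (A p) e) (s ×ˢ Icc 0 1) :=
    ((hφ.fderivWithin hu (by simp)).comp hA.contDiffOn hmaps).clm_apply contDiffOn_const
  refine ⟨_, contDiffOn_integral_of_convex.{u, v} hs hu hG, fun z hz => ?_⟩
  have hint := integral_fderivWithin_lineMap hs hu (hφ.of_le (by simp)) (hproj z hz) hz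
  rw [hφ0 z hz, sub_zero, sub_sub_cancel] at hint
  rw [← hint, ← intervalIntegral.integral_smul]
  simp only [A, map_smul]

end ParametricIntegral

section BoundaryDivision

open Set

variable {d : ℕ} [NeZero d]

lemma norm_sub_coord_le (w : EuclideanSpace ℝ (Fin d)) :
    ‖w - w 0 • EuclideanSpace.single (0 : Fin d) (1 : ℝ)‖ ≤ ‖w‖ := by
  rw [EuclideanSpace.norm_eq, EuclideanSpace.norm_eq]
  refine Real.sqrt_le_sqrt (Finset.sum_le_sum fun i _ => ?_)
  by_cases hi : i = 0
  · subst hi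
    simp [sq_nonneg]
  · simp [hi]

variable {M : Type*} [TopologicalSpace M] [ChartedSpace (EuclideanHalfSpace d) M]

lemma extChartAt_zero_of_isBoundaryPoint {x₀ : M} (hb : (𝓡∂ d).IsBoundaryPoint x₀) :
    extChartAt (𝓡∂ d) x₀ x₀ 0 = 0 := by
  rw [ModelWithCorners.isBoundaryPoint_iff, frontier_range_modelWithCornersEuclideanHalfSpace]
    at hb
  exact hb.symm

/-- A neighbourhood of `x₀` in its chart, small and round enough for Hadamard's lemma to apply to
functions vanishing on the boundary. -/
structure IsHalfBall (x₀ : M) (S : Set (EuclideanSpace ℝ (Fin d))) : Prop where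
  mem_nhdsWithin : S ∈ 𝓝[range (𝓡∂ d)] (extChartAt (𝓡∂ d) x₀ x₀)
  center_mem : extChartAt (𝓡∂ d) x₀ x₀ ∈ S
  subset_target : S ⊆ (extChartAt (𝓡∂ d) x₀).target
  convex : Convex ℝ S
  uniqueDiffOn : UniqueDiffOn ℝ S
  proj_mem : ∀ z ∈ S, z - z 0 • EuclideanSpace.single (0 : Fin d) (1 : ℝ) ∈ S

lemma exists_isHalfBall {x₀ : M} (hb : (𝓡∂ d).IsBoundaryPoint x₀) :
    ∃ S : Set (EuclideanSpace ℝ (Fin d)), IsHalfBall x₀ S := by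
  set z₀ := extChartAt (𝓡∂ d) x₀ x₀ with hz₀
  obtain ⟨r, hr, hsub⟩ := Metric.mem_nhdsWithin_iff.mp
    (extChartAt_target_mem_nhdsWithin (I := 𝓡∂ d) x₀)
  refine ⟨Metric.ball z₀ r ∩ range (𝓡∂ d), Filter.inter_mem
    (mem_nhdsWithin_of_mem_nhds (Metric.ball_mem_nhds _ hr)) self_mem_nhdsWithin,
    ⟨Metric.mem_ball_self hr, mem_range_self _⟩, hsub,
    (convex_ball _ _).inter (𝓡∂ d).convex_range, ?_, ?_⟩
  · rw [inter_comm]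
    exact (𝓡∂ d).uniqueDiffOn.inter Metric.isOpen_ball
  · rintro z ⟨hz, -⟩
    refine ⟨?_, by rw [range_modelWithCornersEuclideanHalfSpace]; simp⟩
    rw [mem_ball_iff_norm] at hz ⊢
    refine lt_of_le_of_lt ?_ hz
    have := norm_sub_coord_le (z - z₀)
    rwa [PiLp.sub_apply, hz₀, extChartAt_zero_of_isBoundaryPoint hb, sub_zero,
      sub_right_comm] at this

lemma mvfderiv_eq_zero_of_eqOn_isHalfBall {x₀ : M} {S : Set (EuclideanSpace ℝ (Fin d))}
    (hS : IsHalfBall x₀ S) (hb : (𝓡∂ d).IsBoundaryPoint x₀) {σ : M → ℝ} (hσ : ContinuousAt σ x₀)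
    {ψ : EuclideanSpace ℝ (Fin d) → ℝ} (hψ : DifferentiableOn ℝ ψ S)
    (hσψ : ∀ z ∈ S, σ ((extChartAt (𝓡∂ d) x₀).symm z) = z 0 * ψ z)
    (h0 : ψ (extChartAt (𝓡∂ d) x₀ x₀) = 0) : mvfderiv (𝓡∂ d) σ x₀ = 0 := by
  have hcoord : HasFDerivWithinAt (fun z : EuclideanSpace ℝ (Fin d) => z 0)
      (EuclideanSpace.proj 0 : EuclideanSpace ℝ (Fin d) →L[ℝ] ℝ) S (extChartAt (𝓡∂ d) x₀ x₀) :=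
    (EuclideanSpace.proj (𝕜 := ℝ) (0 : Fin d)).hasFDerivWithinAt
  have hmul := hcoord.mul (hψ _ hS.center_mem).hasFDerivWithinAt
  rw [h0, extChartAt_zero_of_isBoundaryPoint hb, zero_smul, zero_smul, add_zero] at hmul
  have hderiv : HasMFDerivAt (𝓡∂ d) 𝓘(ℝ, ℝ) σ x₀ 0 :=
    ⟨hσ, (hmul.congr hσψ (hσψ _ hS.center_mem)).mono_of_mem_nhdsWithin hS.mem_nhdsWithin⟩
  rw [mvfderiv, hderiv.mfderiv]
  ext v
  simp

variable [IsManifold (𝓡∂ d) ∞ M]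

lemma isBoundaryPoint_extChartAt_symm (x₀ : M) {z : EuclideanSpace ℝ (Fin d)}
    (hz : z ∈ (extChartAt (𝓡∂ d) x₀).target) (h0 : z 0 = 0) :
    (𝓡∂ d).IsBoundaryPoint ((extChartAt (𝓡∂ d) x₀).symm z) := by
  have hs := (extChartAt (𝓡∂ d) x₀).map_target hz
  rw [extChartAt_source] at hs
  rw [ModelWithCorners.isBoundaryPoint_iff_of_mem_atlas (n := ∞) (by simp)
    (chart_mem_atlas _ x₀) hs]
  change extChartAt (𝓡∂ d) x₀ _ ∈ frontier (extChartAt (𝓡∂ d) x₀).target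
  rw [(extChartAt (𝓡∂ d) x₀).right_inv hz]
  refine ⟨subset_closure hz, fun hi => ?_⟩
  have := interior_mono (extChartAt_target_subset_range (I := 𝓡∂ d) x₀) hi
  rw [interior_range_modelWithCornersEuclideanHalfSpace] at this
  exact (ne_of_gt this) h0

universe v

variable {F : Type v} [NormedAddCommGroup F] [NormedSpace ℝ F]

lemma exists_quotient_isHalfBall [CompleteSpace F] {x₀ : M} {S : Set (EuclideanSpace ℝ (Fin d))}
    (hS : IsHalfBall x₀ S) {f : M → F} (hf : ContMDiff (𝓡∂ d) 𝓘(ℝ, F) ∞ f)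
    (hf0 : ∀ x, (𝓡∂ d).IsBoundaryPoint x → f x = 0) :
    ∃ ψ : EuclideanSpace ℝ (Fin d) → F, ContDiffOn ℝ ∞ ψ S ∧
      ∀ z ∈ S, f ((extChartAt (𝓡∂ d) x₀).symm z) = z 0 • ψ z := by
  have hfS : ContDiffOn ℝ ∞ (f ∘ (extChartAt (𝓡∂ d) x₀).symm) S := by
    rw [← contMDiffOn_iff_contDiffOn]
    exact hf.comp_contMDiffOn ((contMDiffOn_extChartAt_symm x₀).mono hS.subset_target)
  exact exists_smooth_quotient.{0, v} hS.convex hS.uniqueDiffOn (EuclideanSpace.proj 0)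
    (EuclideanSpace.single (0 : Fin d) (1 : ℝ)) hS.proj_mem hfS fun z hz =>
    hf0 _ (isBoundaryPoint_extChartAt_symm x₀ (hS.subset_target (hS.proj_mem z hz)) (by simp))

section DefiningFunction

variable {σ : M → ℝ} (hσ : ContMDiff (𝓡∂ d) 𝓘(ℝ, ℝ) ∞ σ)
  (hσ_zero : ∀ x, σ x = 0 ↔ (𝓡∂ d).IsBoundaryPoint x)
  (hdσ : ∀ x, σ x = 0 → mvfderiv (𝓡∂ d) σ x ≠ 0)
include hσ hσ_zero hdσ

lemma exists_local_quotient_of_isBoundaryPoint [CompleteSpace F] {f : M → F}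
    (hf : ContMDiff (𝓡∂ d) 𝓘(ℝ, F) ∞ f) (hf0 : ∀ x, σ x = 0 → f x = 0) {x₀ : M}
    (hb : (𝓡∂ d).IsBoundaryPoint x₀) :
    ∃ U ∈ 𝓝 x₀, ∃ f' : M → F, ContMDiffOn (𝓡∂ d) 𝓘(ℝ, F) ∞ f' U ∧ ∀ y ∈ U, f y = σ y • f' y := by
  set φ := extChartAt (𝓡∂ d) x₀ with hφ
  obtain ⟨S, hS⟩ := exists_isHalfBall hb
  obtain ⟨ψ, hψ, hσψ⟩ := exists_quotient_isHalfBall hS hσ fun x => (hσ_zero x).mpr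
  obtain ⟨χ, hχ, hfχ⟩ := exists_quotient_isHalfBall hS hf fun x hx => hf0 x ((hσ_zero x).mpr hx)
  have hne : ψ (φ x₀) ≠ 0 := fun h0 => hdσ x₀ ((hσ_zero x₀).mpr hb)
    (mvfderiv_eq_zero_of_eqOn_isHalfBall hS hb hσ.continuous.continuousAt
      (hψ.differentiableOn (by simp)) hσψ h0)
  have hnear : S ∩ {z | ψ z ≠ 0} ∈ 𝓝[range (𝓡∂ d)] (φ x₀) :=
    Filter.inter_mem hS.mem_nhdsWithin (nhdsWithin_le_of_mem hS.mem_nhdsWithin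
      ((hψ.continuousOn _ hS.center_mem).eventually_ne hne))
  rw [hφ, ← map_extChartAt_nhds, Filter.mem_map] at hnear
  refine ⟨_, Filter.inter_mem (extChartAt_source_mem_nhds (I := 𝓡∂ d) x₀) hnear,
    fun y => (ψ (φ y))⁻¹ • χ (φ y), ?_, ?_⟩
  · have hquot : ContDiffOn ℝ ∞ (fun z => (ψ z)⁻¹ • χ z) (S ∩ {z | ψ z ≠ 0}) :=
      ((hψ.mono inter_subset_left).inv fun z hz => hz.2).smul (hχ.mono inter_subset_left)
    refine hquot.contMDiffOn.comp (t := S ∩ {z | ψ z ≠ 0})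
      ((contMDiffOn_extChartAt (x := x₀)).mono fun y hy => ?_) inter_subset_right
    rw [← extChartAt_source (𝓡∂ d)]
    exact hy.1
  · rintro y ⟨hy, hyS, hyψ⟩
    have hyψ : ψ (φ y) ≠ 0 := hyψ
    have hσy := hσψ _ hyS
    have hfy := hfχ _ hyS
    rw [φ.left_inv hy] at hσy hfy
    rw [hfy, hσy, smul_smul, smul_eq_mul, mul_assoc, mul_inv_cancel₀ hyψ, mul_one]

lemma exists_local_quotient [CompleteSpace F] {f : M → F} (hf : ContMDiff (𝓡∂ d) 𝓘(ℝ, F) ∞ f)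
    (hf0 : ∀ x, σ x = 0 → f x = 0) (x₀ : M) :
    ∃ U ∈ 𝓝 x₀, ∃ f' : M → F, ContMDiffOn (𝓡∂ d) 𝓘(ℝ, F) ∞ f' U ∧ ∀ y ∈ U, f y = σ y • f' y := by
  by_cases hx : σ x₀ = 0
  · exact exists_local_quotient_of_isBoundaryPoint hσ hσ_zero hdσ hf hf0 ((hσ_zero x₀).mp hx)
  · exact ⟨{y | σ y ≠ 0}, (isOpen_ne_fun hσ.continuous continuous_const).mem_nhds hx,
      fun y => (σ y)⁻¹ • f y, (hσ.contMDiffOn.inv₀ fun y hy => hy).smul hf.contMDiffOn,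
      fun y hy => (smul_inv_smul₀ hy (f y)).symm⟩

end DefiningFunction

variable {V : M → Type*} [TopologicalSpace (TotalSpace F V)]
  [∀ x, AddCommGroup (V x)] [∀ x, Module ℝ (V x)] [∀ x, TopologicalSpace (V x)]
  [FiberBundle F V] [VectorBundle ℝ F V] [ContMDiffVectorBundle ∞ F V (𝓡∂ d)]

lemma exists_contMDiff_eventuallyEq_trivializationAt [T2Space M] {s : ∀ x, V x}
    (hs : SmoothSection (𝓡∂ d) F s) (x₀ : M) :
    ∃ f : M → F, ContMDiff (𝓡∂ d) 𝓘(ℝ, F) ∞ f ∧ (∀ y, s y = 0 → f y = 0) ∧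
      ∀ᶠ y in 𝓝 x₀, (trivializationAt F V x₀ ⟨y, s y⟩).2 = f y := by
  let t := trivializationAt F V x₀
  have ht : t.baseSet ∈ 𝓝 x₀ :=
    t.open_baseSet.mem_nhds (FiberBundle.mem_baseSet_trivializationAt F V x₀)
  obtain ⟨χ, -, hχ⟩ := (SmoothBumpFunction.nhds_basis_tsupport (I := 𝓡∂ d) x₀).mem_iff.mp ht
  refine ⟨fun y => χ y • t.linearMapAt ℝ y (s y), fun y => ?_, fun y hy => by simp [hy], ?_⟩
  · by_cases hy : y ∈ t.baseSet
    · have hread := ((t.contMDiffAt_section_iff hy).mp (hs y)).congr_of_eventuallyEq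
        (f₁ := fun z => t.linearMapAt ℝ z (s z)) (by
          filter_upwards [t.open_baseSet.mem_nhds hy] with z hz
          rw [t.coe_linearMapAt_of_mem hz])
      exact χ.contMDiffAt.smul hread
    · refine (contMDiffAt_const (c := (0 : F))).congr_of_eventuallyEq ?_
      filter_upwards [(isClosed_tsupport χ).isOpen_compl.mem_nhds fun h => hy (hχ h)] with z hz
      rw [image_eq_zero_of_notMem_tsupport hz, zero_smul]
  · filter_upwards [ht, χ.eventuallyEq_one] with y hy hy1
    rw [t.coe_linearMapAt_of_mem hy, hy1, Pi.one_apply, one_smul]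

variable [T2Space M] {σ : M → ℝ} (hσ : ContMDiff (𝓡∂ d) 𝓘(ℝ, ℝ) ∞ σ)
  (hσ_zero : ∀ x, σ x = 0 ↔ (𝓡∂ d).IsBoundaryPoint x)
  (hdσ : ∀ x, σ x = 0 → mvfderiv (𝓡∂ d) σ x ≠ 0)
include hσ hσ_zero hdσ

lemma exists_local_section_quotient [CompleteSpace F] {s : ∀ x, V x}
    (hs : SmoothSection (𝓡∂ d) F s) (hs0 : ∀ x, σ x = 0 → s x = 0) (x₀ : M) :
    ∃ U ∈ 𝓝 x₀, ∃ s' : ∀ x, V x,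
      ContMDiffOn (𝓡∂ d) ((𝓡∂ d).prod 𝓘(ℝ, F)) ∞ (fun y => TotalSpace.mk' F y (s' y)) U ∧
        ∀ y ∈ U, s y = σ y • s' y := by
  let t := trivializationAt F V x₀
  obtain ⟨f, hf, hf0, hsf⟩ := exists_contMDiff_eventuallyEq_trivializationAt hs x₀
  obtain ⟨U, hU, f', hf', hff'⟩ := exists_local_quotient hσ hσ_zero hdσ hf
    (fun x hx => hf0 x (hs0 x hx)) x₀
  refine ⟨U ∩ (t.baseSet ∩ {y | (t ⟨y, s y⟩).2 = f y}), Filter.inter_mem hU (Filter.inter_mem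
    (t.open_baseSet.mem_nhds (FiberBundle.mem_baseSet_trivializationAt F V x₀)) hsf),
    fun y => t.symm y (f' y), ?_, fun y hy => ?_⟩
  · intro y hy
    rw [t.contMDiffWithinAt_section _ hy.2.1]
    refine ((hf'.mono inter_subset_left).congr fun z hz => ?_) y hy
    rw [t.apply_mk_symm hz.2.1]
  · obtain ⟨hyU, hyt, hyf⟩ := hy
    have hyf : (t ⟨y, s y⟩).2 = f y := hyf
    calc s y = t.symm y (t ⟨y, s y⟩).2 := (t.symm_apply_apply_mk hyt (s y)).symm
      _ = t.symm y (σ y • f' y) := by rw [hyf, hff' y hyU]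
      _ = σ y • t.symm y (f' y) := by
        simp only [← t.symmₗ_apply (R := ℝ) hyt, map_smul]

theorem exists_section_quotient [SecondCountableTopology M] [CompleteSpace F] {s : ∀ x, V x}
    (hs : SmoothSection (𝓡∂ d) F s) (hs0 : ∀ x, σ x = 0 → s x = 0) :
    ∃ s' : ∀ x, V x, SmoothSection (𝓡∂ d) F s' ∧ s = σ • s' := by
  have : LocallyCompactSpace M :=
    Manifold.locallyCompact_of_finiteDimensional (𝓡∂ d)
  have hconvex (x : M) : Convex ℝ {v | s x = σ x • v} := fun v hv w hw a b _ _ hab => by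
    simp only [Set.mem_ofPred_eq] at hv hw ⊢
    rw [smul_add, smul_comm _ a, smul_comm _ b, ← hv, ← hw, ← add_smul, hab, one_smul]
  obtain ⟨s', hs'⟩ := exists_contMDiffSection_forall_mem_convex_of_local (n := (⊤ : ℕ∞)) (𝓡∂ d)
    (F_fiber := F) V _ hconvex (exists_local_section_quotient hσ hσ_zero hdσ hs hs0)
  exact ⟨s', s'.contMDiff, funext hs'⟩

end BoundaryDivision

/-! ### Solutions of the log-type problem -/

section WeightOperators

variable {M : Type*} {V : M → Type*} [∀ x, AddCommGroup (V x)] [∀ x, Module ℝ (V x)]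

lemma weight_sub (w c : ℝ) :
    (fun x => weight (V := V) w x - c • LinearMap.id) = weight (w - c) := by
  ext x v
  simp only [weight, LinearMap.sub_apply, LinearMap.smul_apply, LinearMap.id_apply]
  module

lemma logWeight_sub (w c : ℝ) :
    (fun x => logWeight (V := V) w x - c • LinearMap.id) = logWeight (w - c) := by
  funext x
  refine LinearMap.ext fun p => Prod.ext ?_ ?_ <;>
  · simp only [LinearMap.sub_apply, LinearMap.smul_apply, LinearMap.id_apply, logWeight_apply,
      Prod.fst_sub, Prod.smul_fst, Prod.snd_sub, Prod.smul_snd]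
    module

end WeightOperators

section SmoothSections

variable {E : Type*} [NormedAddCommGroup E] [NormedSpace ℝ E]
  {H : Type*} [TopologicalSpace H] {I : ModelWithCorners ℝ E H}
  {M : Type*} [TopologicalSpace M] [ChartedSpace H M]
  {F : Type*} [NormedAddCommGroup F] [NormedSpace ℝ F]
  {V : M → Type*} [TopologicalSpace (TotalSpace F V)] [∀ x, TopologicalSpace (V x)]
  [FiberBundle F V]

lemma mdifferentiableAt_congr_section {s s' : ∀ x, V x} {x : M} (h : ∀ᶠ y in 𝓝 x, s y = s' y)
    (hs : MDiffAt (T% s') x) : MDiffAt (T% s) x := by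
  refine hs.congr_of_eventuallyEq ?_
  filter_upwards [h] with y hy
  exact congrArg (TotalSpace.mk' F y) hy

variable [∀ x, AddCommGroup (V x)] [∀ x, Module ℝ (V x)] [VectorBundle ℝ F V]

variable (I F V) in
/-- The module of sections that are smooth up to the boundary. -/
def smoothSections : Submodule ℝ (∀ x, V x) where
  carrier := {s | SmoothSection I F s}
  zero_mem' := Bundle.contMDiff_zeroSection ℝ V
  add_mem' ha hb := ContMDiff.add_section ha hb
  smul_mem' c _ hs := ContMDiff.smul_section (f := fun _ => c) contMDiff_const hs

/-- Multiplication by a smooth function, as an endomorphism of the module of smooth sections. -/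
def mulSection {φ : M → ℝ} (hφ : CMDiff ∞ φ) : smoothSections I F V →ₗ[ℝ] smoothSections I F V where
  toFun s := ⟨φ • s.1, hφ.smul_section s.2⟩
  map_add' s s' := Subtype.ext (smul_add φ s.1 s'.1)
  map_smul' c s := Subtype.ext (smul_comm φ c s.1)

lemma mulSection_apply {φ : M → ℝ} (hφ : CMDiff ∞ φ) (s : smoothSections I F V) (x : M) :
    (mulSection hφ s).1 x = φ x • s.1 x := rfl

lemma mulSection_pow_apply {φ : M → ℝ} (hφ : CMDiff ∞ φ) (k : ℕ) (s : smoothSections I F V)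
    (x : M) : ((mulSection hφ ^ k) s).1 x = φ x ^ k • s.1 x := by
  induction k with
  | zero => simp
  | succ k ih =>
    rw [pow_succ', Module.End.mul_apply, mulSection_apply, ih, smul_smul, pow_succ']

/-- A pair of smooth sections as a section of the bundle of pairs, which is how log densities are
recorded. -/
def pairSection : smoothSections I F V × smoothSections I F V →ₗ[ℝ] ∀ x, V x × V x where
  toFun p x := (p.1.1 x, p.2.1 x)
  map_add' _ _ := rfl
  map_smul' _ _ := rfl

lemma ofDensity_eq_pairSection (s : smoothSections I F V) :
    ofDensity s.1 = pairSection (s, 0) := rfl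

lemma logMul_eq_pairSection {τ : M → ℝ} (hτ : CMDiff ∞ (fun x => Real.log (τ x)))
    (s : smoothSections I F V) : logMul τ s.1 = pairSection (mulSection hτ s, s) := rfl

lemma coe_sum_apply {ι : Type*} (t : Finset ι) (s : ι → smoothSections I F V) (x : M) :
    (∑ i ∈ t, s i).1 x = ∑ i ∈ t, (s i).1 x := by
  rw [Submodule.coe_sum, Finset.sum_apply]

lemma formallyEqual_of_telescopes {σ : M → ℝ} (hσ : CMDiff ∞ σ) {u v : LogSeries V}
    {a e : ℕ → smoothSections I F V × smoothSections I F V} {b c : ℕ → smoothSections I F V}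
    (hreg : ∀ k, u.reg k - v.reg k = pairSection (a k))
    (hlog : ∀ k, u.logx k - v.logx k = (b k).1)
    (ha : Telescopes ((mulSection hσ).prodMap (mulSection hσ)) a e)
    (hb : Telescopes (mulSection hσ) b c) : FormallyEqual I F σ u v := fun n => by
  have hterm (k : ℕ) (x : M) :
      σ x ^ k • ((u.reg k x).1 + Real.log (σ x) • u.logx k x)
          - σ x ^ k • ((v.reg k x).1 + Real.log (σ x) • v.logx k x)
        = ((mulSection hσ ^ k) (a k).1).1 x
          + Real.log (σ x) • ((mulSection hσ ^ k) (b k)).1 x := by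
    have hreg_x : (u.reg k x).1 - (v.reg k x).1 = (a k).1.1 x :=
      congrArg (fun s => (s x).1) (hreg k)
    have hlog_x : u.logx k x - v.logx k x = (b k).1 x := congrFun (hlog k) x
    rw [mulSection_pow_apply, mulSection_pow_apply, ← hreg_x, ← hlog_x]
    module
  have ha_sum : ∑ k ∈ Finset.range (n + 1), (mulSection hσ ^ k) (a k).1
      = (mulSection hσ ^ (n + 1)) (e n).1 := by
    have h := congrArg Prod.fst (ha.sum_pow n)
    simpa only [Prod.fst_sum, prodMap_pow_apply] using h
  refine ⟨(e n).1.1, (c n).1, (e n).1.2, (c n).2, fun x _ => ?_⟩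
  simp only [LogSeries.partialSum]
  rw [← Finset.sum_sub_distrib, Finset.sum_congr rfl fun k _ => hterm k x,
    Finset.sum_add_distrib, ← Finset.smul_sum, ← coe_sum_apply, ← coe_sum_apply, ha_sum,
    hb.sum_pow, mulSection_pow_apply, mulSection_pow_apply, smul_smul, mul_comm (Real.log _)]

end SmoothSections

lemma exists_smooth_log {E : Type*} [NormedAddCommGroup E] [NormedSpace ℝ E]
    [FiniteDimensional ℝ E] {H : Type*} [TopologicalSpace H] {I : ModelWithCorners ℝ E H}
    {M : Type*} [TopologicalSpace M] [ChartedSpace H M] [IsManifold I ∞ M] [T2Space M]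
    {σ : M → ℝ} (hσ : CMDiff ∞ σ) {x : M} (hx : 0 < σ x) :
    ∃ L : M → ℝ, CMDiff ∞ L ∧ L =ᶠ[𝓝 x] fun y => Real.log (σ y) := by
  have hpos : {y | 0 < σ y} ∈ 𝓝 x := hσ.continuous.continuousAt.eventually (lt_mem_nhds hx)
  obtain ⟨L, hL, h⟩ := exists_global_eventuallyEq (I := I) (F := ℝ) (V := Bundle.Trivial M ℝ) hpos
    (s := fun y => Real.log (σ y)) fun y hy => by
      refine ContMDiffAt.contMDiffWithinAt ((Bundle.contMDiffAt_section _).mpr ?_)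
      have hlog : ContMDiffAt 𝓘(ℝ, ℝ) 𝓘(ℝ, ℝ) ∞ Real.log (σ y) :=
        (Real.contDiffAt_log.mpr (ne_of_gt hy)).contMDiffAt
      exact hlog.comp y (hσ y)
  exact ⟨L, contMDiff_trivial_iff.mp hL, h⟩

section SolutionOperators

variable {E : Type*} [NormedAddCommGroup E] [NormedSpace ℝ E]
  {H : Type*} [TopologicalSpace H] {I : ModelWithCorners ℝ E H}
  {M : Type*} [TopologicalSpace M] [ChartedSpace H M] [IsManifold I ∞ M]
  {F : Type*} [NormedAddCommGroup F] [NormedSpace ℝ F]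
  {V : M → Type*} [TopologicalSpace (TotalSpace F V)]
  [∀ x, AddCommGroup (V x)] [∀ x, Module ℝ (V x)] [∀ x, TopologicalSpace (V x)]
  [∀ x, IsTopologicalAddGroup (V x)] [∀ x, ContinuousSMul ℝ (V x)]
  [FiberBundle F V] [VectorBundle ℝ F V]
  {cov : (∀ x, V x) → ∀ x, TangentSpace I x →L[ℝ] V x}

lemma IsSmoothConnection.congr (hcov : IsSmoothConnection F cov) {s s' : ∀ x, V x} {x : M}
    (h : ∀ᶠ y in 𝓝 x, s y = s' y) (hs' : MDiffAt (T% s') x) : cov s x = cov s' x :=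
  hcov.isCov.congr_of_eventuallyEq (mdifferentiableAt_congr_section h hs') hs' Filter.univ_mem h

lemma weightOf_spec (g : PseudoMetric I M) (m : ℕ) :
    dimR g + 2 * weightOf g (m + 1) = m + 1 := by
  rw [weightOf]
  push_cast
  ring

variable [FiniteDimensional ℝ E] (g : PseudoMetric I M) {σ : M → ℝ}

lemma contMDiff_scaleNormSq_inv [T2Space M] (hd : dimR g ≠ 0) (hσ : CMDiff ∞ σ)
    (hI : ∀ x, scaleNormSq g σ x ≠ 0) : CMDiff ∞ (fun x => (scaleNormSq g σ x)⁻¹) :=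
  (contMDiff_scaleNormSq g hd hσ).inv₀ hI

namespace IsSmoothConnection

variable (hcov : IsSmoothConnection F cov)
include hcov

lemma hessian_congr {s s' : ∀ x, V x} (hs' : SmoothSection I F s') {x : M}
    (h : ∀ᶠ y in 𝓝 x, s y = s' y) : hessian g cov s x = hessian g cov s' x := by
  funext v w
  have hcov_ext : ∀ᶠ y in 𝓝 x, cov s y (ext w y) = cov s' y (ext w y) := by
    filter_upwards [h.eventually_nhds] with y hy
    rw [hcov.congr hy (mdifferentiableAt_of_smooth hs' y)]
  simp only [hessian]
  rw [hcov.congr hcov_ext (hcov.mdifferentiableAt_apply hs' (mdifferentiableAt_ext w)),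
    hcov.congr h (mdifferentiableAt_of_smooth hs' x)]

variable (hd : dimR g ≠ 0) (hσ : CMDiff ∞ σ)

include hd hσ in
lemma IdotD_congr (w : ℝ) {s s' : ∀ x, V x} (hs' : SmoothSection I F s') {x : M}
    (h : ∀ᶠ y in 𝓝 x, s y = s' y) :
    IdotD g σ cov (weight w) s x = IdotD g σ cov (weight w) s' x := by
  have hds' : MDiffAt (T% s') x := mdifferentiableAt_of_smooth hs' x
  rw [hcov.IdotD_weight g hd hσ w hds',
    hcov.IdotD_weight g hd hσ w (mdifferentiableAt_congr_section h hds'), laplacian,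
    hcov.hessian_congr g hs' h, hcov.congr h hds', h.self_of_nhds, laplacian]

variable [T2Space M] (hI : ∀ x, scaleNormSq g σ x ≠ 0)

/-- The operator `y` on smooth sections of weight `w`. -/
def ySection (w : ℝ) : smoothSections I F V →ₗ[ℝ] smoothSections I F V where
  toFun s := -mulSection (contMDiff_scaleNormSq_inv g hd hσ hI)
    ⟨IdotD g σ cov (weight w) s.1, hcov.contMDiff_IdotD g hd hσ w s.2⟩
  map_add' s s' := by
    rw [← neg_add, ← map_add]
    congr 2
    exact Subtype.ext (hcov.IdotD_add g hd hσ w s.2 s'.2)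
  map_smul' c s := by
    rw [RingHom.id_apply, smul_neg, ← map_smul]
    congr 2
    exact Subtype.ext (hcov.IdotD_const_smul g hd hσ w c s.2)

/-- The derivative of `y` in the weight, which is the effect on `y` of the nilpotent part of the
weight operator of log densities. -/
def ySectionDeriv (w : ℝ) : smoothSections I F V →ₗ[ℝ] smoothSections I F V where
  toFun s := -mulSection (contMDiff_scaleNormSq_inv g hd hσ hI)
    ⟨IdotDWeightDeriv g σ cov w s.1, hcov.contMDiff_IdotDWeightDeriv g hσ w s.2⟩
  map_add' s s' := by
    rw [← neg_add, ← map_add]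
    congr 2
    exact Subtype.ext (hcov.IdotDWeightDeriv_add g w s.2 s'.2)
  map_smul' c s := by
    rw [RingHom.id_apply, smul_neg, ← map_smul]
    congr 2
    exact Subtype.ext (hcov.IdotDWeightDeriv_const_smul g w c s.2)

local notation "𝐱" => mulSection (F := F) (V := V) hσ
local notation "𝐲" => ySection g hcov hd hσ hI
local notation "∂𝐲" => ySectionDeriv g hcov hd hσ hI

lemma ySection_apply (w : ℝ) (s : smoothSections I F V) (x : M) :
    (𝐲 w s).1 x
      = -((scaleNormSq g σ x)⁻¹ • IdotD g σ cov (weight w) s.1 x) := rfl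

lemma ySectionDeriv_apply (w : ℝ) (s : smoothSections I F V) (x : M) :
    (∂𝐲 w s).1 x
      = -((scaleNormSq g σ x)⁻¹ • IdotDWeightDeriv g σ cov w s.1 x) := rfl

lemma scaleAlgebra : ScaleAlgebra (dimR g) 𝐱 0
    𝐲 where
  comm w s := Subtype.ext <| funext fun x => by
    change (𝐲 (w + 1) (𝐱 s)).1 x
      = σ x • (𝐲 w s).1 x - (dimR g + 2 * w) • s.1 x - (2 : ℝ) • (0 : V x)
    rw [ySection_apply, ySection_apply]
    change -((scaleNormSq g σ x)⁻¹ • IdotD g σ cov (weight (w + 1)) (σ • s.1) x) = _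
    rw [hcov.IdotD_scale_smul g hd hσ w s.2 x]
    have := hI x
    match_scalars <;> field_simp
  nil_X s := by simp
  nil_Y w s := by simp

lemma ySectionDeriv_comm (w : ℝ) (s : smoothSections I F V) :
    ∂𝐲 (w + 1) (𝐱 s)
      = 𝐱 (∂𝐲 w s) - (2 : ℝ) • s :=
  Subtype.ext <| funext fun x => by
    change (∂𝐲 (w + 1) (𝐱 s)).1 x
      = σ x • (∂𝐲 w s).1 x - (2 : ℝ) • s.1 x
    rw [ySectionDeriv_apply, ySectionDeriv_apply]
    change -((scaleNormSq g σ x)⁻¹ • IdotDWeightDeriv g σ cov (w + 1) (σ • s.1) x) = _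
    rw [hcov.IdotDWeightDeriv_scale_smul g hd hσ w s.2 x]
    have := hI x
    match_scalars <;> field_simp

lemma yPow_eq (w : ℝ) (k : ℕ) (s : smoothSections I F V) :
    yPow g σ cov (weight w) k s.1 = (iterY 𝐲 w k s).1 := by
  induction k with
  | zero => rfl
  | succ k ih =>
    rw [yPow, ih, weight_sub, iterY_succ]
    rfl

lemma yOp_logWeight (w : ℝ) (p : smoothSections I F V × smoothSections I F V) :
    yOp g σ (logCov cov) (logWeight w) (pairSection p)
      = pairSection (pairY 𝐲 ∂𝐲 w p) := by
  funext x
  have hIdotD := hcov.IdotD_logWeight g hd hσ w (s := pairSection p) p.1.2 p.2.2 x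
  rw [yOp, hIdotD, pairY_apply]
  refine Prod.ext ?_ rfl
  change _ = (𝐲 w p.1).1 x + (∂𝐲 w p.2).1 x
  rw [ySection_apply, ySectionDeriv_apply, ← neg_add, ← smul_add]
  rfl

lemma yPow_log_eq (w : ℝ) (k : ℕ) (p : smoothSections I F V × smoothSections I F V) :
    yPow g σ (logCov cov) (logWeight w) k (pairSection p)
      = pairSection (iterY (pairY 𝐲 ∂𝐲)
          w k p) := by
  induction k with
  | zero => rfl
  | succ k ih => rw [yPow, ih, logWeight_sub, iterY_succ, hcov.yOp_logWeight g hd hσ hI]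

lemma normalOrder_eq (w : ℝ) (S : PowerSeries ℝ) (s : smoothSections I F V) (k : ℕ) :
    normalOrder g σ cov (weight w) S s.1 k
      = (PowerSeries.coeff k S • iterY 𝐲 w k s : smoothSections I F V).1 :=
  congrArg _ (hcov.yPow_eq g hd hσ hI w k s)

lemma normalOrder_log_eq (w : ℝ) (S : PowerSeries ℝ)
    (p : smoothSections I F V × smoothSections I F V) (k : ℕ) :
    normalOrder g σ (logCov cov) (logWeight w) S (pairSection p) k
      = pairSection (PowerSeries.coeff k S •
          iterY (pairY 𝐲 ∂𝐲) w k p) :=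
  congrArg _ (hcov.yPow_log_eq g hd hσ hI w k p)

lemma weylAverage_eq {τ : M → ℝ} (hτ : CMDiff ∞ (fun x => Real.log (τ x))) (w : ℝ) (m : ℕ)
    (s : smoothSections I F V) :
    weylAverage g σ cov w τ m s.1
      = pairSection (algWeyl 𝐲 ∂𝐲
          (mulSection hτ) w m s) := by
  rw [weylAverage, logMul_eq_pairSection hτ, hcov.yPow_eq g hd hσ hI,
    hcov.yPow_log_eq g hd hσ hI]
  rfl

/-- The formal series with coefficients `regCoeff` and `logCoeff`, for the operators `y` and
`∂y/∂w` on smooth sections. -/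
def algSeries (w : ℝ) (m : ℕ) (P Q L : ℕ → ℝ) (f : smoothSections I F V)
    (W : smoothSections I F V × smoothSections I F V) : LogSeries V where
  reg k := pairSection (regCoeff 𝐲 ∂𝐲 w m P Q
    f W k)
  logx k := (logCoeff 𝐲 w L f k).1

lemma shift_normalOrder_eq (w : ℝ) (m : ℕ) (S : PowerSeries ℝ) (s : smoothSections I F V) :
    shift m (normalOrder g σ cov (weight (w - m)) S s.1)
      = fun k => (tailCoeff 𝐲 w m
          (fun j => PowerSeries.coeff j S) s k).1 := by
  funext k
  simp only [shift, tailCoeff, hcov.normalOrder_eq g hd hσ hI]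
  split_ifs <;> rfl

lemma shift_normalOrder_log_eq (w : ℝ) (m : ℕ) (S : PowerSeries ℝ)
    (p : smoothSections I F V × smoothSections I F V) :
    shift m (normalOrder g σ (logCov cov) (logWeight (w - m)) S (pairSection p))
      = fun k => pairSection (tailCoeff (pairY 𝐲
          ∂𝐲) w m (fun j => PowerSeries.coeff j S) p k) := by
  funext k
  simp only [shift, tailCoeff, hcov.normalOrder_log_eq g hd hσ hI]
  split_ifs <;> rfl

lemma solO_eq {τ : M → ℝ} (hτ : CMDiff ∞ (fun x => Real.log (τ x))) (m : ℕ)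
    (s : smoothSections I F V) :
    solO g σ cov (m + 1) τ s.1
      = hcov.algSeries g hd hσ hI (weightOf g (m + 1)) m (regSeq m)
          (fun j => logConst m * kernelCoeff m j) (logSeq m (logConst m)) s
          (algWeyl 𝐲 ∂𝐲
            (mulSection hτ) (weightOf g (m + 1)) m s) := by
  have hK : seriesK (2 - ((m + 1 : ℕ) : ℝ)) = seriesK (1 - m) := by
    congr 1; push_cast; ring
  have hm : m + 1 - 2 = m - 1 := by lia
  have hc : 1 / ((m.factorial : ℝ) * ((m - 1).factorial : ℝ)) = logConst m := rfl
  simp only [solO, algSeries, Nat.add_sub_cancel, hK, hm, hc]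
  rw [hcov.weylAverage_eq g hd hσ hI hτ, hcov.yPow_eq g hd hσ hI,
    hcov.shift_normalOrder_log_eq g hd hσ hI, hcov.shift_normalOrder_eq g hd hσ hI]
  simp only [hcov.normalOrder_eq g hd hσ hI, ofDensity_eq_pairSection, ← map_smul, ← map_sub,
    ← map_add, coeff_seriesK]
  congr 1
  · funext k
    congr 1
    generalize algWeyl _ _ _ _ _ s = W
    rw [regCoeff, regSeq, tailCoeff_mul_left]
    congr 1
    refine Prod.ext ?_ ?_
    · simp only [Prod.fst_sub, Prod.smul_fst, map_smul, sub_smul, mul_smul]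
    · simp
  · funext k
    rw [logCoeff_logSeq, ← Submodule.coe_smul, ← Submodule.coe_neg]

lemma solObar_eq {τ : M → ℝ} (hτ : CMDiff ∞ (fun x => Real.log (τ x)))
    (s : smoothSections I F V) :
    solObar g σ cov τ s.1
      = hcov.algSeries g hd hσ hI (weightOf g 1) 0
          (fun k => PowerSeries.coeff k (PowerSeries.X * seriesH 1))
          (fun j => -1 * kernelCoeff 0 j) (logSeq 0 (-1)) s
          (algWeyl 𝐲 ∂𝐲
            (mulSection hτ) (weightOf g 1) 0 s) := by
  have hW : algWeyl 𝐲 ∂𝐲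
      (mulSection hτ) (weightOf g 1) 0 s = (mulSection hτ s, s) := by
    rw [algWeyl, iterY_zero, iterY_zero, ← two_smul ℝ, smul_smul]
    norm_num
  simp only [hW, solObar, algSeries, logMul_eq_pairSection hτ]
  congr 1
  · funext k
    rw [hcov.normalOrder_log_eq g hd hσ hI, hcov.normalOrder_eq g hd hσ hI,
      ofDensity_eq_pairSection, ← map_neg, ← map_add, coeff_seriesJ0, regCoeff, tailCoeff_zero,
      add_comm, neg_one_mul, neg_smul]
  · funext k
    rw [hcov.normalOrder_eq g hd hσ hI, coeff_seriesJ0, logCoeff_logSeq, tailCoeff_zero,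
      iterY_zero, neg_one_smul, neg_neg]

/-- The smooth coefficients, with respect to the powers of `σ`, of the series obtained by absorbing
the terms in `log τ` into `log σ - log τ`; `T` is multiplication by `log τ`. -/
def freeCoeff (T : smoothSections I F V →ₗ[ℝ] smoothSections I F V) (w : ℝ) (m : ℕ)
    (P Q L : ℕ → ℝ) (f : smoothSections I F V)
    (W : smoothSections I F V × smoothSections I F V) (k : ℕ) : smoothSections I F V :=
  (regCoeff 𝐲 ∂𝐲 w m P Q f W k).1 + T (logCoeff 𝐲 w L f k)

variable {m : ℕ} {P Q L : ℕ → ℝ} (hR : LogRecurrence m P Q L)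
include hR

lemma shift_logCoeff (w : ℝ) (f : smoothSections I F V) (k : ℕ) :
    shift m (fun j => (logCoeff 𝐲 w L f (m + j)).1) k = (logCoeff 𝐲 w L f k).1 := by
  rw [shift]
  split_ifs with hk
  · rw [Nat.add_sub_cancel' hk]
  · rw [logCoeff, hR.below k (by lia), zero_smul]
    rfl

variable {τ : M → ℝ} (hτ : CMDiff ∞ (fun x => Real.log (τ x)))

lemma algSeries_hasForm {w : ℝ} {f : smoothSections I F V}
    {W : smoothSections I F V × smoothSections I F V} (hW : W.2 = iterY 𝐲 w m f) :
    (hcov.algSeries g hd hσ hI w m P Q L f W).HasForm (m + 1) τ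
      (fun k => (hcov.freeCoeff g hd hσ hI (mulSection hτ) w m P Q L f W k).1)
      (fun j => (logCoeff 𝐲 w L f (m + j)).1) := by
  refine ⟨fun k => ?_, fun k => ?_⟩ <;> rw [Nat.add_sub_cancel, hcov.shift_logCoeff g hd hσ hI hR]
  · rw [logMul_eq_pairSection hτ, ofDensity_eq_pairSection, ← map_sub, algSeries]
    refine congrArg pairSection (Prod.ext ?_ ?_)
    · simp only [freeCoeff, Prod.fst_sub, add_sub_cancel_right]
    · simp only [Prod.snd_sub, zero_sub, hR.regCoeff_snd hW]
  · rfl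

omit hR in
lemma IdotD_eq (w : ℝ) (s : smoothSections I F V) (x : M) :
    IdotD g σ cov (weight w) s.1 x = -(scaleNormSq g σ x • (𝐲 w s).1 x) := by
  rw [hcov.ySection_apply g hd hσ hI, smul_neg, neg_neg, smul_inv_smul₀ (hI x)]

omit hR in
lemma IdotDWeightDeriv_eq (w : ℝ) (s : smoothSections I F V) (x : M) :
    IdotDWeightDeriv g σ cov w s.1 x = -(scaleNormSq g σ x • (∂𝐲 w s).1 x) := by
  rw [hcov.ySectionDeriv_apply g hd hσ hI, smul_neg, neg_neg, smul_inv_smul₀ (hI x)]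

omit hR in
lemma IdotD_of_eventuallyEq_add_log_smul {w : ℝ} (hw : dimR g + 2 * w = m + 1)
    {r s u : smoothSections I F V} (hs : (m : ℝ) • s = (m : ℝ) • 𝐱 u) {l : M → ℝ}
    (hl : CMDiff ∞ l) {x : M} (hx : 0 < σ x) (hlog : l =ᶠ[𝓝 x] fun y => Real.log (σ y))
    {S : ∀ y, V y} (hS : ∀ᶠ y in 𝓝 x, S y = (r.1 + l • s.1) y) :
    IdotD g σ cov (weight w) S x
      = scaleNormSq g σ x • ((∂𝐲 w s).1 x + (m : ℝ) • u.1 x - (𝐲 w r).1 x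
          - Real.log (σ x) • (𝐲 w s).1 x) := by
  have hsx : (m : ℝ) • s.1 x = (m : ℝ) • σ x • u.1 x := congrArg (fun s => s.1 x) hs
  have hpole : (scaleNormSq g σ x * (dimR g + 2 * w - 1) * (σ x)⁻¹) • s.1 x
      = (scaleNormSq g σ x * m) • u.1 x := by
    rw [hw, add_sub_cancel_right, mul_right_comm, mul_smul _ (m : ℝ), hsx]
    match_scalars
    field_simp
  have hls : SmoothSection I F (l • s.1) := hl.smul_section s.2
  rw [hcov.IdotD_congr g hd hσ w (ContMDiff.add_section r.2 hls) hS,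
    hcov.IdotD_add g hd hσ w r.2 hls, Pi.add_apply, hcov.IdotD_log_smul g hd hσ w hl s.2 hx hlog,
    hpole, hlog.self_of_nhds, hcov.IdotD_eq g hd hσ hI, hcov.IdotD_eq g hd hσ hI,
    hcov.IdotDWeightDeriv_eq g hd hσ hI]
  module

lemma truncation_eventuallyEq {w : ℝ} {f : smoothSections I F V}
    {W : smoothSections I F V × smoothSections I F V} (n : ℕ) {l : M → ℝ} {x : M}
    (hlog : l =ᶠ[𝓝 x] fun y => Real.log (σ y)) :
    ∀ᶠ y in 𝓝 x, truncation σ (m + 1) τ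
        (fun k => (hcov.freeCoeff g hd hσ hI (mulSection hτ) w m P Q L f W k).1)
        (fun j => (logCoeff 𝐲 w L f (m + j)).1) n y
      = ((∑ k ∈ Finset.range (n + 1), (𝐱 ^ k) (regCoeff 𝐲 ∂𝐲 w m P Q f W k).1).1
          + l • (∑ k ∈ Finset.range (n + 1), (𝐱 ^ k) (logCoeff 𝐲 w L f k)).1) y := by
  filter_upwards [hlog] with y hy
  rw [truncation, Nat.add_sub_cancel, Pi.add_apply, Pi.smul_apply', coe_sum_apply, coe_sum_apply,
    Finset.smul_sum, ← Finset.sum_add_distrib]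
  refine Finset.sum_congr rfl fun k _ => ?_
  rw [hcov.shift_logCoeff g hd hσ hI hR, mulSection_pow_apply, mulSection_pow_apply, freeCoeff,
    Submodule.coe_add, Pi.add_apply, mulSection_apply, hy]
  module

lemma IdotD_truncation {w : ℝ} (hw : dimR g + 2 * w = m + 1) {f : smoothSections I F V}
    {W : smoothSections I F V × smoothSections I F V} (hW : W.2 = iterY 𝐲 w m f) (n : ℕ) {x : M}
    (hx : 0 < σ x) :
    IdotD g σ cov (weight w) (truncation σ (m + 1) τ
        (fun k => (hcov.freeCoeff g hd hσ hI (mulSection hτ) w m P Q L f W k).1)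
        (fun j => (logCoeff 𝐲 w L f (m + j)).1) n) x
      = σ x ^ n • (-(scaleNormSq g σ x •
          (pairY 𝐲 ∂𝐲 (w - n) (regCoeff 𝐲 ∂𝐲 w m P Q f W n)).1.1 x))
        + (σ x ^ n * Real.log (σ x)) • (-(scaleNormSq g σ x •
          (𝐲 (w - n) (logCoeff 𝐲 w L f n)).1 x)) := by
  obtain ⟨l, hl, hlog⟩ := exists_smooth_log hσ hx
  have hreg := hR.Y_sum_regCoeff (hcov.scaleAlgebra g hd hσ hI)
    (hcov.ySectionDeriv_comm g hd hσ hI) hw hW n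
  have hlogs := hR.sum_Y_logCoeff (hcov.scaleAlgebra g hd hσ hI) hw f n
  rw [← map_sum] at hlogs
  rw [hcov.IdotD_of_eventuallyEq_add_log_smul g hd hσ hI hw (hR.natCast_smul_sum_logCoeff f n) hl
    hx hlog (hcov.truncation_eventuallyEq g hd hσ hI hR hτ n hlog), hreg, hlogs]
  simp only [Submodule.coe_add, Submodule.coe_smul, Pi.add_apply, Pi.smul_apply,
    mulSection_pow_apply]
  module

lemma algSeries_isInfiniteOrderSolution {f : smoothSections I F V}
    {W : smoothSections I F V × smoothSections I F V}
    (hW : W.2 = iterY 𝐲 (weightOf g (m + 1)) m f) :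
    IsInfiniteOrderSolution F g σ cov (m + 1) τ
      (fun k => (hcov.freeCoeff g hd hσ hI (mulSection hτ) (weightOf g (m + 1)) m P Q L f W k).1)
      (fun j => (logCoeff 𝐲 (weightOf g (m + 1)) L f (m + j)).1) := by
  have hnorm := contMDiff_scaleNormSq g hd hσ
  refine ⟨fun k => Subtype.property _, fun j => Subtype.property _, fun n => ⟨_, _,
    (-(mulSection hnorm _) : smoothSections I F V).2,
    (-(mulSection hnorm _) : smoothSections I F V).2, fun hn => ?_,
    fun x hx => hcov.IdotD_truncation g hd hσ hI hR hτ (weightOf_spec g m) hW n hx⟩⟩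
  rw [logCoeff, hR.below n (by lia), zero_smul, map_zero, map_zero, neg_zero]
  rfl

lemma algSeries_formallyEqual {T T' : smoothSections I F V →ₗ[ℝ] smoothSections I F V}
    (hTX : ∀ s, T (𝐱 s) = 𝐱 (T s)) (hT : ∀ s, ∃ v, T s - T' s = 𝐱 v)
    {f f' v : smoothSections I F V} (hf : f - f' = 𝐱 v) :
    FormallyEqual I F σ
      (hcov.algSeries g hd hσ hI (weightOf g (m + 1)) m P Q L f
        (algWeyl 𝐲 ∂𝐲 T (weightOf g (m + 1)) m f))
      (hcov.algSeries g hd hσ hI (weightOf g (m + 1)) m P Q L f'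
        (algWeyl 𝐲 ∂𝐲 T' (weightOf g (m + 1)) m f')) := by
  have hA := hcov.scaleAlgebra g hd hσ hI
  obtain ⟨w, hw⟩ : ∃ w, weightOf g (m + 1) = w + 1 := ⟨_, (sub_add_cancel _ 1).symm⟩
  have hdim : dimR g + 2 * w = m - 1 := by linarith [weightOf_spec g m]
  obtain ⟨e, he⟩ := hR.exists_telescopes_regCoeff_sub hA hdim
    (hcov.ySectionDeriv_comm g hd hσ hI) hTX hT hf
  rw [hw]
  refine formallyEqual_of_telescopes hσ (fun k => (map_sub pairSection _ _).symm) (fun k => ?_) he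
    (hR.telescopes_logCoeff_X hA hdim v)
  rw [← hf, ← logCoeff_sub_logCoeff]
  rfl

omit hR
include hd hσ hI hτ

lemma solO_isSolution {h : ℕ} (hh : 2 ≤ h) (s : smoothSections I F V) :
    ∃ f fbar : ℕ → ∀ x, V x,
      (solO g σ cov h τ s.1).HasForm h τ f fbar ∧
      IsInfiniteOrderSolution F g σ cov h τ f fbar ∧
      f 0 = s.1 ∧
      (solO g σ cov h τ s.1).reg (h - 1)
        = (1 / (((h - 1).factorial : ℝ) * ((h - 2).factorial : ℝ))) •
            weylAverage g σ cov (weightOf g h) τ (h - 1) s.1 ∧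
      fbar 0 = -((1 / (((h - 1).factorial : ℝ) * ((h - 2).factorial : ℝ))) •
            yPow g σ cov (weight (weightOf g h)) (h - 1) s.1) := by
  obtain ⟨m, rfl⟩ : ∃ m, h = m + 1 := ⟨h - 1, by lia⟩
  have hm : 1 ≤ m := by lia
  have hR := logRecurrence_regSeq m
  have hW := algWeyl_snd (Y := 𝐲) (N := ∂𝐲) (mulSection hτ) (weightOf g (m + 1)) m s
  have hlead : logCoeff 𝐲 (weightOf g (m + 1)) (logSeq m (logConst m)) s (m + 0)
      = -(logConst m • iterY 𝐲 (weightOf g (m + 1)) m s) := by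
    rw [logCoeff, hR.above, kernelCoeff_zero, mul_one, neg_smul, add_zero]
  have hc : 1 / ((m.factorial : ℝ) * ((m - 1).factorial : ℝ)) = logConst m := rfl
  rw [Nat.add_sub_cancel, show m + 1 - 2 = m - 1 by lia, hc, hcov.solO_eq g hd hσ hI hτ,
    hcov.weylAverage_eq g hd hσ hI hτ, hcov.yPow_eq g hd hσ hI]
  refine ⟨_, _, hcov.algSeries_hasForm g hd hσ hI hR hτ hW,
    hcov.algSeries_isInfiniteOrderSolution g hd hσ hI hR hτ hW, congrArg Subtype.val ?_, ?_,
    congrArg Subtype.val hlead⟩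
  · rw [freeCoeff, regCoeff_lt hm, logCoeff, hR.below 0 hm, zero_smul, map_zero, add_zero,
      iterY_zero, regSeq_zero hm, one_smul]
  · have hreg := regCoeff_add (Y := 𝐲) (N := ∂𝐲) (m := m) (P := regSeq m)
      (Q := fun j => logConst m * kernelCoeff m j) (w := weightOf g (m + 1)) (f := s)
      (W := algWeyl 𝐲 ∂𝐲 (mulSection hτ) (weightOf g (m + 1)) m s) 0
    rw [add_zero, regSeq_self, zero_smul, iterY_zero, kernelCoeff_zero, mul_one, Prod.mk_zero_zero,
      zero_add] at hreg
    exact (congrArg pairSection hreg).trans (map_smul _ _ _)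

lemma solO_formallyEqual {τ' : M → ℝ} (hτ' : CMDiff ∞ (fun x => Real.log (τ' x)))
    (hlog : ∀ s : smoothSections I F V, ∃ v, mulSection hτ s - mulSection hτ' s = 𝐱 v)
    {h : ℕ} (hh : 1 ≤ h) {s s' v : smoothSections I F V} (hs : s - s' = 𝐱 v) :
    FormallyEqual I F σ (solO g σ cov h τ s.1) (solO g σ cov h τ' s'.1) := by
  obtain ⟨m, rfl⟩ := Nat.exists_eq_add_of_le' hh
  rw [hcov.solO_eq g hd hσ hI hτ, hcov.solO_eq g hd hσ hI hτ']
  exact hcov.algSeries_formallyEqual g hd hσ hI (logRecurrence_regSeq m)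
    (fun a => Subtype.ext (smul_comm _ _ a.1)) hlog hs

lemma solObar_isSolution (s : smoothSections I F V) :
    ∃ f fbar : ℕ → ∀ x, V x,
      (solObar g σ cov τ s.1).HasForm 1 τ f fbar ∧
      IsInfiniteOrderSolution F g σ cov 1 τ f fbar ∧
      f 0 = 0 ∧ fbar 0 = s.1 := by
  have hR := logRecurrence_one
  have hW := algWeyl_snd (Y := 𝐲) (N := ∂𝐲) (mulSection hτ) (weightOf g 1) 0 s
  have hlog : logCoeff 𝐲 (weightOf g 1) (logSeq 0 (-1)) s 0 = s := by
    rw [logCoeff, ← Nat.add_zero 0, logSeq_add, kernelCoeff_zero, mul_one, neg_neg, one_smul]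
    rfl
  have hreg : (regCoeff 𝐲 ∂𝐲 (weightOf g 1) 0
      (fun k => PowerSeries.coeff k (PowerSeries.X * seriesH 1)) (fun j => -1 * kernelCoeff 0 j) s
      (algWeyl 𝐲 ∂𝐲 (mulSection hτ) (weightOf g 1) 0 s) 0).1 = -mulSection hτ s := by
    rw [regCoeff, tailCoeff_zero, iterY_zero, iterY_zero, kernelCoeff_zero, algWeyl, iterY_zero,
      iterY_zero, PowerSeries.coeff_zero_X_mul]
    simp only [Prod.fst_add, Prod.smul_fst]
    module
  have hfree : hcov.freeCoeff g hd hσ hI (mulSection hτ) (weightOf g 1) 0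
      (fun k => PowerSeries.coeff k (PowerSeries.X * seriesH 1)) (fun j => -1 * kernelCoeff 0 j)
      (logSeq 0 (-1)) s (algWeyl 𝐲 ∂𝐲 (mulSection hτ) (weightOf g 1) 0 s) 0 = 0 := by
    rw [freeCoeff, hlog, hreg, neg_add_cancel]
  rw [hcov.solObar_eq g hd hσ hI hτ]
  exact ⟨_, _, hcov.algSeries_hasForm g hd hσ hI hR hτ hW,
    hcov.algSeries_isInfiniteOrderSolution g hd hσ hI hR hτ hW, congrArg Subtype.val hfree,
    congrArg Subtype.val hlog⟩

lemma solObar_formallyEqual {τ' : M → ℝ} (hτ' : CMDiff ∞ (fun x => Real.log (τ' x)))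
    (hlog : ∀ s : smoothSections I F V, ∃ v, mulSection hτ s - mulSection hτ' s = 𝐱 v)
    {s s' v : smoothSections I F V} (hs : s - s' = 𝐱 v) :
    FormallyEqual I F σ (solObar g σ cov τ s.1) (solObar g σ cov τ' s'.1) := by
  rw [hcov.solObar_eq g hd hσ hI hτ, hcov.solObar_eq g hd hσ hI hτ']
  exact hcov.algSeries_formallyEqual g hd hσ hI logRecurrence_one
    (fun a => Subtype.ext (smul_comm _ _ a.1)) hlog hs

end IsSmoothConnection

end SolutionOperators

lemma contMDiff_log {E : Type*} [NormedAddCommGroup E] [NormedSpace ℝ E] {H : Type*}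
    [TopologicalSpace H] {I : ModelWithCorners ℝ E H} {M : Type*} [TopologicalSpace M]
    [ChartedSpace H M] {τ : M → ℝ} (hτ : ContMDiff I 𝓘(ℝ, ℝ) ∞ τ)
    (hpos : ∀ x, 0 < τ x) : ContMDiff I 𝓘(ℝ, ℝ) ∞ (fun x => Real.log (τ x)) := fun x =>
  ((Real.contDiffAt_log.mpr (hpos x).ne').contMDiffAt).comp x (hτ x)

lemma mvfderiv_ne_zero_of_scaleNormSq {E : Type*} [NormedAddCommGroup E] [NormedSpace ℝ E]
    [FiniteDimensional ℝ E] {H : Type*} [TopologicalSpace H] {I : ModelWithCorners ℝ E H}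
    {M : Type*} [TopologicalSpace M] [ChartedSpace H M] [IsManifold I ∞ M] {g : PseudoMetric I M}
    {σ : M → ℝ} (hd : dimR g ≠ 0) (hσ : CMDiff ∞ σ) {x : M} (hI : scaleNormSq g σ x ≠ 0)
    (hx : σ x = 0) : mvfderiv I σ x ≠ 0 := by
  intro h
  refine hI ?_
  rw [scaleNormSq_eq g hd ((hσ x).mdifferentiableAt (by simp)), h, hx]
  simp

lemma isSmoothConnection_covariantDerivative {E : Type*} [NormedAddCommGroup E] [NormedSpace ℝ E]
    {H : Type*} [TopologicalSpace H] {I : ModelWithCorners ℝ E H} {M : Type*} [TopologicalSpace M]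
    [ChartedSpace H M] [IsManifold I ∞ M] {F : Type*} [NormedAddCommGroup F] [NormedSpace ℝ F]
    {V : M → Type*} [TopologicalSpace (TotalSpace F V)] [∀ x, AddCommGroup (V x)]
    [∀ x, Module ℝ (V x)] [∀ x, TopologicalSpace (V x)] [∀ x, IsTopologicalAddGroup (V x)]
    [∀ x, ContinuousSMul ℝ (V x)] [FiberBundle F V] [VectorBundle ℝ F V]
    (cov : CovariantDerivative I F V)
    [h : CovariantDerivative.ContMDiffCovariantDerivative cov ∞] :
    IsSmoothConnection F cov.toFun where
  isCov := cov.isCovariantDerivativeOnUniv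
  smooth s hs := contMDiffOn_univ.mp (h.contMDiff.contMDiff (σ := s) hs.contMDiffOn)

section Boundary

variable {d : ℕ} [NeZero d] {M : Type*} [TopologicalSpace M]
  [ChartedSpace (EuclideanHalfSpace d) M] [IsManifold (𝓡∂ d) ∞ M] {g : PseudoMetric (𝓡∂ d) M}

lemma dimR_eq (g : PseudoMetric (𝓡∂ d) M) : dimR g = d := by
  rw [dimR, finrank_euclideanSpace_fin]

variable [T2Space M] [SecondCountableTopology M] {σ : M → ℝ}
  {F : Type*} [NormedAddCommGroup F] [NormedSpace ℝ F] [CompleteSpace F]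
  {V : M → Type*} [TopologicalSpace (TotalSpace F V)]
  [∀ x, AddCommGroup (V x)] [∀ x, Module ℝ (V x)] [∀ x, TopologicalSpace (V x)]
  [FiberBundle F V] [VectorBundle ℝ F V] [ContMDiffVectorBundle ∞ F V (𝓡∂ d)]
  (hd : dimR g ≠ 0) (hσ : ContMDiff (𝓡∂ d) 𝓘(ℝ, ℝ) ∞ σ)
  (hσ_zero : ∀ x, σ x = 0 ↔ (𝓡∂ d).IsBoundaryPoint x) (hI : ∀ x, scaleNormSq g σ x ≠ 0)
include hd hσ_zero hI

lemma exists_section_sub_eq {s s' : smoothSections (𝓡∂ d) F V}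
    (h : ∀ x, σ x = 0 → s.1 x = s'.1 x) : ∃ v, s - s' = mulSection hσ v := by
  obtain ⟨v, hv, hsub⟩ := exists_section_quotient (F := F) (V := V) hσ hσ_zero
    (fun x hx => mvfderiv_ne_zero_of_scaleNormSq hd hσ (hI x) hx) (s - s').2 fun x hx => by
      rw [Submodule.coe_sub, Pi.sub_apply, h x hx, sub_self]
  exact ⟨⟨v, hv⟩, Subtype.ext hsub⟩

lemma exists_mulSection_log_sub_eq {τ τ' : M → ℝ}
    (hτ : ContMDiff (𝓡∂ d) 𝓘(ℝ, ℝ) ∞ (fun x => Real.log (τ x)))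
    (hτ' : ContMDiff (𝓡∂ d) 𝓘(ℝ, ℝ) ∞ (fun x => Real.log (τ' x)))
    (h : ∀ x, σ x = 0 → τ x = τ' x) (s : smoothSections (𝓡∂ d) F V) :
    ∃ v, mulSection hτ s - mulSection hτ' s = mulSection hσ v :=
  exists_section_sub_eq hd hσ hσ_zero hI fun x hx => by
    rw [mulSection_apply, mulSection_apply, h x hx]

end Boundary

end

end TractorCalculus

open TractorCalculus in
theorem theorem5p8_general
    (d : ℕ) [NeZero d] (hd : 2 ≤ d)
    {M : Type*} [TopologicalSpace M] [T2Space M] [SecondCountableTopology M]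
    [ChartedSpace (EuclideanHalfSpace d) M] [IsManifold (𝓡∂ d) ∞ M]
    (g : PseudoMetric (𝓡∂ d) M)
    (σ : M → ℝ) (hσ : ContMDiff (𝓡∂ d) 𝓘(ℝ, ℝ) ∞ σ)
    (hσ_zero : ∀ x, σ x = 0 ↔ (𝓡∂ d).IsBoundaryPoint x)
    (hI : ∀ x, scaleNormSq g σ x ≠ 0)
    {F : Type*} [NormedAddCommGroup F] [NormedSpace ℝ F] [CompleteSpace F]
    {V : M → Type*} [TopologicalSpace (TotalSpace F V)]
    [∀ x, AddCommGroup (V x)] [∀ x, Module ℝ (V x)] [∀ x, TopologicalSpace (V x)]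
    [∀ x, IsTopologicalAddGroup (V x)] [∀ x, ContinuousSMul ℝ (V x)]
    [FiberBundle F V] [VectorBundle ℝ F V] [ContMDiffVectorBundle ∞ F V (𝓡∂ d)]
    (cov : CovariantDerivative (𝓡∂ d) F V)
    [CovariantDerivative.ContMDiffCovariantDerivative cov ∞] :
    (∀ h : ℕ, 2 ≤ h →
      (∀ (f₀ : ∀ x, V x) (τ : M → ℝ), SmoothSection (𝓡∂ d) F f₀ →
        ContMDiff (𝓡∂ d) 𝓘(ℝ, ℝ) ∞ τ → (∀ x, 0 < τ x) →
        ∃ f fbar : ℕ → ∀ x, V x,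
          (solO g σ cov h τ f₀).HasForm h τ f fbar ∧
          IsInfiniteOrderSolution F g σ cov h τ f fbar ∧
          f 0 = f₀ ∧
          (solO g σ cov h τ f₀).reg (h - 1)
            = (1 / (((h - 1).factorial : ℝ) * ((h - 2).factorial : ℝ))) •
                weylAverage g σ cov (weightOf g h) τ (h - 1) f₀ ∧
          fbar 0 = -((1 / (((h - 1).factorial : ℝ) * ((h - 2).factorial : ℝ))) •
                yPow g σ cov (weight (weightOf g h)) (h - 1) f₀)) ∧
      (∀ (f₀ f₀' : ∀ x, V x) (τ τ' : M → ℝ),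
        SmoothSection (𝓡∂ d) F f₀ → SmoothSection (𝓡∂ d) F f₀' →
        ContMDiff (𝓡∂ d) 𝓘(ℝ, ℝ) ∞ τ → (∀ x, 0 < τ x) →
        ContMDiff (𝓡∂ d) 𝓘(ℝ, ℝ) ∞ τ' → (∀ x, 0 < τ' x) →
        (∀ x, σ x = 0 → f₀ x = f₀' x) → (∀ x, σ x = 0 → τ x = τ' x) →
        FormallyEqual (𝓡∂ d) F σ (solO g σ cov h τ f₀) (solO g σ cov h τ' f₀'))) ∧
    (∀ (f₀ : ∀ x, V x) (τ : M → ℝ), SmoothSection (𝓡∂ d) F f₀ →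
      ContMDiff (𝓡∂ d) 𝓘(ℝ, ℝ) ∞ τ → (∀ x, 0 < τ x) →
      ∃ f fbar : ℕ → ∀ x, V x,
        (solObar g σ cov τ f₀).HasForm 1 τ f fbar ∧
        IsInfiniteOrderSolution F g σ cov 1 τ f fbar ∧
        f 0 = 0 ∧ fbar 0 = f₀) ∧
    (∀ (f₀ f₀' : ∀ x, V x) (τ τ' : M → ℝ),
      SmoothSection (𝓡∂ d) F f₀ → SmoothSection (𝓡∂ d) F f₀' →
      ContMDiff (𝓡∂ d) 𝓘(ℝ, ℝ) ∞ τ → (∀ x, 0 < τ x) →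
      ContMDiff (𝓡∂ d) 𝓘(ℝ, ℝ) ∞ τ' → (∀ x, 0 < τ' x) →
      (∀ x, σ x = 0 → f₀ x = f₀' x) → (∀ x, σ x = 0 → τ x = τ' x) →
      FormallyEqual (𝓡∂ d) F σ (solObar g σ cov τ f₀) (solObar g σ cov τ' f₀')) := by
  have hd0 : dimR g ≠ 0 := by
    rw [dimR_eq]
    exact_mod_cast (by lia : d ≠ 0)
  have hcov := isSmoothConnection_covariantDerivative cov
  refine ⟨fun h hh => ⟨fun f₀ τ hf hτ hpos =>
      hcov.solO_isSolution g hd0 hσ hI (contMDiff_log hτ hpos) hh ⟨f₀, hf⟩,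
    fun f₀ f₀' τ τ' hf hf' hτ hpos hτ' hpos' hf₀ hτ₀ => ?_⟩, fun f₀ τ hf hτ hpos =>
      hcov.solObar_isSolution g hd0 hσ hI (contMDiff_log hτ hpos) ⟨f₀, hf⟩,
    fun f₀ f₀' τ τ' hf hf' hτ hpos hτ' hpos' hf₀ hτ₀ => ?_⟩
  all_goals
    have hlog := exists_mulSection_log_sub_eq (F := F) (V := V) hd0 hσ hσ_zero hI
      (contMDiff_log hτ hpos) (contMDiff_log hτ' hpos') hτ₀
    obtain ⟨v, hv⟩ := exists_section_sub_eq (s := (⟨f₀, hf⟩ : smoothSections (𝓡∂ d) F V))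
      (s' := ⟨f₀', hf'⟩) hd0 hσ hσ_zero hI hf₀
  · exact (hcov.solO_formallyEqual g hd0 hσ hI _ _ hlog (one_le_two.trans hh) hv :)
  · exact (hcov.solObar_formallyEqual g hd0 hσ hI _ _ hlog hv :)

open TractorCalculus in
theorem theorem5p8
    -- a manifold with boundary of dimension `d ≥ 3`, and a metric `g` of the conformal class
    (d : ℕ) [NeZero d] (hd : 3 ≤ d)
    {M : Type*} [TopologicalSpace M] [T2Space M] [SecondCountableTopology M]
    [ChartedSpace (EuclideanHalfSpace d) M] [IsManifold (𝓡∂ d) ∞ M]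
    (g : PseudoMetric (𝓡∂ d) M)
    -- the defining density `σ ≥ 0` of `Σ = ∂M`, with `I²` nowhere zero
    (σ : M → ℝ) (hσ : ContMDiff (𝓡∂ d) 𝓘(ℝ, ℝ) ∞ σ) (hσ_nonneg : ∀ x, 0 ≤ σ x)
    (hσ_zero : ∀ x, σ x = 0 ↔ (𝓡∂ d).IsBoundaryPoint x)
    (hI : ∀ x, scaleNormSq g σ x ≠ 0)
    -- a tractor bundle with its tractor connection
    {F : Type*} [NormedAddCommGroup F] [NormedSpace ℝ F] [FiniteDimensional ℝ F]
    {V : M → Type*} [TopologicalSpace (TotalSpace F V)]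
    [∀ x, AddCommGroup (V x)] [∀ x, Module ℝ (V x)] [∀ x, TopologicalSpace (V x)]
    [∀ x, IsTopologicalAddGroup (V x)] [∀ x, ContinuousSMul ℝ (V x)]
    [FiberBundle F V] [VectorBundle ℝ F V] [ContMDiffVectorBundle ∞ F V (𝓡∂ d)]
    (cov : CovariantDerivative (𝓡∂ d) F V)
    [CovariantDerivative.ContMDiffCovariantDerivative cov ∞]
    (hV : IsTractorBundle F g cov) :
    -- the case `h₀ ≥ 2`
    (∀ h : ℕ, 2 ≤ h →
      (∀ (f₀ : ∀ x, V x) (τ : M → ℝ), SmoothSection (𝓡∂ d) F f₀ →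
        ContMDiff (𝓡∂ d) 𝓘(ℝ, ℝ) ∞ τ → (∀ x, 0 < τ x) →
        ∃ f fbar : ℕ → ∀ x, V x,
          (solO g σ cov h τ f₀).HasForm h τ f fbar ∧
          IsInfiniteOrderSolution F g σ cov h τ f fbar ∧
          f 0 = f₀ ∧
          -- no free term of order `h - 1`: only the logarithmic terms of `𝒪` contribute there
          (solO g σ cov h τ f₀).reg (h - 1)
            = (1 / (((h - 1).factorial : ℝ) * ((h - 2).factorial : ℝ))) •
                weylAverage g σ cov (weightOf g h) τ (h - 1) f₀ ∧
          fbar 0 = -((1 / (((h - 1).factorial : ℝ) * ((h - 2).factorial : ℝ))) •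
                yPow g σ cov (weight (weightOf g h)) (h - 1) f₀)) ∧
      (∀ (f₀ f₀' : ∀ x, V x) (τ τ' : M → ℝ),
        SmoothSection (𝓡∂ d) F f₀ → SmoothSection (𝓡∂ d) F f₀' →
        ContMDiff (𝓡∂ d) 𝓘(ℝ, ℝ) ∞ τ → (∀ x, 0 < τ x) →
        ContMDiff (𝓡∂ d) 𝓘(ℝ, ℝ) ∞ τ' → (∀ x, 0 < τ' x) →
        (∀ x, σ x = 0 → f₀ x = f₀' x) → (∀ x, σ x = 0 → τ x = τ' x) →
        FormallyEqual (𝓡∂ d) F σ (solO g σ cov h τ f₀) (solO g σ cov h τ' f₀'))) ∧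
    -- the case `h₀ = 1`
    (∀ (f₀ : ∀ x, V x) (τ : M → ℝ), SmoothSection (𝓡∂ d) F f₀ →
      ContMDiff (𝓡∂ d) 𝓘(ℝ, ℝ) ∞ τ → (∀ x, 0 < τ x) →
      ∃ f fbar : ℕ → ∀ x, V x,
        (solObar g σ cov τ f₀).HasForm 1 τ f fbar ∧
        IsInfiniteOrderSolution F g σ cov 1 τ f fbar ∧
        f 0 = 0 ∧ fbar 0 = f₀) ∧
    (∀ (f₀ f₀' : ∀ x, V x) (τ τ' : M → ℝ),
      SmoothSection (𝓡∂ d) F f₀ → SmoothSection (𝓡∂ d) F f₀' →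
      ContMDiff (𝓡∂ d) 𝓘(ℝ, ℝ) ∞ τ → (∀ x, 0 < τ x) →
      ContMDiff (𝓡∂ d) 𝓘(ℝ, ℝ) ∞ τ' → (∀ x, 0 < τ' x) →
      (∀ x, σ x = 0 → f₀ x = f₀' x) → (∀ x, σ x = 0 → τ x = τ' x) →
      FormallyEqual (𝓡∂ d) F σ (solObar g σ cov τ f₀) (solObar g σ cov τ' f₀')) := by
  have := FiniteDimensional.complete ℝ F
  exact theorem5p8_general d (by lia) g σ hσ hσ_zero hI cov
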